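/- \textbf{Setting.} Let $p\ge 1$, $q\ge 2$, $p+q>4$, $n=p+q-2$, $\lambda\in\mathbb C$, and let $\epsilon_i=1$ for $1\le i\le p-1$, $\epsilon_i=-1$ for $p\le i\le n$. Let $G=SO_o(p,q)$ be the identity component of the orthogonal group of the form $2x_0x_{n+1}+\sum_{i=1}^n\epsilon_ix_i^2$ on $\mathbb R^{n+2}$, $G'=SO_o(p,q-1)$ the stabilizer of $e_n$ in $G$, $P$ and $P_-$ the stabilizers in $G$ of the lines $\mathbb Re_0$ and $\mathbb Re_{n+1}$, $L=P\cap P_-$, $L'=L\cap G'$; $\mathfrak g,\mathfrak g',\mathfrak p$ are the complexified Lie algebras of $G,G',P$, $\mathfrak n_+$ is the nilradical of $\mathfrak p$, and $\mathfrak n_+'=\mathfrak n_+\cap\mathfrak g'$. Let $N_\pm$ be the unipotent radicals of $P$ and $P_-$; we identify $N_-\simeq\mathfrak n_-(\mathbb R)\simeq\mathbb R^n_x$ via $\exp$ and $\mathfrak n_+(\mathbb R)\simeq\mathbb R^n_\xi$ by the standard coordinates. Let $\mathbb C_\lambda$ be the character $p\mapsto a(p)^\lambda$ of $P$, where $p e_0=\pm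 a(p)e_0$, $a(p)>0$, with basis vector $1_\lambda$, and let $M(\lambda)=U(\mathfrak g)\otimes_{U(\mathfrak p)}\mathbb C_\lambda$ be the generalized Verma module, with $L'$ acting by $\ell(u\otimes v)=\mathrm{Ad}(\ell)u\otimes\ell v$. Let $d\pi$ be the action of $\mathfrak g$ on $C^\infty(\mathbb R^n_x)$ given by $(d\pi(Z)f)(x)=\frac{d}{dt}\big|_{t=0}\tilde f(\exp(-tZ)\exp x)$ for real $Z$, where $\tilde f(n_-p)=a(p)^{\lambda}f(n_-)$ for $n_-\in N_-$, $p\in P$ (the representation induced from $\mathbb C_{-\lambda}=\mathbb C_\lambda^\vee$), extended complex linearly. Let $d\pi^\vee(Z)T=-T\circ d\pi(Z)$ be the dual action on distributions supported at $0$, and let $d\tilde\pi$ be the action on $\mathrm{Pol}[\xi_1,\dots,\xi_n]\otimes\mathbb C_\lambda$ obtained from it by the Fourier transform $T\mapsto T_x(e^{i\langle x,\xi\rangle})$, $\langle x,\xi\rangle=\sum_jx_j\xi_j$. Put $$\mathrm{Sol}=\mathrm{Sol}(\mathfrak g,\mathfrak g';\mathbb C_\lambda)=\{f\in\mathrm{Pol}[\xi_1,\dots,\xi_n]\otimes\mathbb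 C_\lambda:\ d\tilde\pi(Z)f=0\ \text{for all }Z\in\mathfrak n_+'\},$$ with $L'$ acting by $f\otimes v\mapsto f(\mathrm{Ad}(\ell)^{-1}\cdot)\otimes\ell v$. Let $\varphi:\mathrm{Pol}[\xi_1,\dots,\xi_n]\otimes\mathbb C_\lambda\to M(\lambda)$ be the map given by the inverse Fourier transform and the identification of $M(\lambda)$ with the distributions supported at $0$; it is the unique linear isomorphism with $\varphi(1\otimes 1_\lambda)=1\otimes 1_\lambda$ that intertwines $d\tilde\pi$ with the $\mathfrak g$-action on $M(\lambda)$. Let $$P_j(\lambda)=-i\Big(\tfrac12\epsilon_j\xi_j\square+(\lambda-E)\partial_{\xi_j}\Big),\qquad \square=\sum_{i=1}^n\epsilon_i\partial_{\xi_i}^2,\quad E=\sum_{k=1}^n\xi_k\partial_{\xi_k}.$$ With $(a)_k=a(a+1)\cdots(a+k-1)$, let $C_l^\alpha(x)=\sum_{k=0}^{[l/2]}(-1)^k\frac{(\alpha)_{l-k}}{k!\,(l-2k)!}(2x)^{l-2k}$ be the Gegenbauer polynomial, and let $\widetilde C_l^{\alpha}=C_l^\alpha/(\alpha)_{[(l+1)/2]}$,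 where the common factor is cancelled so that this is defined for all $\alpha\in\mathbb C$. Let $\widetilde{\mathcal C}_l^\alpha$ be the polynomial with $\widetilde{\mathcal C}_l^\alpha(x^2)=x^l\widetilde C_l^\alpha(x^{-1})$. For $K\in\mathbb N=\{0,1,2,\dots\}$ put $$w_{K,\lambda}=c_K\,\xi_n^K\,\widetilde{\mathcal C}_K^{-\lambda-\frac{n-1}2}\Big(-\frac{\epsilon_n\sum_{i=1}^{n-1}\epsilon_i\xi_i^2}{\xi_n^2}\Big)\otimes 1_\lambda,\qquad c_{2N}=N!,\quad c_{2N+1}=\tfrac12N!.$$ Let $\mathcal H^k(\mathbb R^{p-1,q-1})$ (resp. $\mathcal H^k(\mathbb R^{p-1,q-2})$) be the space of complex homogeneous polynomials of degree $k$ in $\xi_1,\dots,\xi_n$ (resp. $\xi_1,\dots,\xi_{n-1}$) killed by $\square$ (resp. by $\sum_{i=1}^{n-1}\epsilon_i\partial_{\xi_i}^2$). For $\lambda\in\mathbb N$ and $1\le j\le\lambda+1$ let $H_j'\subset\mathcal H^{\lambda+1}(\mathbb R^{p-1,q-1})\otimes\mathbb C_\lambda$ be the sum of the images of all $O(p-1,q-2)$-homomorphisms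 $\mathcal H^j(\mathbb R^{p-1,q-2})\to\mathcal H^{\lambda+1}(\mathbb R^{p-1,q-1})\otimes\mathbb C_\lambda$, where $O(p-1,q-2)$ acts trivially on $\mathbb C_\lambda$. \textbf{Theorem.} (1) $\mathrm{Sol}=\{f\otimes1_\lambda:\ P_j(\lambda)f=0\ \text{for } 1\le j\le n-1\}$. (2) All $w_{K,\lambda}$ are non-zero. If $\lambda\notin\mathbb N$, then $\mathrm{Sol}=\bigoplus_{K=0}^\infty\mathbb Cw_{K,\lambda}$. (3) If $\lambda\in\mathbb N$, then each $H_j'$ $(1\le j\le\lambda+1)$ is isomorphic to $\mathcal H^j(\mathbb R^{p-1,q-2})$ as an $O(p-1,q-2)$-module, and $\mathrm{Sol}=\bigoplus_{K=0}^\infty\mathbb Cw_{K,\lambda}\oplus\bigoplus_{j=1}^{\lambda+1}H_j'$. Moreover, for $1\le j\le\lambda+1$, $\varphi(H_j')$ is contained in the $\mathfrak g'$-submodule of $M(\lambda)$ generated by $\varphi(w_{\lambda+1-j,\lambda})$. In all cases, $\varphi$ restricts to an $L'$-isomorphism of $\mathrm{Sol}$ onto the space of singular vectors $M(\lambda)^{\mathfrak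 n_+'}=\{v\in M(\lambda):Zv=0\ \text{for all }Z\in\mathfrak n_+'\}$. -/

import Mathlib

open scoped TensorProduct
open Matrix

attribute [local instance 100] LieRing.ofAssociativeRing

noncomputable section

namespace FMethod

/-! ### Conventions

`r = p - 1` and `m = n - 1 = p + q - 3`.  The quadratic form on `ℝ^{p+q}` is
`2 x₀ x_{n+1} + ∑ εᵢ xᵢ²`; the middle coordinates `x₁, …, x_n` are indexed by `Fin (m + 1)`,
so that `x_n` is the coordinate `Fin.last m`, and `x₁, …, x_{n-1}` are the coordinates
`Fin.castSucc j` with `j : Fin m`. -/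

/-- The signs `ε`: the first `r` of them are `1`, the others are `-1`. -/
def eps (R : Type*) [Ring R] (r : ℕ) {n : ℕ} (i : Fin n) : R := if i.val < r then 1 else -1

/-- Index set of the coordinates `x₀, (x₁, …, x_n), x_{n+1}`. -/
abbrev Idx (m : ℕ) := Unit ⊕ (Fin (m + 1) ⊕ Unit)

abbrev e0 {m : ℕ} : Idx m := Sum.inl ()
abbrev mid {m : ℕ} (i : Fin (m + 1)) : Idx m := Sum.inr (Sum.inl i)
abbrev eInf {m : ℕ} : Idx m := Sum.inr (Sum.inr ())

/-- Gram matrix of the form `2 x₀ x_{n+1} + ∑ εᵢ xᵢ²`. -/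
def gram (R : Type*) [Ring R] (r m : ℕ) : Matrix (Idx m) (Idx m) R := fun x y =>
  match x, y with
  | Sum.inl _, Sum.inr (Sum.inr _) => 1
  | Sum.inr (Sum.inr _), Sum.inl _ => 1
  | Sum.inr (Sum.inl i), Sum.inr (Sum.inl j) => if i = j then eps R r i else 0
  | _, _ => 0

/-! ### Lie algebras and groups -/

/-- `𝔤 = 𝔰𝔬(p,q) ⊗ ℂ`. -/
abbrev g (r m : ℕ) : LieSubalgebra ℂ (Matrix (Idx m) (Idx m) ℂ) :=
  skewAdjointMatricesLieSubalgebra (gram ℂ r m)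

/-- Membership in `𝔤' = 𝔰𝔬(p,q-1) ⊗ ℂ`, the stabilizer in `𝔤` of the vector `e_n`. -/
def InGPrime {r m : ℕ} (Z : g r m) : Prop := ∀ x, Z.1 x (mid (Fin.last m)) = 0

/-- Membership in the parabolic subalgebra `𝔭`, the stabilizer in `𝔤` of the line `ℂ e₀`. -/
def InP {r m : ℕ} (Z : g r m) : Prop := ∀ x, x ≠ e0 → Z.1 x e0 = 0

/-- Membership in the nilradical `𝔫₊` of `𝔭`: the elements of `𝔭` whose component in the
Levi part `𝔩` (diagonal blocks) vanishes. -/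
def InNPlus {r m : ℕ} (Z : g r m) : Prop :=
  InP Z ∧ Z.1 e0 e0 = 0 ∧ ∀ i j, Z.1 (mid i) (mid j) = 0

/-- Membership in `𝔫₊' = 𝔫₊ ∩ 𝔤'`. -/
def InNPlusPrime {r m : ℕ} (Z : g r m) : Prop := InNPlus Z ∧ InGPrime Z

/-- The real orthogonal group `O(p,q)` of the quadratic form. -/
def orthGroup (r m : ℕ) : Subgroup (GL (Idx m) ℝ) where
  carrier := {a | (a.1)ᵀ * gram ℝ r m * a.1 = gram ℝ r m}
  one_mem' := by simp
  mul_mem' := by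
    intro a b ha hb
    simp only [Set.mem_ofPred_eq] at ha hb ⊢
    calc ((a * b).1)ᵀ * gram ℝ r m * (a * b).1
        = (b.1)ᵀ * ((a.1)ᵀ * gram ℝ r m * a.1) * b.1 := by
          simp [Matrix.transpose_mul, Matrix.mul_assoc]
      _ = gram ℝ r m := by rw [ha, hb]
  inv_mem' := by
    intro a ha
    simp only [Set.mem_ofPred_eq] at ha ⊢
    have h1 : a.1 * (a⁻¹).1 = 1 := by rw [← Units.val_mul, mul_inv_cancel]; rfl
    have h2 : ((a⁻¹).1)ᵀ * (a.1)ᵀ = 1 := by rw [← Matrix.transpose_mul, h1, transpose_one]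
    calc ((a⁻¹).1)ᵀ * gram ℝ r m * (a⁻¹).1
        = ((a⁻¹).1)ᵀ * ((a.1)ᵀ * gram ℝ r m * a.1) * (a⁻¹).1 := by rw [ha]
      _ = (((a⁻¹).1)ᵀ * (a.1)ᵀ) * gram ℝ r m * (a.1 * (a⁻¹).1) := by
          simp only [Matrix.mul_assoc]
      _ = gram ℝ r m := by rw [h1, h2, Matrix.one_mul, Matrix.mul_one]

/-- `G = SO_o(p,q)`, the identity component of `O(p,q)`. -/
def G (r m : ℕ) : Subgroup (GL (Idx m) ℝ) :=
  (Subgroup.connectedComponentOfOne (orthGroup r m)).map (orthGroup r m).subtype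

/-- Membership in `L' = L ∩ G'`: elements of `G` preserving the lines spanned by `e₀` and by
`e_{n+1}` (i.e. lying in `L = P ∩ P₋`) and fixing the vector `e_n` (i.e. lying in `G'`). -/
def InLPrime (r : ℕ) {m : ℕ} (a : GL (Idx m) ℝ) : Prop :=
  a ∈ G r m ∧ (∀ x, x ≠ e0 → a.1 x e0 = 0) ∧ (∀ x, x ≠ eInf → a.1 x eInf = 0) ∧
    ∀ x, a.1 x (mid (Fin.last m)) = if x = mid (Fin.last m) then 1 else 0

/-! ### The representation `dπ` of `𝔤` in the non-compact picture -/

/-- `exp X ∈ N₋` for `X ∈ 𝔫₋(ℝ) ≅ ℝⁿ`. -/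
def nMinus (r : ℕ) {m : ℕ} (X : Fin (m + 1) → ℝ) : Matrix (Idx m) (Idx m) ℝ := fun x y =>
  match x, y with
  | Sum.inl _, Sum.inl _ => 1
  | Sum.inl _, Sum.inr _ => 0
  | Sum.inr (Sum.inl i), Sum.inl _ => X i
  | Sum.inr (Sum.inl i), Sum.inr (Sum.inl j) => if i = j then 1 else 0
  | Sum.inr (Sum.inl _), Sum.inr (Sum.inr _) => 0
  | Sum.inr (Sum.inr _), Sum.inl _ => -(∑ i, eps ℝ r i * X i ^ 2) / 2
  | Sum.inr (Sum.inr _), Sum.inr (Sum.inl j) => -(eps ℝ r j * X j)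
  | Sum.inr (Sum.inr _), Sum.inr (Sum.inr _) => 1

/-- A function `f` on `𝔫₋(ℝ) ≅ N₋`, extended to the open cell `N₋ P` as a section of the line
bundle induced from `V = ℂ_{-λ}` (so that `V^∨ = ℂ_λ`):
`f̃ (n₋ p) = p⁻¹ · f(n₋) = a(p)^λ f(n₋)`, where `a(p) = |p₀₀|`; see `cellExt_mul`. -/
def cellExt {m : ℕ} (lam : ℂ) (f : (Fin (m + 1) → ℝ) → ℂ) (a : Matrix (Idx m) (Idx m) ℝ) : ℂ :=
  ((|a e0 e0| : ℝ) : ℂ) ^ lam * f (fun i => a (mid i) e0 / a e0 e0)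

theorem cellExt_mul (r : ℕ) {m : ℕ} (lam : ℂ) (f : (Fin (m + 1) → ℝ) → ℂ)
    (X : Fin (m + 1) → ℝ) (b : Matrix (Idx m) (Idx m) ℝ) (hb : ∀ x, x ≠ e0 → b x e0 = 0)
    (hb0 : b e0 e0 ≠ 0) :
    cellExt lam f (nMinus r X * b) = ((|b e0 e0| : ℝ) : ℂ) ^ lam * f X := by
  have h (x : Idx m) : (nMinus r X * b) x e0 = nMinus r X x e0 * b e0 e0 := by
    rw [Matrix.mul_apply]
    exact Finset.sum_eq_single _ (fun y _ hy => by rw [hb y hy, mul_zero]) (by simp)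
  simp [cellExt, h, nMinus, hb0]

/-- `(dπ(Z) f)(X) = d/dt|_{t=0} f̃(exp(-tZ) exp X)` for a real matrix `Z`. -/
def dpiReal (r : ℕ) {m : ℕ} (lam : ℂ) (Z : Matrix (Idx m) (Idx m) ℝ)
    (f : (Fin (m + 1) → ℝ) → ℂ) (X : Fin (m + 1) → ℝ) : ℂ :=
  deriv (fun t : ℝ => cellExt lam f (NormedSpace.exp (-(t • Z)) * nMinus r X)) 0

/-- Complex linear extension of `dπ` to `𝔤`. -/
def dpi {r m : ℕ} (lam : ℂ) (Z : g r m) (f : (Fin (m + 1) → ℝ) → ℂ)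
    (X : Fin (m + 1) → ℝ) : ℂ :=
  dpiReal r lam (Z.1.map Complex.re) f X + Complex.I * dpiReal r lam (Z.1.map Complex.im) f X

/-! ### Distributions supported at the origin and the Fourier transform -/

/-- The polynomials on `𝔫₊`, in the variables `ξ₁, …, ξ_n`; the tensor product with the line
`ℂ_λ` is suppressed by `1_λ = 1`. -/
abbrev Pol (n : ℕ) := MvPolynomial (Fin n) ℂ

/-- The partial derivative `∂f/∂x_j`. -/
def pd {n : ℕ} (j : Fin n) (f : (Fin n → ℝ) → ℂ) (X : Fin n → ℝ) : ℂ :=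
  fderiv ℝ f X (Pi.single j 1)

/-- The iterated partial derivative `∂^α f`. -/
def pdMulti {n : ℕ} (α : Fin n →₀ ℕ) (f : (Fin n → ℝ) → ℂ) : (Fin n → ℝ) → ℂ :=
  (List.finRange n).foldr (fun j h => (pd j)^[α j] h) f

/-- The exponential `x ↦ e^{i⟨x,ξ⟩}`. -/
def expI {n : ℕ} (ξ : Fin n → ℝ) (X : Fin n → ℝ) : ℂ :=
  Complex.exp (Complex.I * ((∑ j, X j * ξ j : ℝ) : ℂ))

/-- The inverse Fourier transform of a polynomial `f(ξ)`: the distribution supported at the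
origin whose value on a function `h` is `(f(-i ∂_x) h)(0)`; see `fourier_invFourier`. -/
def invFourier {n : ℕ} (h : (Fin n → ℝ) → ℂ) : Pol n →ₗ[ℂ] ℂ :=
  (MvPolynomial.basisMonomials (Fin n) ℂ).constr ℂ
    (fun α => (-Complex.I) ^ (α.sum fun _ k => k) * pdMulti α h 0)

theorem pd_smul_expI {n : ℕ} (j : Fin n) (ξ : Fin n → ℝ) (c : ℂ) :
    pd j (fun X => c * expI ξ X) = fun X => (Complex.I * ξ j * c) * expI ξ X := by
  funext X
  have h1 : HasFDerivAt (fun X : Fin n → ℝ => ∑ j, X j * ξ j)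
      (∑ j, ξ j • (ContinuousLinearMap.proj (R := ℝ) (φ := fun _ : Fin n => ℝ) j)) X := by
    refine HasFDerivAt.fun_sum fun k _ => ?_
    exact (hasFDerivAt_apply k X).mul_const (ξ k)
  have h2 := ((Complex.ofRealCLM.hasFDerivAt.comp X h1).const_mul Complex.I).cexp.const_mul c
  have h3 : fderiv ℝ (fun X => c * expI ξ X) X = _ := HasFDerivAt.fderiv h2
  rw [pd, h3]
  simp [expI, Pi.single_apply]
  ring

theorem pdMulti_expI {n : ℕ} (α : Fin n →₀ ℕ) (ξ : Fin n → ℝ) :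
    pdMulti α (expI ξ) =
      fun X => (∏ j, (Complex.I * (ξ j : ℂ)) ^ α j) * expI ξ X := by
  have hit (j : Fin n) (k : ℕ) (c : ℂ) : (pd j)^[k] (fun X => c * expI ξ X) =
      fun X => ((Complex.I * ξ j) ^ k * c) * expI ξ X := by
    induction k with
    | zero => simp
    | succ k ih => rw [Function.iterate_succ_apply', ih, pd_smul_expI]; funext X; ring
  have hl (l : List (Fin n)) : l.foldr (fun j h => (pd j)^[α j] h) (expI ξ) =
      fun X => ((l.map fun j => (Complex.I * (ξ j : ℂ)) ^ α j).prod) * expI ξ X := by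
    induction l with
    | nil => simp
    | cons a l ih => rw [List.foldr_cons, ih, hit]; simp
  rw [pdMulti, hl]
  funext X
  rw [← List.ofFn_eq_map, List.prod_ofFn]

/-- `invFourier` is inverse to the Fourier transform `T ↦ (ξ ↦ T_x(e^{i⟨x,ξ⟩}))`. -/
theorem fourier_invFourier {n : ℕ} (f : Pol n) (ξ : Fin n → ℝ) :
    invFourier (expI ξ) f = MvPolynomial.eval (fun j => (ξ j : ℂ)) f := by
  have : invFourier (expI ξ) = (MvPolynomial.aeval (fun j => (ξ j : ℂ))).toLinearMap := by
    refine (MvPolynomial.basisMonomials (Fin n) ℂ).ext fun α => ?_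
    rw [invFourier, Module.Basis.constr_basis, pdMulti_expI]
    have hs : (α.sum fun _ k => k) = ∑ j, α j := Finsupp.sum_fintype _ _ (fun _ => rfl)
    have h0 : expI ξ (0 : Fin n → ℝ) = 1 := by simp [expI]
    simp only [MvPolynomial.coe_basisMonomials, AlgHom.toLinearMap_apply,
      MvPolynomial.aeval_monomial, map_one, one_mul, h0, mul_one, hs]
    rw [Finsupp.prod_fintype _ _ (fun _ => pow_zero _), ← Finset.prod_pow_eq_pow_sum,
      ← Finset.prod_mul_distrib]
    refine Finset.prod_congr rfl fun j _ => ?_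
    rw [← mul_pow, ← mul_assoc]
    simp
  rw [this]
  simp [MvPolynomial.aeval_eq_eval]

/-- The action `dπ̃(Z) = F ∘ dπ^∨(Z) ∘ F⁻¹` of `Z ∈ 𝔤` on polynomials, where
`dπ^∨(Z) T = - T ∘ dπ(Z)` on distributions and `F T (ξ) = T_x(e^{i⟨x,ξ⟩})`; its value is
given as a function of `ξ ∈ 𝔫₊(ℝ) ≅ ℝⁿ`. -/
def dpiTilde {r m : ℕ} (lam : ℂ) (Z : g r m) (f : Pol (m + 1)) (ξ : Fin (m + 1) → ℝ) : ℂ :=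
  -invFourier (dpi lam Z (expI ξ)) f

/-- `Sol(𝔤, 𝔤'; ℂ_λ) = {f : dπ̃(Z) f = 0 for all Z ∈ 𝔫₊'}`. -/
def Sol (r m : ℕ) (lam : ℂ) : Submodule ℂ (Pol (m + 1)) where
  carrier := {f | ∀ Z : g r m, InNPlusPrime Z → ∀ ξ, dpiTilde lam Z f ξ = 0}
  zero_mem' := by intro Z _ ξ; simp [dpiTilde]
  add_mem' := by
    intro f h hf hh Z hZ ξ
    have h1 := hf Z hZ ξ
    have h2 := hh Z hZ ξ
    simp only [dpiTilde, neg_eq_zero] at h1 h2 ⊢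
    rw [map_add, h1, h2, add_zero]
  smul_mem' := by
    intro c f hf Z hZ ξ
    have h1 := hf Z hZ ξ
    simp only [dpiTilde, neg_eq_zero] at h1 ⊢
    rw [map_smul, h1, smul_zero]

/-! ### Differential operators on polynomials -/

/-- `□ = ∑ εᵢ ∂²/∂ξᵢ²`, with `r` signs `+1`. -/
def box (r n : ℕ) : Pol n →ₗ[ℂ] Pol n :=
  ∑ i : Fin n, (eps ℂ r i) • ((MvPolynomial.pderiv i).toLinearMap ∘ₗ
    (MvPolynomial.pderiv i).toLinearMap)

/-- The Euler operator `E = ∑ ξₖ ∂/∂ξₖ`. -/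
def euler (n : ℕ) : Pol n →ₗ[ℂ] Pol n :=
  ∑ k : Fin n, LinearMap.mulLeft ℂ (MvPolynomial.X k) ∘ₗ (MvPolynomial.pderiv k).toLinearMap

/-- `P_j(λ) = -i (½ ε_j ξ_j □ + (λ - E) ∂_j)`. -/
def P (r n : ℕ) (lam : ℂ) (j : Fin n) : Pol n →ₗ[ℂ] Pol n :=
  (-Complex.I) • ((eps ℂ r j / 2) • (LinearMap.mulLeft ℂ (MvPolynomial.X j) ∘ₗ box r n) +
    (lam • LinearMap.id - euler n) ∘ₗ (MvPolynomial.pderiv j).toLinearMap)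

/-! ### Gegenbauer polynomials and the vectors `w_{K,λ}` -/

/-- The Pochhammer symbol `(a)_k = a (a+1) ⋯ (a+k-1)`. -/
def poch (a : ℂ) (k : ℕ) : ℂ := ∏ i ∈ Finset.range k, (a + i)

/-- The Gegenbauer polynomial
`C_l^α(x) = ∑_{k ≤ l/2} (-1)^k (α)_{l-k} / (k! (l-2k)!) (2x)^{l-2k}`. -/
def gegenbauer (α : ℂ) (l : ℕ) : Polynomial ℂ :=
  ∑ k ∈ Finset.range (l / 2 + 1),
    Polynomial.C ((-1) ^ k * poch α (l - k) / (k.factorial * (l - 2 * k).factorial)) *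
      (2 * Polynomial.X) ^ (l - 2 * k)

/-- The renormalized Gegenbauer polynomial `C_l^α / (α)_{[(l+1)/2]}`, where the common factor
is cancelled so that it is defined for every `α`; see `poch_mul_gegenbauerRen`. -/
def gegenbauerRen (α : ℂ) (l : ℕ) : Polynomial ℂ :=
  ∑ k ∈ Finset.range (l / 2 + 1),
    Polynomial.C ((-1) ^ k * poch (α + ((l + 1) / 2 : ℕ)) (l - k - (l + 1) / 2) /
      (k.factorial * (l - 2 * k).factorial)) * (2 * Polynomial.X) ^ (l - 2 * k)

theorem poch_mul_gegenbauerRen (α : ℂ) (l : ℕ) :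
    Polynomial.C (poch α ((l + 1) / 2)) * gegenbauerRen α l = gegenbauer α l := by
  rw [gegenbauerRen, gegenbauer, Finset.mul_sum]
  refine Finset.sum_congr rfl fun k hk => ?_
  have hk' : k < l / 2 + 1 := Finset.mem_range.1 hk
  have h : poch α (l - k) =
      poch α ((l + 1) / 2) * poch (α + ((l + 1) / 2 : ℕ)) (l - k - (l + 1) / 2) := by
    have e : l - k = (l + 1) / 2 + (l - k - (l + 1) / 2) := by omega
    conv_lhs => rw [e]
    simp only [poch, Finset.prod_range_add]
    congr 1
    refine Finset.prod_congr rfl fun i _ => ?_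
    push_cast
    ring
  rw [← mul_assoc, ← Polynomial.C_mul, h]
  congr 2
  ring

/-- The normalizing factor of `w_{K,λ}`: `N!` if `K = 2N`, and `N!/2` if `K = 2N+1`. -/
def wNorm (K : ℕ) : ℂ := if Even K then ((K / 2).factorial : ℂ) else ((K / 2).factorial : ℂ) / 2

/-- `w_{K,λ} = N!/(α)_N f_{K,λ}` if `K = 2N` and `N!/(2 (α)_{N+1}) f_{K,λ}` if `K = 2N+1`,
where `α = -λ - (n-1)/2 = -λ - m/2`, and
`f_{K,λ}(ξ) = ξ_n^K 𝒞(- ε_n ∑_{i<n} εᵢ ξᵢ² / ξ_n²)` with `𝒞(x²) = x^K C_K^α(1/x)`;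
thus the coefficient of `s^k` in `𝒞(s)` is that of `x^{K-2k}` in `C_K^α(x)`. -/
def w (r m : ℕ) (lam : ℂ) (K : ℕ) : Pol (m + 1) :=
  wNorm K • ∑ k ∈ Finset.range (K / 2 + 1),
    (gegenbauerRen (-lam - (m : ℂ) / 2) K).coeff (K - 2 * k) •
      ((-(eps ℂ r (Fin.last m)) • ∑ i : Fin m,
          eps ℂ r (Fin.castSucc i) • (MvPolynomial.X (Fin.castSucc i) : Pol (m + 1)) ^ 2) ^ k *
        (MvPolynomial.X (Fin.last m) : Pol (m + 1)) ^ (K - 2 * k))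

/-! ### Harmonic polynomials and the summands `H'_j` -/

/-- Homogeneous polynomials of degree `k` in `n` variables killed by `□`. -/
def harm (r n k : ℕ) : Submodule ℂ (Pol n) :=
  MvPolynomial.homogeneousSubmodule (Fin n) ℂ k ⊓ LinearMap.ker (box r n)

/-- Membership in `O(r, n - r)`, the real orthogonal group of `∑ εᵢ ξᵢ²`. -/
def InO (r : ℕ) {n : ℕ} (A : Matrix (Fin n) (Fin n) ℝ) : Prop :=
  Aᵀ * Matrix.diagonal (eps ℝ r) * A = Matrix.diagonal (eps ℝ r)

/-- `f(ξ') ↦ f(A ξ')` for `f ∈ Pol[ξ₁, …, ξ_{n-1}]`. -/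
def subst {m : ℕ} (A : Matrix (Fin m) (Fin m) ℝ) : Pol m →ₐ[ℂ] Pol m :=
  MvPolynomial.aeval fun i => ∑ k, ((A i k : ℝ) : ℂ) • (MvPolynomial.X k : Pol m)

/-- `f(ξ', ξ_n) ↦ f(A ξ', ξ_n)` for `f ∈ Pol[ξ₁, …, ξ_n]`. -/
def substPrime {m : ℕ} (A : Matrix (Fin m) (Fin m) ℝ) : Pol (m + 1) →ₐ[ℂ] Pol (m + 1) :=
  MvPolynomial.aeval (Fin.lastCases (MvPolynomial.X (Fin.last m))
    fun i => ∑ k, ((A i k : ℝ) : ℂ) • (MvPolynomial.X (Fin.castSucc k) : Pol (m + 1)))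

/-- A linear map `H^j(ℝ^{p-1,q-2}) → H^k(ℝ^{p-1,q-1})` commuting with `O(p-1,q-2)`. -/
def IsBranching (r m k j : ℕ) (T : harm r m j →ₗ[ℂ] Pol (m + 1)) : Prop :=
  (∀ f, T f ∈ harm r (m + 1) k) ∧
    ∀ A : Matrix (Fin m) (Fin m) ℝ, InO r A → ∀ f f' : harm r m j,
      (f' : Pol m) = subst A (f : Pol m) → T f' = substPrime A (T f)

/-- The subspace of `H^k(ℝ^{p-1,q-1})` corresponding to `H^j(ℝ^{p-1,q-2})` in the
`O(p-1,q-2)`-decomposition: the sum of the images of all `O(p-1,q-2)`-homomorphisms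
`H^j(ℝ^{p-1,q-2}) → H^k(ℝ^{p-1,q-1})`. -/
def branch (r m k j : ℕ) : Submodule ℂ (Pol (m + 1)) :=
  ⨆ (T : harm r m j →ₗ[ℂ] Pol (m + 1)) (_ : IsBranching r m k j T), LinearMap.range T

/-! ### The generalized Verma module -/

abbrev U (r m : ℕ) := UniversalEnvelopingAlgebra ℂ (g r m)

/-- The relations `u Z ⊗ v = u ⊗ Z v` for `u ∈ U(𝔤)`, `Z ∈ 𝔭`, `v ∈ ℂ_λ`, where `Z` acts on
`ℂ_λ` by `λ Z₀₀`, the differential of `p ↦ a^λ`.  (As `𝔭` generates `U(𝔭)`, these are the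
relations defining the tensor product over `U(𝔭)`.) -/
def vermaRel (r m : ℕ) (lam : ℂ) : Submodule (U r m) (U r m ⊗[ℂ] ℂ) :=
  Submodule.span (U r m) {t | ∃ (u : U r m) (Z : g r m) (v : ℂ), InP Z ∧
    t = (u * UniversalEnvelopingAlgebra.ι ℂ Z) ⊗ₜ[ℂ] v - u ⊗ₜ[ℂ] (lam * Z.1 e0 e0 * v)}

/-- The generalized Verma module `M(λ) = U(𝔤) ⊗_{U(𝔭)} ℂ_λ`. -/
abbrev Verma (r m : ℕ) (lam : ℂ) := (U r m ⊗[ℂ] ℂ) ⧸ vermaRel r m lam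

/-- The class of `u ⊗ v`. -/
def vermaMk {r m : ℕ} (lam : ℂ) (u : U r m) (v : ℂ) : Verma r m lam :=
  (vermaRel r m lam).mkQ (u ⊗ₜ[ℂ] v)

/-- The action of `Z ∈ 𝔤` on `M(λ)`. -/
def vermaAct {r m : ℕ} {lam : ℂ} (Z : g r m) (v : Verma r m lam) : Verma r m lam :=
  (UniversalEnvelopingAlgebra.ι ℂ Z : U r m) • v

/-- The space `M(λ)^{𝔫₊'}` of singular vectors. -/
def singular (r m : ℕ) (lam : ℂ) : Submodule ℂ (Verma r m lam) where
  carrier := {v | ∀ Z : g r m, InNPlusPrime Z → vermaAct Z v = 0}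
  zero_mem' := by intro Z _; simp [vermaAct]
  add_mem' := by
    intro a b ha hb Z hZ
    have h1 := ha Z hZ
    have h2 := hb Z hZ
    simp only [vermaAct] at h1 h2 ⊢
    rw [smul_add, h1, h2, add_zero]
  smul_mem' := by
    intro c a ha Z hZ
    have h1 := ha Z hZ
    simp only [vermaAct] at h1 ⊢
    rw [smul_comm, h1, smul_zero]

/-- The `𝔤'`-submodule of `M(λ)` generated by a vector. -/
def gPrimeSpan {r m : ℕ} {lam : ℂ} (v : Verma r m lam) : Submodule ℂ (Verma r m lam) :=
  sInf {W | v ∈ W ∧ ∀ Z : g r m, InGPrime Z → ∀ x ∈ W, vermaAct Z x ∈ W}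

/-- The map `φ : Pol[𝔫₊] ⊗ ℂ_λ → U(𝔤) ⊗_{U(𝔭)} ℂ_λ` given by the inverse Fourier transform:
its inverse is the composition of `M(λ) ≅ 𝒟'_{[o]}` with the Fourier transform, i.e. the map
which sends `1 ⊗ 1` (the delta function) to `1` and intertwines the action of `𝔤` on `M(λ)`
with `dπ̃`. -/
def IsPhi {r m : ℕ} {lam : ℂ} (φ : Pol (m + 1) ≃ₗ[ℂ] Verma r m lam) : Prop :=
  φ 1 = vermaMk lam 1 1 ∧
    ∀ (Z : g r m) (v : Verma r m lam) (ξ : Fin (m + 1) → ℝ),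
      MvPolynomial.eval (fun j => (ξ j : ℂ)) (φ.symm (vermaAct Z v)) =
        dpiTilde lam Z (φ.symm v) ξ

/-! ### The actions of `L'` -/

/-- Complexification of a real invertible matrix. -/
def cGL {m : ℕ} (a : GL (Idx m) ℝ) : GL (Idx m) ℂ :=
  Matrix.GeneralLinearGroup.map (algebraMap ℝ ℂ) a

theorem InLPrime.mem_orthGroup {r m : ℕ} {a : GL (Idx m) ℝ} (ha : InLPrime r a) :
    a ∈ orthGroup r m := by
  obtain ⟨⟨b, _, rfl⟩, _⟩ := ha
  exact b.2

theorem gram_map (r m : ℕ) : (gram ℝ r m).map (algebraMap ℝ ℂ) = gram ℂ r m := by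
  ext x y
  rcases x with _ | i | _ <;> rcases y with _ | j | _ <;> simp [gram, eps]
  split_ifs <;> simp

theorem cGL_orth {r m : ℕ} {a : GL (Idx m) ℝ} (ha : a ∈ orthGroup r m) :
    (cGL a).1ᵀ * gram ℂ r m * (cGL a).1 = gram ℂ r m := by
  have h : (a.1ᵀ * gram ℝ r m * a.1).map (algebraMap ℝ ℂ) =
      (gram ℝ r m).map (algebraMap ℝ ℂ) := by rw [show a.1ᵀ * gram ℝ r m * a.1 = _ from ha]
  rw [Matrix.map_mul, Matrix.map_mul, gram_map, Matrix.transpose_map] at h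
  exact h

theorem mem_g {r m : ℕ} (A : Matrix (Idx m) (Idx m) ℂ) :
    A ∈ g r m ↔ Aᵀ * gram ℂ r m = gram ℂ r m * (-A) := by
  rw [mem_skewAdjointMatricesLieSubalgebra, mem_skewAdjointMatricesSubmodule]
  rfl

theorem conj_mem {r m : ℕ} {a : GL (Idx m) ℝ} (ha : a ∈ orthGroup r m) (Z : g r m) :
    (cGL a).1 * Z.1 * (cGL a)⁻¹.1 ∈ g r m := by
  have hZ : Z.1ᵀ * gram ℂ r m = gram ℂ r m * (-Z.1) := (mem_g _).1 Z.2
  rw [mem_g]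
  have h1 : (cGL a).1 * (cGL a)⁻¹.1 = 1 := by rw [← Units.val_mul, mul_inv_cancel]; rfl
  have h2 : (cGL a)⁻¹.1ᵀ * (cGL a).1ᵀ = 1 := by rw [← Matrix.transpose_mul, h1, transpose_one]
  have h3 : (cGL a).1ᵀ * gram ℂ r m = gram ℂ r m * (cGL a)⁻¹.1 := by
    calc (cGL a).1ᵀ * gram ℂ r m
        = (cGL a).1ᵀ * gram ℂ r m * ((cGL a).1 * (cGL a)⁻¹.1) := by rw [h1, Matrix.mul_one]
      _ = ((cGL a).1ᵀ * gram ℂ r m * (cGL a).1) * (cGL a)⁻¹.1 := by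
          simp only [Matrix.mul_assoc]
      _ = _ := by rw [cGL_orth ha]
  have h4 : (cGL a)⁻¹.1ᵀ * gram ℂ r m = gram ℂ r m * (cGL a).1 := by
    calc (cGL a)⁻¹.1ᵀ * gram ℂ r m
        = (cGL a)⁻¹.1ᵀ * ((cGL a).1ᵀ * gram ℂ r m * (cGL a).1) := by rw [cGL_orth ha]
      _ = ((cGL a)⁻¹.1ᵀ * (cGL a).1ᵀ) * gram ℂ r m * (cGL a).1 := by
          simp only [Matrix.mul_assoc]
      _ = _ := by rw [h2, Matrix.one_mul]
  calc ((cGL a).1 * Z.1 * (cGL a)⁻¹.1)ᵀ * gram ℂ r m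
      = (cGL a)⁻¹.1ᵀ * Z.1ᵀ * ((cGL a).1ᵀ * gram ℂ r m) := by
        simp only [Matrix.transpose_mul, Matrix.mul_assoc]
    _ = (cGL a)⁻¹.1ᵀ * (Z.1ᵀ * gram ℂ r m) * (cGL a)⁻¹.1 := by
        rw [h3]; simp only [Matrix.mul_assoc]
    _ = ((cGL a)⁻¹.1ᵀ * gram ℂ r m) * (-Z.1) * (cGL a)⁻¹.1 := by
        rw [hZ]; simp only [Matrix.mul_assoc]
    _ = gram ℂ r m * (-((cGL a).1 * Z.1 * (cGL a)⁻¹.1)) := by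
        rw [h4]; simp only [Matrix.mul_assoc, Matrix.mul_neg, Matrix.neg_mul]

/-- The adjoint action `Ad(a) Z = a Z a⁻¹` on `𝔤`. -/
def Ad {r m : ℕ} {a : GL (Idx m) ℝ} (ha : InLPrime r a) : g r m →ₗ⁅ℂ⁆ g r m where
  toFun Z := ⟨(cGL a).1 * Z.1 * (cGL a)⁻¹.1, conj_mem ha.mem_orthGroup Z⟩
  map_add' := by intro Z Y; ext1; simp [Matrix.mul_add, Matrix.add_mul]
  map_smul' := by intro c Z; ext1; simp
  map_lie' := by
    intro Z Y
    ext1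
    have h1 : (cGL a)⁻¹.1 * (cGL a).1 = 1 := by rw [← Units.val_mul, inv_mul_cancel]; rfl
    have key (A B : Matrix (Idx m) (Idx m) ℂ) :
        (cGL a).1 * A * (cGL a)⁻¹.1 * ((cGL a).1 * B * (cGL a)⁻¹.1) =
          (cGL a).1 * (A * B) * (cGL a)⁻¹.1 := by
      calc _ = (cGL a).1 * A * ((cGL a)⁻¹.1 * (cGL a).1) * B * (cGL a)⁻¹.1 := by
            simp only [Matrix.mul_assoc]
        _ = _ := by rw [h1]; simp only [Matrix.mul_assoc, Matrix.one_mul]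
    change (cGL a).1 * (Z.1 * Y.1 - Y.1 * Z.1) * (cGL a)⁻¹.1 = _ * _ - _ * _
    rw [key, key, Matrix.mul_sub, Matrix.sub_mul]

/-- The extension of `Ad(a)` to `U(𝔤)`. -/
def AdU {r m : ℕ} {a : GL (Idx m) ℝ} (ha : InLPrime r a) : U r m →ₐ[ℂ] U r m :=
  UniversalEnvelopingAlgebra.lift ℂ ((UniversalEnvelopingAlgebra.ι ℂ).comp (Ad ha))

/-- The character `p ↦ a(p)^λ` by which `L' ⊂ P` acts on `ℂ_λ`. -/
def chi {m : ℕ} (lam : ℂ) (a : GL (Idx m) ℝ) : ℂ := ((|a.1 e0 e0| : ℝ) : ℂ) ^ lam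

/-- `u ⊗ v ↦ Ad(a) u ⊗ a · v` on `U(𝔤) ⊗ ℂ_λ`. -/
def preAct {r m : ℕ} (lam : ℂ) {a : GL (Idx m) ℝ} (ha : InLPrime r a) :
    U r m ⊗[ℂ] ℂ →ₗ[ℂ] U r m ⊗[ℂ] ℂ :=
  TensorProduct.map (AdU ha).toLinearMap (chi lam a • LinearMap.id)

theorem preAct_smul {r m : ℕ} (lam : ℂ) {a : GL (Idx m) ℝ} (ha : InLPrime r a) (u : U r m)
    (t : U r m ⊗[ℂ] ℂ) : preAct lam ha (u • t) = AdU ha u • preAct lam ha t := by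
  induction t with
  | zero => simp
  | add x y hx hy => rw [smul_add, map_add, hx, hy, map_add, smul_add]
  | tmul x y => simp [preAct, TensorProduct.smul_tmul']

theorem Ad_e0 {r m : ℕ} {a : GL (Idx m) ℝ} (ha : InLPrime r a) (Z : g r m) (hZ : InP Z) :
    InP (Ad ha Z) ∧ (Ad ha Z).1 e0 e0 = Z.1 e0 e0 := by
  have h0 (x : Idx m) (hx : x ≠ e0) : (cGL a).1 x e0 = 0 := by
    change algebraMap ℝ ℂ (a.1 x e0) = 0
    rw [ha.2.1 x hx, map_zero]
  -- the action of `a⁻¹` on the line spanned by `e₀`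
  have hcol (B : Matrix (Idx m) (Idx m) ℂ) (x : Idx m) :
      (B * (cGL a).1) x e0 = B x e0 * (cGL a).1 e0 e0 := by
    rw [Matrix.mul_apply]
    exact Finset.sum_eq_single _ (fun y _ hy => by rw [h0 y hy, mul_zero]) (by simp)
  have h1 : (cGL a)⁻¹.1 * (cGL a).1 = 1 := by rw [← Units.val_mul, inv_mul_cancel]; rfl
  have hne : (cGL a).1 e0 e0 ≠ 0 := by
    intro h
    have := hcol (cGL a)⁻¹.1 e0
    rw [h1, h, mul_zero] at this
    simp at this
  have hA : (Ad ha Z).1 * (cGL a).1 = (cGL a).1 * Z.1 := by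
    change (cGL a).1 * Z.1 * (cGL a)⁻¹.1 * (cGL a).1 = _
    rw [Matrix.mul_assoc, h1, Matrix.mul_one]
  have hB (x : Idx m) : (Ad ha Z).1 x e0 * (cGL a).1 e0 e0 = (cGL a).1 x e0 * Z.1 e0 e0 := by
    rw [← hcol, hA, Matrix.mul_apply]
    exact Finset.sum_eq_single _ (fun y _ hy => by rw [hZ y hy, mul_zero]) (by simp)
  refine ⟨fun x hx => ?_, ?_⟩
  · have := hB x
    rw [h0 x hx, zero_mul] at this
    exact (mul_eq_zero.1 this).resolve_right hne
  · exact mul_right_cancel₀ hne ((hB e0).trans (mul_comm _ _))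

theorem preAct_mem {r m : ℕ} (lam : ℂ) {a : GL (Idx m) ℝ} (ha : InLPrime r a) :
    (vermaRel r m lam).restrictScalars ℂ ≤
      ((vermaRel r m lam).restrictScalars ℂ).comap (preAct lam ha) := by
  intro t ht
  change preAct lam ha t ∈ vermaRel r m lam
  change t ∈ vermaRel r m lam at ht
  unfold vermaRel at ht
  induction ht using Submodule.span_induction with
  | zero => rw [map_zero]; exact zero_mem _
  | add x y _ _ hx hy => rw [map_add]; exact add_mem hx hy
  | smul u x _ hx => rw [preAct_smul]; exact Submodule.smul_mem _ _ hx
  | mem x hx =>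
    obtain ⟨u, Z, v, hZ, rfl⟩ := hx
    obtain ⟨h1, h2⟩ := Ad_e0 ha Z hZ
    refine Submodule.subset_span ⟨AdU ha u, Ad ha Z, chi lam a * v, h1, ?_⟩
    have h3 : AdU ha (UniversalEnvelopingAlgebra.ι ℂ Z) =
        UniversalEnvelopingAlgebra.ι ℂ (Ad ha Z) := by
      simp [AdU]
    rw [map_sub, h2]
    simp only [preAct, TensorProduct.map_tmul, AlgHom.toLinearMap_apply, map_mul, h3,
      LinearMap.smul_apply, LinearMap.id_apply, smul_eq_mul]
    congr 2
    ring

/-- The action `a · (u ⊗ v) = Ad(a) u ⊗ a · v` of `L'` on `M(λ)`. -/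
def vermaLAct {r m : ℕ} {lam : ℂ} {a : GL (Idx m) ℝ} (ha : InLPrime r a) :
    Verma r m lam →ₗ[ℂ] Verma r m lam :=
  (Submodule.Quotient.restrictScalarsEquiv ℂ (vermaRel r m lam)).toLinearMap ∘ₗ
    Submodule.mapQ _ _ (preAct lam ha) (preAct_mem lam ha) ∘ₗ
      (Submodule.Quotient.restrictScalarsEquiv ℂ (vermaRel r m lam)).symm.toLinearMap

theorem vermaLAct_mk {r m : ℕ} {lam : ℂ} {a : GL (Idx m) ℝ} (ha : InLPrime r a)
    (u : U r m) (v : ℂ) :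
    vermaLAct ha (vermaMk lam u v) = vermaMk lam (AdU ha u) (chi lam a * v) := by
  change Submodule.Quotient.mk (preAct lam ha (u ⊗ₜ[ℂ] v)) = _
  simp only [preAct, vermaMk, TensorProduct.map_tmul]
  rfl

/-- The action `f ⊗ v ↦ f(Ad(a)⁻¹ ·) ⊗ a · v` of `L'` on polynomials on `𝔫₊`.  For
`a = diag(c, b, c⁻¹)` and `ξ ∈ 𝔫₊`, a row vector, `Ad(a)⁻¹ ξ = c⁻¹ ξ b`. -/
def polLAct {m : ℕ} (lam : ℂ) (a : GL (Idx m) ℝ) : Pol (m + 1) →ₗ[ℂ] Pol (m + 1) :=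
  chi lam a • (MvPolynomial.aeval fun j => ∑ k,
    (((a.1 e0 e0)⁻¹ * a.1 (mid k) (mid j) : ℝ) : ℂ) •
      (MvPolynomial.X k : Pol (m + 1))).toLinearMap

end FMethod

end

/-! On e^{i⟨x,ξ⟩} the operator dπ(Z) produces a polynomial in x times the same exponential, so the
Fourier transform turns dπ̃(Z) into a differential operator in ξ, by the substitution x_j ↦ -i∂_j
(`dpiTilde_eq`). It is multiplication by iξ_j for the basis vector Y_j of 𝔫₋, multiplies the
constant 1 by a character when Z ∈ 𝔭, and is a combination of the P_j(λ) when Z ∈ 𝔫₊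
(`tildeOp_nPlus`); this gives (1). As dπ̃ is a representation (`tildeOp_lie`), the defining
relations of M(λ) yield an intertwiner M(λ) → Pol. Its inverse is f ↦ f(-iY) ⊗ 1, which makes sense
because 𝔫₋ is abelian. So φ exists, is unique, and carries Sol onto the singular vectors, compatibly
with L'.

Each P_j(λ) lowers the degree by one, so the equations are solved degree by degree. For f of degree
K write f = Σ f_a(ξ') ξ_n^a with ξ' = (ξ_1, …, ξ_{n-1}). The system becomes (ε_j/2) ξ_j (□f)_a +
(λ-K+1) ∂_j f_a = 0 for j < n. Since (□f)_a contains f_{a+2} with a nonzero coefficient, f_0 and f_1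
determine f. If K ≠ λ+1, the gradient of f_a is proportional to that of Q' = Σ_{i<n} ε_i ξ_i². The
Casimir operator in ξ' then kills f_a, so f_a is a multiple of a power of Q'. Parity leaves one free
constant, realized by w_{K,λ} (`mem_span_w_of_mem_Sol`). If K = λ+1, the system just says □f = 0.

In that last degree, the recurrence of the Gegenbauer coefficients shows that h(ξ') w_{K,λ} is
harmonic whenever h ∈ H^j and K+j = λ+1 (`emb_mul_w_mem_harm`). Decomposing f_0 and f_1 into powers
of Q' times harmonics shows that these products span (`harm_le`). An O(p-1,q-2)-map from H^j,
differentiated along one-parameter groups, respects the Casimir operator; the eigenvalue forces its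
image into H^j w_{λ+1-j,λ} (`IsBranching.range_le`). Hence H'_j = H^j w_{λ+1-j,λ}, without any
appeal to irreducibility. The summands are independent because degree and Casimir eigenvalue
together separate them. The inclusion into the 𝔤'-submodule holds because ξ_i, i < n, acts through
𝔫₋ ∩ 𝔤'. -/

namespace FMethod

open MvPolynomial

/-! ### Polynomial multiples of exponentials -/

/-- The function `X ↦ p(X) e^{i⟨X,ξ⟩}`. -/
noncomputable def polExp {n : ℕ} (ξ : Fin n → ℝ) (p : Pol n) (X : Fin n → ℝ) : ℂ :=
  eval (fun j => (X j : ℂ)) p * expI ξ X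

/-- The operator `∂_j + i ξ_j`, by which `∂_j` acts on polynomial multiples of `e^{i⟨X,ξ⟩}`. -/
noncomputable def twistedDeriv {n : ℕ} (ξ : Fin n → ℝ) (j : Fin n) : Module.End ℂ (Pol n) :=
  (pderiv j).toLinearMap + (Complex.I * ξ j) • LinearMap.id

theorem hasFDerivAt_eval {n : ℕ} (p : Pol n) (X : Fin n → ℝ) :
    HasFDerivAt (fun X : Fin n → ℝ => eval (fun j => (X j : ℂ)) p)
      (∑ k, eval (fun j => (X j : ℂ)) (pderiv k p) •
        (Complex.ofRealCLM.comp
          (ContinuousLinearMap.proj (R := ℝ) (φ := fun _ : Fin n => ℝ) k))) X := by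
  induction p using MvPolynomial.induction_on with
  | C a =>
    simp only [eval_C]
    refine (hasFDerivAt_const (𝕜 := ℝ) a X).congr_fderiv ?_
    ext v
    simp
  | add p q hp hq =>
    simp only [map_add]
    refine (hp.add hq).congr_fderiv ?_
    ext v
    simp [add_mul, Finset.sum_add_distrib]
  | mul_X p i hp =>
    simp only [map_mul, eval_X]
    refine (hp.mul (Complex.ofRealCLM.hasFDerivAt.comp X
      (hasFDerivAt_apply i X))).congr_fderiv ?_
    ext v
    simp [pderiv_X, Pi.single_apply, add_mul, Finset.sum_add_distrib, Finset.mul_sum, apply_ite]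
    simp only [mul_assoc]

theorem hasFDerivAt_expI {n : ℕ} (ξ X : Fin n → ℝ) :
    HasFDerivAt (expI ξ)
      (∑ k, (Complex.I * ξ k * expI ξ X) • (Complex.ofRealCLM.comp
          (ContinuousLinearMap.proj (R := ℝ) (φ := fun _ : Fin n => ℝ) k))) X := by
  have h1 : HasFDerivAt (fun X : Fin n → ℝ => ∑ j, X j * ξ j)
      (∑ j, ξ j • (ContinuousLinearMap.proj (R := ℝ) (φ := fun _ : Fin n => ℝ) j)) X :=
    HasFDerivAt.fun_sum fun k _ => (hasFDerivAt_apply k X).mul_const (ξ k)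
  refine (((Complex.ofRealCLM.hasFDerivAt.comp X h1).const_mul Complex.I).cexp).congr_fderiv ?_
  ext v
  simp only [_root_.smul_apply, ContinuousLinearMap.comp_apply,
    _root_.sum_apply, ContinuousLinearMap.proj_apply, Complex.ofRealCLM_apply,
    Function.comp_apply, smul_eq_mul, Complex.ofReal_sum, Complex.ofReal_mul, Finset.mul_sum, expI]
  refine Finset.sum_congr rfl fun k _ => ?_
  ring

theorem pd_polExp {n : ℕ} (ξ : Fin n → ℝ) (j : Fin n) (p : Pol n) :
    pd j (polExp ξ p) = polExp ξ (twistedDeriv ξ j p) := by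
  funext X
  have h : HasFDerivAt (polExp ξ p) _ X := (hasFDerivAt_eval p X).mul (hasFDerivAt_expI ξ X)
  rw [pd, h.fderiv]
  simp [polExp, twistedDeriv, Pi.single_apply, apply_ite]
  ring

/-- The composition of the powers `(∂_j + i ξ_j)^{α_j}` for `j` in a list. -/
noncomputable def twistedDerivs {n : ℕ} (ξ : Fin n → ℝ) (α : Fin n →₀ ℕ) (l : List (Fin n)) :
    Module.End ℂ (Pol n) :=
  (l.map fun j => twistedDeriv ξ j ^ α j).prod

theorem pdMulti_polExp {n : ℕ} (ξ : Fin n → ℝ) (α : Fin n →₀ ℕ) (p : Pol n) :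
    pdMulti α (polExp ξ p) = polExp ξ (twistedDerivs ξ α (List.finRange n) p) := by
  have hit (j : Fin n) (k : ℕ) (p : Pol n) :
      (pd j)^[k] (polExp ξ p) = polExp ξ ((twistedDeriv ξ j ^ k) p) := by
    induction k with
    | zero => simp
    | succ k ih => rw [Function.iterate_succ_apply', ih, pd_polExp, pow_succ']; rfl
  rw [pdMulti]
  induction List.finRange n with
  | nil => simp [twistedDerivs]
  | cons a l ih => rw [List.foldr_cons, ih, hit]; simp [twistedDerivs]

theorem twistedDeriv_X_mul {n : ℕ} (ξ : Fin n → ℝ) (j k : Fin n) (p : Pol n) :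
    twistedDeriv ξ j (X k * p) = X k * twistedDeriv ξ j p + if j = k then p else 0 := by
  rcases eq_or_ne j k with rfl | h
  · simp [twistedDeriv, mul_add, add_right_comm]
  · simp [twistedDeriv, h, pderiv_X_of_ne h.symm, mul_add]

theorem twistedDeriv_pow_X_mul {n : ℕ} (ξ : Fin n → ℝ) (j k : Fin n) (a : ℕ) (p : Pol n) :
    (twistedDeriv ξ j ^ a) (X k * p) = X k * (twistedDeriv ξ j ^ a) p +
      if j = k then (a : ℂ) • (twistedDeriv ξ j ^ (a - 1)) p else 0 := by
  induction a with
  | zero => simp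
  | succ a ih =>
    rw [pow_succ', Module.End.mul_apply, ih, map_add, twistedDeriv_X_mul, Module.End.mul_apply]
    rcases eq_or_ne j k with rfl | h
    · rcases a with _ | a
      · simp
      · simp only [if_true, map_smul, Nat.add_sub_cancel, pow_succ' _ a,
          Module.End.mul_apply, Nat.cast_add, Nat.cast_one]
        module
    · simp [h]

/-- The Leibniz commutator [D_k^a, X_k] = a D_k^{a-1} for one variable passes to the product over a
list. Without repetitions in the list, exactly one factor fails to commute with X_k. -/
theorem twistedDerivs_X_mul {n : ℕ} (ξ : Fin n → ℝ) (α : Fin n →₀ ℕ) (k : Fin n)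
    (l : List (Fin n)) (hl : l.Nodup) (p : Pol n) :
    twistedDerivs ξ α l (X k * p) = X k * twistedDerivs ξ α l p +
      if k ∈ l then (α k : ℂ) • twistedDerivs ξ (α - Finsupp.single k 1) l p else 0 := by
  induction l with
  | nil => simp [twistedDerivs]
  | cons a l ih =>
    have hc (β : Fin n →₀ ℕ) (q : Pol n) : twistedDerivs ξ β (a :: l) q =
        (twistedDeriv ξ a ^ β a) (twistedDerivs ξ β l q) := by simp [twistedDerivs]
    obtain ⟨hal, hl'⟩ := List.nodup_cons.1 hl
    rw [hc, ih hl', map_add, twistedDeriv_pow_X_mul, hc, hc, add_assoc]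
    congr 1
    rcases eq_or_ne a k with rfl | h
    · have : twistedDerivs ξ (α - Finsupp.single a 1) l = twistedDerivs ξ α l := by
        unfold twistedDerivs
        congr 1
        refine List.map_congr_left fun j hj => ?_
        have : j ≠ a := by rintro rfl; exact hal hj
        simp [this.symm]
      simp [hal, this]
    · simp only [h, if_false, zero_add, List.mem_cons, h.symm, false_or]
      split_ifs
      · simp [h.symm]
      · simp

/-- The basic rule of the Fourier transform: multiplication of the test function by x_k is dual to
-i∂/∂ξ_k on the symbol. At the origin only the commutator term of `twistedDerivs_X_mul` survives. -/
theorem invFourier_polExp_X_mul {n : ℕ} (ξ : Fin n → ℝ) (k : Fin n) (p f : Pol n) :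
    invFourier (polExp ξ (X k * p)) f =
      invFourier (polExp ξ p) (-Complex.I • pderiv k f) := by
  have hmon (h : (Fin n → ℝ) → ℂ) (α : Fin n →₀ ℕ) (c : ℂ) : invFourier h (monomial α c) =
      c * ((-Complex.I) ^ (α.sum fun _ k => k) * pdMulti α h 0) := by
    have : monomial α c = c • basisMonomials (Fin n) ℂ α := by
      simp [smul_monomial]
    rw [this, map_smul, invFourier, Module.Basis.constr_basis, smul_eq_mul]
  induction f using MvPolynomial.induction_on' with
  | add f g hf hg => rw [map_add, hf, hg, map_add, smul_add, map_add]
  | monomial α c =>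
    rw [pderiv_monomial, smul_monomial, hmon, hmon, pdMulti_polExp, pdMulti_polExp,
      twistedDerivs_X_mul _ _ _ _ (List.nodup_finRange n)]
    simp only [polExp, List.mem_finRange, if_true, map_add, map_mul, eval_X, smul_eval,
      Pi.zero_apply, Complex.ofReal_zero, zero_mul, zero_add]
    rcases Nat.eq_zero_or_pos (α k) with h0 | h0
    · simp [h0]
    · have hs : (α.sum fun _ k => k) = ((α - Finsupp.single k 1).sum fun _ k => k) + 1 := by
        conv_lhs => rw [← tsub_add_cancel_of_le (show Finsupp.single k 1 ≤ α by
          rw [Finsupp.single_le_iff]; exact h0)]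
        rw [Finsupp.sum_add_index' (by simp) (by simp)]
        simp
      rw [hs, pow_succ]
      simp only [smul_eq_mul]
      ring

theorem invFourier_polExp_add {n : ℕ} (ξ : Fin n → ℝ) (p q f : Pol n) :
    invFourier (polExp ξ (p + q)) f = invFourier (polExp ξ p) f + invFourier (polExp ξ q) f := by
  rw [← LinearMap.add_apply]
  congr 1
  refine (basisMonomials (Fin n) ℂ).ext fun α => ?_
  simp only [LinearMap.add_apply, invFourier, Module.Basis.constr_basis, pdMulti_polExp]
  simp [polExp]
  ring

theorem invFourier_polExp_smul {n : ℕ} (ξ : Fin n → ℝ) (c : ℂ) (p f : Pol n) :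
    invFourier (polExp ξ (c • p)) f = c * invFourier (polExp ξ p) f := by
  rw [← smul_eq_mul, ← LinearMap.smul_apply]
  congr 1
  refine (basisMonomials (Fin n) ℂ).ext fun α => ?_
  simp only [LinearMap.smul_apply, invFourier, Module.Basis.constr_basis, pdMulti_polExp]
  simp [polExp]
  ring

/-! ### The pairing of polynomials given by `f(-i∂) g` at the origin -/

/-- The pairing `(f, g) ↦ (f(-i∂) g)(0)`. -/
noncomputable def pairing {n : ℕ} (g : Pol n) : Pol n →ₗ[ℂ] ℂ :=
  (basisMonomials (Fin n) ℂ).constr ℂ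
    (fun α => (∏ j, (-Complex.I) ^ α j * ((α j).factorial : ℂ)) * coeff α g)

theorem pairing_monomial {n : ℕ} (g : Pol n) (α : Fin n →₀ ℕ) (c : ℂ) :
    pairing g (monomial α c) =
      c * ((∏ j, (-Complex.I) ^ α j * ((α j).factorial : ℂ)) * coeff α g) := by
  have : monomial α c = c • basisMonomials (Fin n) ℂ α := by simp [smul_monomial]
  rw [this, map_smul, pairing, Module.Basis.constr_basis, smul_eq_mul]

theorem pairing_add {n : ℕ} (f g h : Pol n) : pairing (g + h) f = pairing g f + pairing h f := by
  rw [← LinearMap.add_apply]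
  congr 1
  refine (basisMonomials (Fin n) ℂ).ext fun α => ?_
  simp only [pairing, LinearMap.add_apply, Module.Basis.constr_basis, coeff_add]
  ring

theorem pairing_smul {n : ℕ} (c : ℂ) (f g : Pol n) : pairing (c • g) f = c * pairing g f := by
  rw [← smul_eq_mul, ← LinearMap.smul_apply]
  congr 1
  refine (basisMonomials (Fin n) ℂ).ext fun α => ?_
  simp only [pairing, LinearMap.smul_apply, Module.Basis.constr_basis, coeff_smul, smul_eq_mul]
  ring

/-- On monomials the pairing is diagonal with weights (-i)^{|α|} α!, none of which vanishes.
Nondegeneracy permits identities between operators to be checked on their transposes. -/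
theorem eq_zero_of_pairing {n : ℕ} (f : Pol n) (h : ∀ g, pairing g f = 0) : f = 0 := by
  have key (g : Pol n) (α : Fin n →₀ ℕ) : pairing (monomial α 1) g =
      (∏ j, (-Complex.I) ^ α j * ((α j).factorial : ℂ)) * coeff α g := by
    induction g using MvPolynomial.induction_on' with
    | add p q hp hq => rw [map_add, hp, hq, coeff_add, mul_add]
    | monomial β c =>
      rw [pairing_monomial, coeff_monomial, coeff_monomial]
      rcases eq_or_ne α β with rfl | hne
      · simp; ring
      · simp [hne, hne.symm]
  ext α
  have := h (monomial α 1)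
  rw [key] at this
  refine (mul_eq_zero.1 this).resolve_left (Finset.prod_ne_zero_iff.2 fun j _ => ?_)
  simp [Nat.factorial_ne_zero]

theorem prod_pairing_weight {n : ℕ} (α : Fin n →₀ ℕ) (k : Fin n) :
    (∏ j, (-Complex.I) ^ (α + Finsupp.single k 1 : Fin n →₀ ℕ) j *
        (((α + Finsupp.single k 1 : Fin n →₀ ℕ) j).factorial : ℂ)) =
      -Complex.I * (α k + 1) * ∏ j, (-Complex.I) ^ α j * ((α j).factorial : ℂ) := by
  rw [← Finset.mul_prod_erase _ _ (Finset.mem_univ k),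
    ← Finset.mul_prod_erase _ _ (Finset.mem_univ k), ← mul_assoc]
  congr 1
  · simp [pow_succ, Nat.factorial_succ]; ring
  · refine Finset.prod_congr rfl fun j hj => ?_
    simp [(Finset.ne_of_mem_erase hj).symm]

theorem pairing_X_mul {n : ℕ} (k : Fin n) (f g : Pol n) :
    pairing (X k * g) f = pairing g (-Complex.I • pderiv k f) := by
  induction f using MvPolynomial.induction_on' with
  | add p q hp hq => rw [map_add, hp, hq, map_add, smul_add, map_add]
  | monomial α c =>
    rw [pderiv_monomial, smul_monomial, pairing_monomial, pairing_monomial, mul_comm (X k) g]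
    rcases Nat.eq_zero_or_pos (α k) with h0 | h0
    · simp [coeff_mul_X', h0]
    · obtain ⟨β, rfl⟩ : ∃ β, α = β + Finsupp.single k 1 :=
        ⟨α - Finsupp.single k 1, (tsub_add_cancel_of_le (by
          rw [Finsupp.single_le_iff]; exact h0)).symm⟩
      rw [coeff_mul_X, prod_pairing_weight]
      simp only [add_tsub_cancel_right, smul_eq_mul]
      simp
      ring

theorem pairing_pderiv {n : ℕ} (k : Fin n) (f g : Pol n) :
    pairing (pderiv k g) f = pairing g (Complex.I • (X k * f)) := by
  induction f using MvPolynomial.induction_on' with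
  | add p q hp hq => rw [map_add, hp, hq, mul_add, smul_add, map_add]
  | monomial α c =>
    rw [X, monomial_mul, smul_monomial, pairing_monomial, pairing_monomial, coeff_pderiv,
      add_comm (Finsupp.single k 1) α, prod_pairing_weight]
    simp only [smul_eq_mul, one_mul]
    linear_combination (c * (∏ j, (-Complex.I) ^ α j * ((α j).factorial : ℂ)) *
      coeff (α + Finsupp.single k 1) g * ((α k : ℂ) + 1)) * Complex.I_mul_I


/-! ### The operators `dπ̃(Z)` -/

/-- The quadratic form `∑ εᵢ Xᵢ²`. -/
noncomputable def quad (r n : ℕ) : Pol n := ∑ i : Fin n, eps ℂ r i • (X i : Pol n) ^ 2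

/-- The first column `(1, X, -Q(X)/2)` of `exp X`, as a vector of polynomials. -/
noncomputable def coneVec (r m : ℕ) : Idx m → Pol (m + 1)
  | Sum.inl _ => 1
  | Sum.inr (Sum.inl i) => X i
  | Sum.inr (Sum.inr _) => (-1 / 2 : ℂ) • quad r (m + 1)

/-- The image of `coneVec` under a matrix. -/
noncomputable def matVec (r : ℕ) {m : ℕ} (Z : Matrix (Idx m) (Idx m) ℂ) (a : Idx m) :
    Pol (m + 1) :=
  ∑ b, Z a b • coneVec r m b

/-- The components of the vector field on `𝔫₋` defined by `-Z`. -/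
noncomputable def fieldCoeff (r : ℕ) {m : ℕ} (Z : Matrix (Idx m) (Idx m) ℂ) (i : Fin (m + 1)) :
    Pol (m + 1) :=
  matVec r Z (mid i) - X i * matVec r Z e0

theorem hasDerivAt_exp_mul_nMinus (r : ℕ) {m : ℕ} (Z : Matrix (Idx m) (Idx m) ℝ)
    (x : Fin (m + 1) → ℝ) (a : Idx m) :
    HasDerivAt (fun t : ℝ => (NormedSpace.exp (-(t • Z)) * nMinus r x) a e0)
      (-(Z * nMinus r x) a e0) 0 := by
  -- The norm is only a local choice that makes the derivative of the exponential available; the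
  -- conclusion is entrywise.
  let _ : NormedRing (Matrix (Idx m) (Idx m) ℝ) := Matrix.linftyOpNormedRing
  let _ : NormedAlgebra ℝ (Matrix (Idx m) (Idx m) ℝ) := Matrix.linftyOpNormedAlgebra
  have h := hasDerivAt_exp_smul_const (𝕂 := ℝ) (-Z) (0 : ℝ)
  have h2 (c : Idx m) : HasDerivAt (fun t : ℝ => NormedSpace.exp (t • -Z) a c) (-Z a c) 0 := by
    have := (hasDerivAt_pi.1 ((hasDerivAt_pi.1 h) a)) c
    simp only [zero_smul, NormedSpace.exp_zero, one_mul, Matrix.neg_apply] at this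
    exact this
  have h3 := HasDerivAt.fun_sum (u := Finset.univ)
    (fun c _ => (h2 c).mul_const (nMinus r x c e0))
  simp only [smul_neg] at h3
  simpa [Matrix.mul_apply] using h3

theorem dpiReal_expI (r : ℕ) {m : ℕ} (lam : ℂ) (Z : Matrix (Idx m) (Idx m) ℝ)
    (ξ x : Fin (m + 1) → ℝ) :
    dpiReal r lam Z (expI ξ) x =
      -(lam * ((Z * nMinus r x) e0 e0 : ℝ) + ∑ i, Complex.I * ξ i *
        (((Z * nMinus r x) (mid i) e0 : ℝ) - x i * ((Z * nMinus r x) e0 e0 : ℝ))) *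
          expI ξ x := by
  have h0 (a : Idx m) := hasDerivAt_exp_mul_nMinus r Z x a
  set F : ℝ → Matrix (Idx m) (Idx m) ℝ := fun t => NormedSpace.exp (-(t • Z)) * nMinus r x
  have hF : F 0 = nMinus r x := by simp [F]
  have hF0 : F 0 e0 e0 = 1 := by rw [hF]; rfl
  have hFi (i : Fin (m + 1)) : F 0 (mid i) e0 = x i := by rw [hF]; rfl
  have h1 : HasDerivAt (fun t => |F t e0 e0|) (-(Z * nMinus r x) e0 e0) 0 := by
    -- The corner entry equals 1 at t = 0, so neither the absolute value nor the complex power meets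
    -- a singularity.
    have := (hasDerivAt_abs_pos (x := F 0 e0 e0) (by rw [hF0]; exact one_pos)).comp 0 (h0 e0)
    simpa [Function.comp_def] using this
  have h2 : HasDerivAt (fun t => ((|F t e0 e0| : ℝ) : ℂ) ^ lam)
      (-lam * ((Z * nMinus r x) e0 e0 : ℝ)) 0 := by
    have hc : HasDerivAt (fun z : ℂ => z ^ lam) (lam * 1 ^ (lam - 1) * 1)
        ((|F 0 e0 e0| : ℝ) : ℂ) := by
      rw [hF0, abs_one, Complex.ofReal_one]
      exact (hasDerivAt_id (1 : ℂ)).cpow_const (by simp)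
    have := (hc.hasFDerivAt.restrictScalars ℝ).comp_hasDerivAt
      (f := fun t => ((|F t e0 e0| : ℝ) : ℂ)) (0 : ℝ) h1.ofReal_comp
    refine HasDerivAt.congr_deriv (f := fun t => ((|F t e0 e0| : ℝ) : ℂ) ^ lam) this ?_
    simp [mul_comm]
  have h3 : HasDerivAt (fun t i => F t (mid i) e0 / F t e0 e0)
      (fun i => -(Z * nMinus r x) (mid i) e0 + x i * (Z * nMinus r x) e0 e0) 0 := by
    refine hasDerivAt_pi.2 fun i => ?_
    have := (h0 (mid i)).fun_div (h0 e0) (by change F 0 e0 e0 ≠ 0; rw [hF0]; exact one_ne_zero)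
    refine this.congr_deriv ?_
    change (-(Z * nMinus r x) (mid i) e0 * F 0 e0 e0 - F 0 (mid i) e0 * -(Z * nMinus r x) e0 e0) /
      F 0 e0 e0 ^ 2 = _
    rw [hF0, hFi]
    ring
  have h6 := h2.mul ((hasFDerivAt_expI ξ (fun i => F 0 (mid i) e0 / F 0 e0 e0)).comp_hasDerivAt
    (0 : ℝ) h3)
  rw [dpiReal]
  refine (HasDerivAt.deriv (h6 : HasDerivAt (fun t => cellExt lam (expI ξ) (F t)) _ 0)).trans ?_
  have h5 : expI ξ (fun i => F 0 (mid i) e0) = expI ξ x := by simp only [hFi]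
  simp only [hF0, Function.comp_apply, div_one, h5, abs_one, Complex.ofReal_one, Complex.one_cpow, one_mul,
    _root_.sum_apply, _root_.smul_apply, ContinuousLinearMap.comp_apply,
    ContinuousLinearMap.proj_apply, Complex.ofRealCLM_apply, smul_eq_mul, Complex.ofReal_add,
    Complex.ofReal_neg, Complex.ofReal_mul, neg_mul, add_mul, Finset.sum_mul, neg_add]
  rw [← Finset.sum_neg_distrib]
  congr 1
  refine Finset.sum_congr rfl fun i _ => ?_
  ring

theorem eval_coneVec (r m : ℕ) (x : Fin (m + 1) → ℝ) (a : Idx m) :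
    eval (fun j => (x j : ℂ)) (coneVec r m a) = (nMinus r x a e0 : ℝ) := by
  rcases a with _ | i | _
  · simp [coneVec, nMinus]
  · simp [coneVec, nMinus]
  · have (i : Fin (m + 1)) : ((eps ℝ r i : ℝ) : ℂ) = eps ℂ r i := by
      unfold eps; split_ifs <;> simp
    simp [coneVec, nMinus, quad, this, smul_eval]
    ring

/-- The first column of exp X is polynomial in X, and only that column enters the extension to the
cell. The weight a(p)^λ contributes the term with λ, and the motion of the base point contributes
the vector field applied to the exponential. -/
theorem dpi_expI {r m : ℕ} (lam : ℂ) (Z : g r m) (ξ : Fin (m + 1) → ℝ) :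
    dpi lam Z (expI ξ) = polExp ξ (-(lam • matVec r Z.1 e0 +
      ∑ i, (Complex.I * ξ i) • fieldCoeff r Z.1 i)) := by
  funext x
  have h (a : Idx m) : eval (fun j => (x j : ℂ)) (matVec r Z.1 a) =
      ((Z.1.map Complex.re * nMinus r x) a e0 : ℝ) +
        Complex.I * ((Z.1.map Complex.im * nMinus r x) a e0 : ℝ) := by
    simp only [matVec, map_sum, smul_eval, eval_coneVec, Matrix.mul_apply, Complex.ofReal_sum,
      Finset.mul_sum, Complex.ofReal_mul, Matrix.map_apply]
    rw [← Finset.sum_add_distrib]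
    refine Finset.sum_congr rfl fun b _ => ?_
    conv_lhs => rw [← Complex.re_add_im (Z.1 a b)]
    ring
  rw [dpi, dpiReal_expI, dpiReal_expI, polExp]
  simp only [map_neg, map_add, smul_eval, map_sum, fieldCoeff, map_sub, map_mul, eval_X, h]
  have e : ∑ i, Complex.I * (ξ i : ℂ) * (((Z.1.map Complex.re * nMinus r x) (mid i) e0 : ℝ) +
        Complex.I * ((Z.1.map Complex.im * nMinus r x) (mid i) e0 : ℝ) -
        x i * (((Z.1.map Complex.re * nMinus r x) e0 e0 : ℝ) +
        Complex.I * ((Z.1.map Complex.im * nMinus r x) e0 e0 : ℝ))) =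
      ∑ i, Complex.I * (ξ i : ℂ) * (((Z.1.map Complex.re * nMinus r x) (mid i) e0 : ℝ) -
        x i * ((Z.1.map Complex.re * nMinus r x) e0 e0 : ℝ)) +
      Complex.I * ∑ i, Complex.I * (ξ i : ℂ) *
        (((Z.1.map Complex.im * nMinus r x) (mid i) e0 : ℝ) -
        x i * ((Z.1.map Complex.im * nMinus r x) e0 e0 : ℝ)) := by
    rw [Finset.mul_sum, ← Finset.sum_add_distrib]
    exact Finset.sum_congr rfl fun i _ => by ring
  rw [e]
  ring

/-- `DualOp p D` says that `D` is the differential operator obtained from the polynomial `p` by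
the substitution `X_j ↦ -i ∂_j`. -/
inductive DualOp {n : ℕ} : Pol n → Module.End ℂ (Pol n) → Prop
  | one : DualOp 1 1
  | smul (c : ℂ) {p D} : DualOp p D → DualOp (c • p) (c • D)
  | add {p q D T} : DualOp p D → DualOp q T → DualOp (p + q) (D + T)
  | X_mul (j : Fin n) {p D} : DualOp p D →
      DualOp (X j * p) (D * ((-Complex.I) • (pderiv j).toLinearMap))

namespace DualOp

theorem sum {n : ℕ} {ι : Type*} (s : Finset ι) (p : ι → Pol n) (D : ι → Module.End ℂ (Pol n))
    (h : ∀ i, DualOp (p i) (D i)) : DualOp (∑ i ∈ s, p i) (∑ i ∈ s, D i) := by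
  classical
  induction s using Finset.induction_on with
  | empty => simpa using DualOp.smul 0 (DualOp.one (n := n))
  | insert a s ha ih => rw [Finset.sum_insert ha, Finset.sum_insert ha]; exact (h a).add ih

theorem sub {n : ℕ} {p q : Pol n} {D T : Module.End ℂ (Pol n)} (h : DualOp p D)
    (h' : DualOp q T) : DualOp (p - q) (D - T) := by
  have := h.add (h'.smul (-1))
  have e : (-1 : ℂ) • T = -T := LinearMap.ext fun x => neg_one_smul ℂ (T x)
  rwa [neg_one_smul, e, ← sub_eq_add_neg, ← sub_eq_add_neg] at this

theorem X {n : ℕ} (j : Fin n) :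
    DualOp (MvPolynomial.X j : Pol n) ((-Complex.I) • (pderiv j).toLinearMap) := by
  have := DualOp.X_mul j (DualOp.one (n := n))
  rwa [mul_one, one_mul] at this

theorem invFourier_eq {n : ℕ} {p : Pol n} {D : Module.End ℂ (Pol n)} (h : DualOp p D)
    (ξ : Fin n → ℝ) (f : Pol n) :
    invFourier (polExp ξ p) f = eval (fun j => (ξ j : ℂ)) (D f) := by
  induction h generalizing f with
  | one =>
    have : polExp ξ 1 = expI ξ := by funext x; simp [polExp]
    rw [this, fourier_invFourier]
    rfl
  | smul c _ ih => rw [invFourier_polExp_smul, ih]; simp [smul_eval]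
  | add _ _ ih ih' => rw [invFourier_polExp_add, ih, ih']; simp
  | X_mul j _ ih => rw [invFourier_polExp_X_mul, ih]; simp

theorem pairing_eq {n : ℕ} {p : Pol n} {D : Module.End ℂ (Pol n)} (h : DualOp p D)
    (f g : Pol n) : pairing (p * g) f = pairing g (D f) := by
  induction h generalizing f with
  | one => simp
  | smul c _ ih => rw [smul_mul_assoc, pairing_smul, ih]; simp
  | add _ _ ih ih' => rw [add_mul, pairing_add, ih, ih']; simp
  | X_mul j _ ih => rw [mul_assoc, pairing_X_mul, ih]; simp

end DualOp

theorem g_e0_eInf {r m : ℕ} (Z : g r m) : Z.1 e0 eInf = 0 := by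
  have h := congrFun (congrFun ((mem_g _).1 Z.2) eInf) eInf
  simp [Matrix.mul_apply, Fintype.sum_sum_type, gram] at h
  linear_combination h / 2

theorem g_mid_eInf {r m : ℕ} (Z : g r m) (i : Fin (m + 1)) :
    Z.1 (mid i) eInf = -(eps ℂ r i * Z.1 e0 (mid i)) := by
  have h := congrFun (congrFun ((mem_g _).1 Z.2) (mid i)) eInf
  simp [Matrix.mul_apply, Fintype.sum_sum_type, gram] at h
  have e : eps ℂ r i * eps ℂ r i = 1 := by unfold eps; split_ifs <;> simp
  rw [h]
  linear_combination (-Z.1 (mid i) eInf) * e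

/-- The dual operator of `matVec r Z e0`. -/
noncomputable def dualC {r m : ℕ} (Z : g r m) : Module.End ℂ (Pol (m + 1)) :=
  Z.1 e0 e0 • 1 + ∑ j, Z.1 e0 (mid j) • ((-Complex.I) • (pderiv j).toLinearMap)

/-- The dual operator of `fieldCoeff r Z i`. -/
noncomputable def dualV {r m : ℕ} (Z : g r m) (i : Fin (m + 1)) : Module.End ℂ (Pol (m + 1)) :=
  Z.1 (mid i) e0 • 1 + ∑ j, Z.1 (mid i) (mid j) • ((-Complex.I) • (pderiv j).toLinearMap) +
    (eps ℂ r i * Z.1 e0 (mid i) / 2) • (∑ j, eps ℂ r j •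
      (((-Complex.I) • (pderiv j).toLinearMap) * ((-Complex.I) • (pderiv j).toLinearMap))) -
    dualC Z * ((-Complex.I) • (pderiv i).toLinearMap)

theorem dualOp_matVec_e0 {r m : ℕ} (Z : g r m) : DualOp (matVec r Z.1 e0) (dualC Z) := by
  have : matVec r Z.1 e0 = Z.1 e0 e0 • 1 + ∑ j, Z.1 e0 (mid j) • X j := by
    simp [matVec, Fintype.sum_sum_type, coneVec, g_e0_eInf]
  rw [this]
  exact (DualOp.one.smul _).add (DualOp.sum _ _ _ fun j => (DualOp.X j).smul _)

theorem dualOp_fieldCoeff {r m : ℕ} (Z : g r m) (i : Fin (m + 1)) :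
    DualOp (fieldCoeff r Z.1 i) (dualV Z i) := by
  have : fieldCoeff r Z.1 i = Z.1 (mid i) e0 • 1 + ∑ j, Z.1 (mid i) (mid j) • X j +
      (eps ℂ r i * Z.1 e0 (mid i) / 2) • (∑ j, eps ℂ r j • (X j * X j)) -
        X i * matVec r Z.1 e0 := by
    rw [fieldCoeff, matVec]
    simp only [Fintype.sum_sum_type, Finset.univ_unique, Finset.sum_singleton, coneVec,
      quad, smul_smul, sq]
    rw [← add_assoc]
    congr 3
    -- Skewness expresses the last column through the first row; together with the -1/2 in the last
    -- coordinate of the cone vector it produces the coefficient ε_i Z_{0i}/2 of the quadratic form.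
    rw [show Z.1 (mid i) (Sum.inr (Sum.inr default)) = _ from g_mid_eInf Z i]
    ring
  rw [this]
  exact (((DualOp.one.smul _).add (DualOp.sum _ _ _ fun j => (DualOp.X j).smul _)).add
    ((DualOp.sum _ _ _ fun j => ((DualOp.X j).X_mul j).smul _).smul _)).sub
      ((dualOp_matVec_e0 Z).X_mul i)

/-- The differential operator `dπ̃(Z)` on polynomials. -/
noncomputable def tildeOp {r m : ℕ} (lam : ℂ) (Z : g r m) : Module.End ℂ (Pol (m + 1)) :=
  lam • dualC Z + ∑ i, LinearMap.mulLeft ℂ (Complex.I • (X i : Pol (m + 1))) * dualV Z i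

theorem dpiTilde_eq {r m : ℕ} (lam : ℂ) (Z : g r m) (f : Pol (m + 1)) (ξ : Fin (m + 1) → ℝ) :
    dpiTilde lam Z f ξ = eval (fun j => (ξ j : ℂ)) (tildeOp lam Z f) := by
  -- For fixed ξ the factors iξ_i are constants; they become multiplication by iX_i once the result
  -- is evaluated at the same ξ. The factor -1 cancels the sign in the dual action.
  have h := (((dualOp_matVec_e0 Z).smul lam).add (DualOp.sum Finset.univ _ _ fun i =>
    (dualOp_fieldCoeff Z i).smul (Complex.I * ξ i))).smul (-1)
  rw [dpiTilde, dpi_expI, ← neg_one_smul ℂ (lam • matVec r Z.1 e0 + _), h.invFourier_eq]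
  simp [tildeOp, smul_eval, mul_assoc, add_comm]

theorem eq_of_real_eval {n : ℕ} {p q : Pol n}
    (h : ∀ ξ : Fin n → ℝ, eval (fun j => (ξ j : ℂ)) p = eval (fun j => (ξ j : ℂ)) q) : p = q := by
  refine MvPolynomial.funext_set (fun _ => Set.range ((↑) : ℝ → ℂ))
    (fun _ => Set.infinite_range_of_injective Complex.ofReal_injective) fun x hx => ?_
  choose y hy using fun i => hx i (Set.mem_univ i)
  obtain rfl : (fun i => (y i : ℂ)) = x := _root_.funext hy
  exact h y

/-! ### The commutation relations -/

/-- The vector field on `𝔫₋` defined by `-Z`. -/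
noncomputable def vecField (r : ℕ) {m : ℕ} (Z : Matrix (Idx m) (Idx m) ℂ) :
    Derivation ℂ (Pol (m + 1)) (Pol (m + 1)) :=
  -∑ i, fieldCoeff r Z i • pderiv i

theorem vecField_apply (r : ℕ) {m : ℕ} (Z : Matrix (Idx m) (Idx m) ℂ) (f : Pol (m + 1)) :
    vecField r Z f = -∑ i, fieldCoeff r Z i * pderiv i f := by
  have h := congrFun (map_sum (Derivation.coeFnAddMonoidHom (R := ℂ) (A := Pol (m + 1))
    (M := Pol (m + 1))) (fun i => fieldCoeff r Z i • pderiv i) Finset.univ) f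
  rw [Finset.sum_apply] at h
  rw [vecField, Derivation.neg_apply]
  exact congrArg Neg.neg h

theorem vecField_X (r : ℕ) {m : ℕ} (Z : Matrix (Idx m) (Idx m) ℂ) (i : Fin (m + 1)) :
    vecField r Z (X i) = -fieldCoeff r Z i := by
  simp [vecField_apply, pderiv_X, Pi.single_apply]

/-- With v = (1, X, -Q/2) and S the Gram matrix, SZ is antisymmetric, so vᵀSZv = 0: the vector Zv is
tangent to the null cone on which v lies. -/
theorem cone_relation {r m : ℕ} (Z : g r m) :
    matVec r Z.1 eInf + ∑ i, eps ℂ r i • (X i * matVec r Z.1 (mid i)) -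
      (1 / 2 : ℂ) • (quad r (m + 1) * matVec r Z.1 e0) = 0 := by
  have hanti (a b : Idx m) : (gram ℂ r m * Z.1) a b = -(gram ℂ r m * Z.1) b a := by
    have h := congrFun (congrFun ((mem_g _).1 Z.2) b) a
    have hs : (gram ℂ r m)ᵀ = gram ℂ r m := by
      ext x y
      rcases x with _ | i | _ <;> rcases y with _ | j | _ <;> simp [gram]
      rcases eq_or_ne i j with rfl | h
      · rfl
      · simp [h, h.symm]
    have h2 : (Z.1ᵀ * gram ℂ r m) b a = (gram ℂ r m * Z.1) a b := by
      rw [← Matrix.transpose_apply (gram ℂ r m * Z.1), Matrix.transpose_mul, hs]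
    rw [← h2, h, Matrix.mul_neg, Matrix.neg_apply]
  have hS : ∑ a, ∑ b, (gram ℂ r m * Z.1) a b • (coneVec r m a * coneVec r m b) = 0 := by
    have h : ∑ a, ∑ b, (gram ℂ r m * Z.1) a b • (coneVec r m a * coneVec r m b) =
        -∑ a, ∑ b, (gram ℂ r m * Z.1) a b • (coneVec r m a * coneVec r m b) := by
      conv_lhs => rw [Finset.sum_comm]
      simp only [← Finset.sum_neg_distrib]
      refine Finset.sum_congr rfl fun a _ => Finset.sum_congr rfl fun b _ => ?_
      rw [hanti b a, neg_smul, mul_comm]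
    exact self_eq_neg.1 h
  have hrow (a : Idx m) : ∑ b, (gram ℂ r m * Z.1) a b • (coneVec r m a * coneVec r m b) =
      coneVec r m a * ∑ c, gram ℂ r m a c • matVec r Z.1 c := by
    simp only [Matrix.mul_apply, matVec, Finset.smul_sum, Finset.mul_sum, Finset.sum_smul]
    rw [Finset.sum_comm]
    refine Finset.sum_congr rfl fun b _ => Finset.sum_congr rfl fun c _ => ?_
    rw [smul_smul, mul_smul_comm]
  simp only [hrow] at hS
  simp [Fintype.sum_sum_type, gram, coneVec] at hS
  rw [← hS, sub_eq_add_neg, ← neg_smul, add_assoc]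
  norm_num

/-- Moving v by -Zv stays on the cone to first order; adding the multiple (Zv)_0 v restores the
normalization v_0 = 1. The last coordinate is where `cone_relation` is needed. -/
theorem vecField_coneVec {r m : ℕ} (Z : g r m) (a : Idx m) :
    vecField r Z.1 (coneVec r m a) =
      -matVec r Z.1 a + matVec r Z.1 e0 * coneVec r m a := by
  rcases a with _ | i | _
  · simp [coneVec]
  · change vecField r Z.1 (X i) = -matVec r Z.1 (mid i) + _ * X i
    rw [vecField_X, fieldCoeff]
    ring
  · have h1 : vecField r Z.1 (quad r (m + 1)) =
        -(2 : ℂ) • (∑ i, eps ℂ r i • (X i * matVec r Z.1 (mid i)) -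
          quad r (m + 1) * matVec r Z.1 e0) := by
      rw [quad, map_sum, Finset.sum_mul, ← Finset.sum_sub_distrib, Finset.smul_sum]
      refine Finset.sum_congr rfl fun i _ => ?_
      rw [Derivation.map_smul, sq, Derivation.leibniz, vecField_X, fieldCoeff]
      simp only [smul_eq_C_mul, map_neg, smul_eq_mul]
      have : (C 2 : Pol (m + 1)) = 2 := rfl
      rw [this]
      ring
    have h2 := cone_relation Z
    change vecField r Z.1 ((-1 / 2 : ℂ) • quad r (m + 1)) = -matVec r Z.1 eInf +
      matVec r Z.1 e0 * ((-1 / 2 : ℂ) • quad r (m + 1))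
    rw [Derivation.map_smul, h1, mul_smul_comm, mul_comm (matVec r Z.1 e0)]
    rw [← sub_eq_zero, ← h2]
    module

theorem vecField_matVec {r m : ℕ} (Z Y : g r m) (a : Idx m) :
    vecField r Z.1 (matVec r Y.1 a) =
      -matVec r (Y.1 * Z.1) a + matVec r Z.1 e0 * matVec r Y.1 a := by
  have : matVec r (Y.1 * Z.1) a = ∑ b, Y.1 a b • matVec r Z.1 b := by
    simp only [matVec, Matrix.mul_apply, Finset.smul_sum, Finset.sum_smul, smul_smul]
    rw [Finset.sum_comm]
  rw [this, matVec, map_sum, Finset.mul_sum, ← Finset.sum_neg_distrib, ← Finset.sum_add_distrib]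
  refine Finset.sum_congr rfl fun b _ => ?_
  rw [Derivation.map_smul, vecField_coneVec, smul_add, smul_neg, mul_smul_comm]

theorem matVec_sub (r : ℕ) {m : ℕ} (Z Y : Matrix (Idx m) (Idx m) ℂ) (a : Idx m) :
    matVec r (Z - Y) a = matVec r Z a - matVec r Y a := by
  simp [matVec, sub_smul]

theorem vecField_lie {r m : ℕ} (Z Y : g r m) :
    ⁅vecField r Z.1, vecField r Y.1⁆ = vecField r (Z.1 * Y.1 - Y.1 * Z.1) := by
  refine MvPolynomial.derivation_ext fun i => ?_
  rw [Derivation.commutator_apply]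
  simp only [vecField_X, fieldCoeff, map_neg, map_sub, Derivation.leibniz, vecField_matVec,
    smul_eq_mul, matVec_sub]
  ring

/-- The operator `dπ(Z)` on polynomials. -/
noncomputable def polOp {r m : ℕ} (lam : ℂ) (Z : g r m) (f : Pol (m + 1)) : Pol (m + 1) :=
  vecField r Z.1 f - lam • (matVec r Z.1 e0 * f)

/-- The vector fields form a representation by `vecField_lie`, and the multiplier (Zv)_0 satisfies
the cocycle identity because of `vecField_matVec`. -/
theorem polOp_lie {r m : ℕ} (lam : ℂ) (Z Y : g r m) (f : Pol (m + 1)) :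
    polOp lam ⁅Z, Y⁆ f = polOp lam Z (polOp lam Y f) - polOp lam Y (polOp lam Z f) := by
  have hb : (⁅Z, Y⁆ : g r m).1 = Z.1 * Y.1 - Y.1 * Z.1 := rfl
  have h1 := congrArg (fun D => D f) (vecField_lie Z Y)
  simp only [Derivation.commutator_apply] at h1
  simp only [polOp, hb, ← h1, matVec_sub, map_sub, Derivation.map_smul, Derivation.leibniz,
    vecField_matVec, smul_eq_mul]
  simp only [smul_eq_C_mul]
  ring

theorem polOp_add {r m : ℕ} (lam : ℂ) (Z Y : g r m) (f : Pol (m + 1)) :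
    polOp lam (Z + Y) f = polOp lam Z f + polOp lam Y f := by
  have h (a : Idx m) : matVec r (Z + Y).1 a = matVec r Z.1 a + matVec r Y.1 a := by
    simp [matVec, add_smul, Finset.sum_add_distrib]
  simp only [polOp, vecField_apply, fieldCoeff, h, mul_add, add_mul, sub_mul,
    Finset.sum_add_distrib, Finset.sum_sub_distrib, smul_add]
  abel

theorem polOp_smul {r m : ℕ} (lam c : ℂ) (Z : g r m) (f : Pol (m + 1)) :
    polOp lam (c • Z) f = c • polOp lam Z f := by
  have h (a : Idx m) : matVec r (c • Z).1 a = c • matVec r Z.1 a := by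
    simp [matVec, Finset.smul_sum, smul_smul]
  simp only [polOp, vecField_apply, fieldCoeff, h, mul_smul_comm, smul_mul_assoc, ← smul_sub,
    ← Finset.smul_sum, smul_comm lam c, ← smul_neg]

/-- Under the pairing, multiplication by X_j is transposed to -i∂_j and ∂_j to multiplication by
iX_j, so dπ̃(Z) is minus the transpose of the first-order operator dπ(Z). -/
theorem pairing_tildeOp {r m : ℕ} (lam : ℂ) (Z : g r m) (f h : Pol (m + 1)) :
    pairing h (tildeOp lam Z f) = -pairing (polOp lam Z h) f := by
  have hs (s : Finset (Fin (m + 1))) (p : Fin (m + 1) → Pol (m + 1)) :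
      pairing (∑ i ∈ s, p i) f = ∑ i ∈ s, pairing (p i) f := by
    classical
    induction s using Finset.induction_on with
    | empty => simpa using pairing_smul 0 f 0
    | insert a s ha ih => rw [Finset.sum_insert ha, Finset.sum_insert ha, pairing_add, ih]
  have h1 : polOp lam Z h = (-1 : ℂ) • (lam • (matVec r Z.1 e0 * h) +
      ∑ i, fieldCoeff r Z.1 i * pderiv i h) := by
    rw [polOp, vecField_apply, neg_one_smul]
    abel
  rw [h1, pairing_smul, pairing_add, pairing_smul, hs, (dualOp_matVec_e0 Z).pairing_eq]
  simp only [(dualOp_fieldCoeff Z _).pairing_eq, pairing_pderiv, tildeOp]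
  simp

theorem ext_pairing {n : ℕ} {p q : Pol n} (h : ∀ g, pairing g p = pairing g q) : p = q :=
  sub_eq_zero.1 (eq_zero_of_pairing _ fun g => by rw [map_sub, h, sub_self])

/-- A direct computation with second-order operators is avoided: minus the transpose of a
representation is again a representation, and the pairing is nondegenerate. -/
theorem tildeOp_lie {r m : ℕ} (lam : ℂ) (Z Y : g r m) (f : Pol (m + 1)) :
    tildeOp lam ⁅Z, Y⁆ f = tildeOp lam Z (tildeOp lam Y f) - tildeOp lam Y (tildeOp lam Z f) := by
  refine ext_pairing fun h => ?_
  have hn (p q : Pol (m + 1)) : pairing (p - q) f = pairing p f - pairing q f := by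
    rw [sub_eq_add_neg, ← neg_one_smul ℂ q, pairing_add, pairing_smul]; ring
  rw [map_sub]
  simp only [pairing_tildeOp, polOp_lie, hn]
  ring

theorem tildeOp_add {r m : ℕ} (lam : ℂ) (Z Y : g r m) (f : Pol (m + 1)) :
    tildeOp lam (Z + Y) f = tildeOp lam Z f + tildeOp lam Y f := by
  refine ext_pairing fun h => ?_
  rw [map_add]
  simp only [pairing_tildeOp, polOp_add, pairing_add]
  ring

theorem tildeOp_smul {r m : ℕ} (lam c : ℂ) (Z : g r m) (f : Pol (m + 1)) :
    tildeOp lam (c • Z) f = c • tildeOp lam Z f := by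
  refine ext_pairing fun h => ?_
  rw [map_smul]
  simp only [pairing_tildeOp, polOp_smul, pairing_smul, smul_eq_mul]
  ring

/-- The representation `dπ̃` of `𝔤` on polynomials. -/
noncomputable def tildeRep (r m : ℕ) (lam : ℂ) : g r m →ₗ⁅ℂ⁆ Module.End ℂ (Pol (m + 1)) where
  toFun Z := tildeOp lam Z
  map_add' Z Y := LinearMap.ext (tildeOp_add lam Z Y)
  map_smul' c Z := LinearMap.ext (tildeOp_smul lam c Z)
  map_lie' {Z Y} := LinearMap.ext (tildeOp_lie lam Z Y)


/-! ### The operators `dπ̃(Z)` on `𝔫₋`, `𝔭` and `𝔫₊` -/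

theorem eps_mul_self (r : ℕ) {n : ℕ} (i : Fin n) : eps ℂ r i * eps ℂ r i = 1 := by
  unfold eps; split_ifs <;> simp

theorem g_eInf_e0 {r m : ℕ} (Z : g r m) : Z.1 eInf e0 = 0 := by
  have h := congrFun (congrFun ((mem_g _).1 Z.2) e0) e0
  simp [Matrix.mul_apply, Fintype.sum_sum_type, gram] at h
  linear_combination h / 2

/-- The matrices of the basis vectors of `𝔫₋`. -/
def negMat (r : ℕ) {m : ℕ} (j : Fin (m + 1)) : Matrix (Idx m) (Idx m) ℂ := fun x y =>
  match x, y with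
  | Sum.inr (Sum.inl i), Sum.inl _ => if i = j then 1 else 0
  | Sum.inr (Sum.inr _), Sum.inr (Sum.inl i) => if i = j then -eps ℂ r j else 0
  | _, _ => 0

/-- The matrices of the basis vectors of `𝔫₊`. -/
def posMat (r : ℕ) {m : ℕ} (j : Fin (m + 1)) : Matrix (Idx m) (Idx m) ℂ := fun x y =>
  match x, y with
  | Sum.inl _, Sum.inr (Sum.inl i) => if i = j then 1 else 0
  | Sum.inr (Sum.inl i), Sum.inr (Sum.inr _) => if i = j then -eps ℂ r j else 0
  | _, _ => 0

theorem negMat_mem (r : ℕ) {m : ℕ} (j : Fin (m + 1)) : negMat r j ∈ g r m := by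
  rw [mem_g]
  ext x y
  rcases x with _ | i | _ <;> rcases y with _ | k | _ <;>
    simp [Matrix.mul_apply, Fintype.sum_sum_type, gram, negMat]
  all_goals split_ifs <;> simp_all

theorem posMat_mem (r : ℕ) {m : ℕ} (j : Fin (m + 1)) : posMat r j ∈ g r m := by
  rw [mem_g]
  ext x y
  have := eps_mul_self r j
  rcases x with _ | i | _ <;> rcases y with _ | k | _ <;>
    simp [Matrix.mul_apply, Fintype.sum_sum_type, gram, posMat]
  all_goals split_ifs <;> simp_all

/-- The basis vectors of `𝔫₋`. -/
def negElt (r : ℕ) {m : ℕ} (j : Fin (m + 1)) : g r m := ⟨negMat r j, negMat_mem r j⟩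

/-- The basis vectors of `𝔫₊`. -/
def posElt (r : ℕ) {m : ℕ} (j : Fin (m + 1)) : g r m := ⟨posMat r j, posMat_mem r j⟩

theorem tildeOp_negElt {r m : ℕ} (lam : ℂ) (j : Fin (m + 1)) (f : Pol (m + 1)) :
    tildeOp lam (negElt r j) f = Complex.I • (X j * f) := by
  simp [tildeOp, dualC, dualV, negElt, negMat]

theorem tildeOp_one {r m : ℕ} (lam : ℂ) (Z : g r m) (hZ : InP Z) :
    tildeOp lam Z 1 = (lam * Z.1 e0 e0) • 1 := by
  have h (i : Fin (m + 1)) : Z.1 (mid i) e0 = 0 := hZ _ (by simp)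
  simp [tildeOp, dualC, dualV, h, smul_smul]

theorem box_apply (r n : ℕ) (f : Pol n) :
    box r n f = ∑ i, eps ℂ r i • pderiv i (pderiv i f) := by
  simp [box]

theorem euler_apply (n : ℕ) (f : Pol n) : euler n f = ∑ i, X i * pderiv i f := by
  simp [euler]

theorem P_apply (r n : ℕ) (lam : ℂ) (j : Fin n) (f : Pol n) :
    P r n lam j f = -Complex.I • ((eps ℂ r j / 2) • (X j * box r n f) +
      (lam • pderiv j f - euler n (pderiv j f))) := by
  simp [P]

theorem pderiv_comm {n : ℕ} (i j : Fin n) (f : Pol n) :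
    pderiv i (pderiv j f) = pderiv j (pderiv i f) := by
  ext α
  simp only [coeff_pderiv, add_right_comm α]
  rcases eq_or_ne i j with rfl | h
  · rfl
  · simp [h, h.symm]
    ring

/-- For Z ∈ 𝔫₊ the vector field has only its quadratic part, determined by the first row of Z. The
square (-i)² turns the quadratic form into -□, and the term from dilation gives the Euler operator.
-/
theorem tildeOp_nPlus {r m : ℕ} (lam : ℂ) (Z : g r m) (hZ : InNPlus Z) (f : Pol (m + 1)) :
    tildeOp lam Z f = ∑ j, Z.1 e0 (mid j) • P r (m + 1) lam j f := by
  obtain ⟨h1, h2, h3⟩ := hZ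
  have h (i : Fin (m + 1)) : Z.1 (mid i) e0 = 0 := h1 _ (by simp)
  have hC (p : Pol (m + 1)) : dualC Z p = ∑ j, (-Complex.I * Z.1 e0 (mid j)) • pderiv j p := by
    simp [dualC, h2, smul_smul, mul_comm]
  have hV (i : Fin (m + 1)) : dualV Z i f = (-(eps ℂ r i * Z.1 e0 (mid i) / 2)) • box r (m + 1) f +
      ∑ j, Z.1 e0 (mid j) • pderiv i (pderiv j f) := by
    have e1 : dualC Z (pderiv i f) = -Complex.I • ∑ j, Z.1 e0 (mid j) • pderiv i (pderiv j f) := by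
      rw [hC, Finset.smul_sum]
      refine Finset.sum_congr rfl fun j _ => ?_
      rw [smul_smul, pderiv_comm]
    have e2 : ∑ j, eps ℂ r j • (-Complex.I • pderiv j (-Complex.I • pderiv j f)) =
        -box r (m + 1) f := by
      rw [box_apply, ← Finset.sum_neg_distrib]
      refine Finset.sum_congr rfl fun j _ => ?_
      rw [Derivation.map_smul, smul_smul (-Complex.I)]
      simp
    have : dualV Z i f = (eps ℂ r i * Z.1 e0 (mid i) / 2) •
        (∑ j, eps ℂ r j • (-Complex.I • pderiv j (-Complex.I • pderiv j f))) -
        dualC Z (-Complex.I • pderiv i f) := by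
      simp [dualV, h, h3, LinearMap.sum_apply]
    rw [this, e2, map_smul, e1, smul_smul, smul_neg, neg_smul, sub_eq_add_neg, ← neg_smul]
    simp
  have hT : tildeOp lam Z f = lam • dualC Z f + ∑ i, Complex.I • (X i * dualV Z i f) := by
    simp [tildeOp]
  have hE (j : Fin (m + 1)) : euler (m + 1) (pderiv j f) =
      ∑ i, X i * pderiv i (pderiv j f) := euler_apply _ _
  rw [hT, hC]
  simp only [hV, P_apply, hE, mul_add, smul_add, smul_sub, Finset.sum_add_distrib,
    Finset.sum_sub_distrib, Finset.smul_sum, Finset.mul_sum]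
  have e3 : ∑ i, ∑ j, Complex.I • (X i * Z.1 e0 (mid j) • pderiv i (pderiv j f)) =
      -∑ j, ∑ i, Z.1 e0 (mid j) • -Complex.I • (X i * pderiv i (pderiv j f)) := by
    rw [Finset.sum_comm]
    simp only [← Finset.sum_neg_distrib]
    refine Finset.sum_congr rfl fun j _ => Finset.sum_congr rfl fun i _ => ?_
    rw [mul_smul_comm, neg_smul, smul_neg, neg_neg, smul_comm]
  have e4 : ∑ j, lam • (-Complex.I * Z.1 e0 (mid j)) • pderiv j f =
      ∑ j, Z.1 e0 (mid j) • -Complex.I • lam • pderiv j f := by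
    refine Finset.sum_congr rfl fun j _ => ?_
    simp only [smul_smul]; congr 1; ring
  have e5 : ∑ i, Complex.I • (X i * (-(eps ℂ r i * Z.1 e0 (mid i) / 2)) • box r (m + 1) f) =
      ∑ j, Z.1 e0 (mid j) • -Complex.I • (eps ℂ r j / 2) • (X j * box r (m + 1) f) := by
    refine Finset.sum_congr rfl fun j _ => ?_
    rw [mul_smul_comm]
    simp only [smul_smul]; congr 1; ring
  rw [e3, e4, e5]
  abel

theorem mem_Sol_iff_tildeOp {r m : ℕ} (lam : ℂ) (f : Pol (m + 1)) :
    f ∈ Sol r m lam ↔ ∀ Z : g r m, InNPlusPrime Z → tildeOp lam Z f = 0 := by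
  change (∀ Z : g r m, InNPlusPrime Z → ∀ ξ, dpiTilde lam Z f ξ = 0) ↔ _
  refine forall₂_congr fun Z _ => ⟨fun h => eq_of_real_eval fun ξ => ?_, fun h ξ => ?_⟩
  · rw [← dpiTilde_eq, h, map_zero]
  · rw [dpiTilde_eq, h, map_zero]

/-- The condition of lying in 𝔤' kills exactly the coordinate Z_{0n} of Z ∈ 𝔫₊, so 𝔫₊' tests the
operators P_j with j < n and no others. -/
theorem mem_Sol_iff {r m : ℕ} (lam : ℂ) (f : Pol (m + 1)) :
    f ∈ Sol r m lam ↔ ∀ j : Fin m, P r (m + 1) lam j.castSucc f = 0 := by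
  rw [mem_Sol_iff_tildeOp]
  constructor
  · intro h j
    have hn : InNPlus (posElt r j.castSucc) := by
      refine ⟨fun x hx => ?_, rfl, fun _ _ => rfl⟩
      rcases x with _ | i | _ <;> first | exact absurd rfl hx | rfl
    have h1 := h (posElt r j.castSucc) ⟨hn, fun x => by
      rcases x with _ | i | _ <;> simp [posElt, posMat, (Fin.castSucc_lt_last j).ne']⟩
    rw [tildeOp_nPlus lam _ hn] at h1
    simpa [posElt, posMat] using h1
  · intro h Z hZ
    rw [tildeOp_nPlus lam Z hZ.1, Fin.sum_univ_castSucc]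
    simp [h, hZ.2 e0]

/-! ### The isomorphism `φ` -/

/-- The action of `U(𝔤)` on polynomials. -/
noncomputable def tildeU (r m : ℕ) (lam : ℂ) : U r m →ₐ[ℂ] Module.End ℂ (Pol (m + 1)) :=
  UniversalEnvelopingAlgebra.lift ℂ (tildeRep r m lam)

theorem tildeU_ι {r m : ℕ} (lam : ℂ) (Z : g r m) :
    tildeU r m lam (UniversalEnvelopingAlgebra.ι ℂ Z) = tildeOp lam Z :=
  UniversalEnvelopingAlgebra.lift_ι_apply ℂ (tildeRep r m lam) Z

/-- The map `u ⊗ v ↦ u · v`. -/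
noncomputable def preTheta (r m : ℕ) (lam : ℂ) : U r m ⊗[ℂ] ℂ →ₗ[ℂ] Pol (m + 1) :=
  TensorProduct.lift (LinearMap.lsmul ℂ (Pol (m + 1))
    |>.flip.comp ((LinearMap.applyₗ (1 : Pol (m + 1))).comp (tildeU r m lam).toLinearMap))

theorem preTheta_tmul {r m : ℕ} (lam : ℂ) (u : U r m) (v : ℂ) :
    preTheta r m lam (u ⊗ₜ v) = v • tildeU r m lam u 1 := by
  simp [preTheta]

theorem preTheta_smul {r m : ℕ} (lam : ℂ) (u : U r m) (t : U r m ⊗[ℂ] ℂ) :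
    preTheta r m lam (u • t) = tildeU r m lam u (preTheta r m lam t) := by
  induction t with
  | zero => simp
  | add x y hx hy => rw [smul_add, map_add, hx, hy, map_add, map_add]
  | tmul x y => rw [TensorProduct.smul_tmul', preTheta_tmul, preTheta_tmul]; simp

theorem preTheta_rel (r m : ℕ) (lam : ℂ) :
    (vermaRel r m lam).restrictScalars ℂ ≤ LinearMap.ker (preTheta r m lam) := by
  intro t ht
  change t ∈ vermaRel r m lam at ht
  rw [LinearMap.mem_ker]
  unfold vermaRel at ht
  induction ht using Submodule.span_induction with
  | zero => simp
  | add x y _ _ hx hy => rw [map_add, hx, hy, add_zero]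
  | smul u x _ hx => rw [preTheta_smul, hx, map_zero]
  | mem x hx =>
    obtain ⟨u, Z, v, hZ, rfl⟩ := hx
    rw [map_sub, preTheta_tmul, preTheta_tmul, map_mul, tildeU_ι, Module.End.mul_apply,
      tildeOp_one lam Z hZ, map_smul, smul_smul, mul_comm, sub_self]

/-- The map `M(λ) → Pol` which intertwines the actions of `𝔤`. -/
noncomputable def theta (r m : ℕ) (lam : ℂ) : Verma r m lam →ₗ[ℂ] Pol (m + 1) :=
  Submodule.liftQ _ (preTheta r m lam) (preTheta_rel r m lam) ∘ₗ
    (Submodule.Quotient.restrictScalarsEquiv ℂ (vermaRel r m lam)).symm.toLinearMap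

theorem theta_mkQ {r m : ℕ} (lam : ℂ) (t : U r m ⊗[ℂ] ℂ) :
    theta r m lam ((vermaRel r m lam).mkQ t) = preTheta r m lam t := rfl

theorem theta_smul {r m : ℕ} (lam : ℂ) (u : U r m) (x : Verma r m lam) :
    theta r m lam (u • x) = tildeU r m lam u (theta r m lam x) := by
  obtain ⟨t, rfl⟩ := (vermaRel r m lam).mkQ_surjective x
  rw [← map_smul, theta_mkQ, theta_mkQ, preTheta_smul]

theorem theta_vermaAct {r m : ℕ} {lam : ℂ} (Z : g r m) (x : Verma r m lam) :
    theta r m lam (vermaAct Z x) = tildeOp lam Z (theta r m lam x) := by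
  rw [vermaAct, theta_smul, tildeU_ι]

theorem negElt_lie {r m : ℕ} (i j : Fin (m + 1)) : ⁅negElt r i, negElt r j⁆ = 0 := by
  apply Subtype.ext
  change negMat r i * negMat r j - negMat r j * negMat r i = 0
  ext x y
  rcases x with _ | k | _ <;> rcases y with _ | l | _ <;>
    simp [Matrix.mul_apply, Fintype.sum_sum_type, negMat]
  rcases eq_or_ne i j with rfl | h
  · simp
  · simp [h, h.symm]

-- Polynomials can be evaluated only in a commutative algebra. As 𝔫₋ is abelian, the subalgebra
-- generated by its basis vectors is one. The scalar -i makes X_j correspond to multiplication by -i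
-- · iξ_j = ξ_j under dπ̃.
open scoped IsMulCommutative in
theorem exists_algHom_negElt (r m : ℕ) : ∃ F : Pol (m + 1) →ₐ[ℂ] U r m,
    ∀ j, F (X j) = -Complex.I • UniversalEnvelopingAlgebra.ι ℂ (negElt r j) := by
  let s : Set (U r m) := Set.range fun j : Fin (m + 1) =>
    UniversalEnvelopingAlgebra.ι ℂ (negElt r j)
  have hs : ∀ a ∈ s, ∀ b ∈ s, a * b = b * a := by
    rintro _ ⟨i, rfl⟩ _ ⟨j, rfl⟩
    have h := (UniversalEnvelopingAlgebra.ι ℂ).map_lie (negElt r i) (negElt r j)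
    rw [negElt_lie, map_zero, LieRing.of_associative_ring_bracket] at h
    exact (sub_eq_zero.1 h.symm)
  have := Algebra.isMulCommutative_adjoin ℂ hs
  refine ⟨(Algebra.adjoin ℂ s).val.comp (aeval fun j => -Complex.I •
    (⟨_, Algebra.subset_adjoin ⟨j, rfl⟩⟩ : Algebra.adjoin ℂ s)), fun j => ?_⟩
  rw [AlgHom.comp_apply, aeval_X]
  rfl

/-- The map `ξ_j ↦ -i Y_j` from polynomials to `U(𝔤)`. -/
noncomputable def polToU (r m : ℕ) : Pol (m + 1) →ₐ[ℂ] U r m := (exists_algHom_negElt r m).choose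

theorem polToU_X {r m : ℕ} (j : Fin (m + 1)) :
    polToU r m (X j) = -Complex.I • UniversalEnvelopingAlgebra.ι ℂ (negElt r j) :=
  (exists_algHom_negElt r m).choose_spec j

theorem tildeU_polToU {r m : ℕ} (lam : ℂ) (f h : Pol (m + 1)) :
    tildeU r m lam (polToU r m f) h = f * h := by
  induction f using MvPolynomial.induction_on generalizing h with
  | C a =>
    rw [← MvPolynomial.algebraMap_eq, AlgHom.commutes, AlgHom.commutes, Module.algebraMap_end_apply,
      Algebra.smul_def]
  | add p q hp hq => rw [map_add, map_add, LinearMap.add_apply, hp, hq, add_mul]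
  | mul_X p i hp =>
    rw [map_mul, map_mul, Module.End.mul_apply, polToU_X, map_smul, tildeU_ι, LinearMap.smul_apply,
      tildeOp_negElt, hp, smul_smul]
    simp [mul_assoc]

/-- The map `f ↦ f(-i Y) ⊗ 1`. -/
noncomputable def kappa (r m : ℕ) (lam : ℂ) : Pol (m + 1) →ₗ[ℂ] Verma r m lam where
  toFun f := polToU r m f • vermaMk lam 1 1
  map_add' f h := by rw [map_add, add_smul]
  map_smul' c f := by rw [map_smul, smul_assoc]; rfl

theorem vermaMk_eq {r m : ℕ} (lam : ℂ) (u : U r m) (v : ℂ) :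
    vermaMk lam u v = v • u • (vermaMk lam 1 1 : Verma r m lam) := by
  have : u ⊗ₜ[ℂ] v = v • u • ((1 : U r m) ⊗ₜ[ℂ] (1 : ℂ)) := by
    rw [TensorProduct.smul_tmul', ← TensorProduct.tmul_smul, smul_eq_mul, smul_eq_mul, mul_one,
      mul_one]
  rw [vermaMk, this]
  rfl

theorem kappa_one (r m : ℕ) (lam : ℂ) : kappa r m lam 1 = vermaMk lam 1 1 := by
  change polToU r m 1 • (vermaMk lam 1 1 : Verma r m lam) = _
  rw [map_one, one_smul]

theorem theta_kappa {r m : ℕ} (lam : ℂ) (f : Pol (m + 1)) :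
    theta r m lam (kappa r m lam f) = f := by
  have h1 : theta r m lam (vermaMk lam 1 1) = 1 := by
    rw [vermaMk, theta_mkQ, preTheta_tmul]; simp
  change theta r m lam (polToU r m f • (vermaMk lam 1 1 : Verma r m lam)) = f
  rw [theta_smul, h1, tildeU_polToU, mul_one]

theorem vermaAct_smul {r m : ℕ} {lam : ℂ} (Z : g r m) (c : ℂ) (x : Verma r m lam) :
    vermaAct Z (c • x) = c • vermaAct Z x := by
  simp only [vermaAct]; rw [smul_comm]

theorem kappa_mul_X {r m : ℕ} (lam : ℂ) (f : Pol (m + 1)) (j : Fin (m + 1)) :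
    kappa r m lam (f * X j) = -Complex.I • vermaAct (negElt r j) (kappa r m lam f) := by
  change polToU r m (f * X j) • (vermaMk lam 1 1 : Verma r m lam) =
    -Complex.I • (UniversalEnvelopingAlgebra.ι ℂ (negElt r j) : U r m) •
      (polToU r m f • (vermaMk lam 1 1 : Verma r m lam))
  rw [mul_comm, map_mul, polToU_X, mul_smul, smul_assoc]

theorem vermaAct_negElt_kappa {r m : ℕ} (lam : ℂ) (f : Pol (m + 1)) (j : Fin (m + 1)) :
    vermaAct (negElt r j) (kappa r m lam f) = kappa r m lam (Complex.I • (X j * f)) := by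
  rw [map_smul, mul_comm, kappa_mul_X, smul_smul]
  simp

theorem vermaAct_add_left {r m : ℕ} {lam : ℂ} (Z Y : g r m) (x : Verma r m lam) :
    vermaAct (Z + Y) x = vermaAct Z x + vermaAct Y x := by
  simp only [vermaAct, map_add, add_smul]

theorem vermaAct_sum_smul {r m : ℕ} {lam : ℂ} {ι : Type*} (s : Finset ι) (c : ι → ℂ)
    (Z : ι → g r m) (x : Verma r m lam) :
    vermaAct (∑ i ∈ s, c i • Z i) x = ∑ i ∈ s, c i • vermaAct (Z i) x := by
  simp only [vermaAct, map_sum, Finset.sum_smul, map_smul, smul_assoc]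

theorem vermaAct_mk_one {r m : ℕ} (lam : ℂ) (Z : g r m) (hZ : InP Z) :
    vermaAct Z (vermaMk lam 1 1) = (lam * Z.1 e0 e0) • vermaMk lam 1 1 := by
  have h : (1 * UniversalEnvelopingAlgebra.ι ℂ Z : U r m) ⊗ₜ[ℂ] (1 : ℂ) -
      1 ⊗ₜ[ℂ] (lam * Z.1 e0 e0 * 1) ∈ vermaRel r m lam :=
    Submodule.subset_span ⟨1, Z, 1, hZ, rfl⟩
  rw [← Submodule.Quotient.mk_eq_zero, Submodule.Quotient.mk_sub, sub_eq_zero] at h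
  have h' : vermaMk lam (1 * UniversalEnvelopingAlgebra.ι ℂ Z) 1 =
      (vermaMk lam 1 (lam * Z.1 e0 e0 * 1) : Verma r m lam) := h
  rw [vermaMk_eq, vermaMk_eq lam 1 (_ * 1), one_mul, one_smul, one_smul, mul_one] at h'
  exact h'

/-- Stability of U(𝔫₋) ⊗ 1 under 𝔤, by induction on the degree for all Z at once: Z Y_i = Y_i Z +
[Z, Y_i] moves Z past one factor. -/
theorem vermaAct_kappa_mem {r m : ℕ} (lam : ℂ) (f : Pol (m + 1)) (Z : g r m) :
    vermaAct Z (kappa r m lam f) ∈ LinearMap.range (kappa r m lam) := by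
  induction f using MvPolynomial.induction_on generalizing Z with
  | C a =>
    have hk : kappa r m lam (C a) = a • kappa r m lam 1 := by
      rw [← map_smul, smul_eq_C_mul, mul_one]
    -- The first column of Z gives its 𝔫₋-component Y, so that Z - Y lies in 𝔭 and acts on the
    -- generator by a scalar.
    set Y : g r m := ∑ j, Z.1 (mid j) e0 • negElt r j with hY
    have hYe (x : Idx m) : Y.1 x e0 = ∑ j, Z.1 (mid j) e0 * (negElt r j).1 x e0 := by
      have : Y.1 = ∑ j, Z.1 (mid j) e0 • (negElt r j).1 := by
        rw [hY]; simp
      rw [this, Matrix.sum_apply]; rfl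
    have hP : InP (Z - Y) := by
      intro x hx
      change Z.1 x e0 - Y.1 x e0 = 0
      rw [hYe]
      rcases x with _ | i | _
      · exact absurd rfl hx
      · simp [negElt, negMat]
      · rw [show Z.1 (Sum.inr (Sum.inr _)) e0 = 0 from g_eInf_e0 Z]
        simp [negElt, negMat]
    have hZ : Z = (Z - Y) + Y := by abel
    rw [hk, vermaAct_smul, hZ, vermaAct_add_left]
    refine Submodule.smul_mem _ _ (Submodule.add_mem _ ?_ ?_)
    · rw [kappa_one, vermaAct_mk_one lam _ hP, ← kappa_one]
      exact Submodule.smul_mem _ _ ⟨_, rfl⟩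
    · rw [hY, vermaAct_sum_smul]
      refine Submodule.sum_mem _ fun j _ => Submodule.smul_mem _ _ ?_
      rw [vermaAct_negElt_kappa]
      exact ⟨_, rfl⟩
  | add p q hp hq =>
    have : vermaAct Z (kappa r m lam (p + q)) =
        vermaAct Z (kappa r m lam p) + vermaAct Z (kappa r m lam q) := by
      rw [map_add, vermaAct, smul_add]; rfl
    rw [this]
    exact Submodule.add_mem _ (hp Z) (hq Z)
  | mul_X p i hp =>
    rw [kappa_mul_X, vermaAct_smul]
    refine Submodule.smul_mem _ _ ?_
    have : vermaAct Z (vermaAct (negElt r i) (kappa r m lam p)) =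
        vermaAct (negElt r i) (vermaAct Z (kappa r m lam p)) +
          vermaAct ⁅Z, negElt r i⁆ (kappa r m lam p) := by
      simp only [vermaAct, LieHom.map_lie, LieRing.of_associative_ring_bracket, sub_smul, mul_smul]
      abel
    rw [this]
    refine Submodule.add_mem _ ?_ (hp _)
    obtain ⟨h, hh⟩ := hp Z
    rw [← hh, vermaAct_negElt_kappa]
    exact ⟨_, rfl⟩

/-- The elements of U(𝔤) preserving the range form a subalgebra S containing 𝔤, hence all of U(𝔤),
and the range contains the cyclic vector. With `theta_kappa` this replaces the
Poincaré-Birkhoff-Witt theorem. -/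
theorem kappa_surjective (r m : ℕ) (lam : ℂ) : Function.Surjective (kappa r m lam) := by
  let S : Subalgebra ℂ (U r m) :=
    { carrier := {u | ∀ x ∈ LinearMap.range (kappa r m lam), u • x ∈ LinearMap.range (kappa r m lam)}
      mul_mem' := fun {a b} ha hb x hx => by rw [mul_smul]; exact ha _ (hb _ hx)
      add_mem' := fun {a b} ha hb x hx => by
        rw [add_smul]; exact Submodule.add_mem _ (ha _ hx) (hb _ hx)
      algebraMap_mem' := fun c x hx => by
        rw [algebraMap_smul]; exact Submodule.smul_mem _ _ hx }
  have hι (Z : g r m) : UniversalEnvelopingAlgebra.ι ℂ Z ∈ S := by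
    rintro _ ⟨f, rfl⟩
    exact vermaAct_kappa_mem lam f Z
  let j : g r m →ₗ⁅ℂ⁆ S :=
    { toFun := fun Z => ⟨UniversalEnvelopingAlgebra.ι ℂ Z, hι Z⟩
      map_add' := fun Z Y => Subtype.ext (map_add _ _ _)
      map_smul' := fun c Z => Subtype.ext (map_smul _ _ _)
      map_lie' := fun {Z Y} => Subtype.ext (LieHom.map_lie _ _ _) }
  -- That 𝔤 generates U(𝔤) follows from the universal property: lifting 𝔤 → S and including S back
  -- agrees with the identity on 𝔤.
  have hid : S.val.comp (UniversalEnvelopingAlgebra.lift ℂ j) = AlgHom.id ℂ (U r m) := by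
    refine UniversalEnvelopingAlgebra.hom_ext ℂ (LieHom.ext fun Z => ?_)
    change (UniversalEnvelopingAlgebra.lift ℂ j (UniversalEnvelopingAlgebra.ι ℂ Z)).1 = _
    rw [UniversalEnvelopingAlgebra.lift_ι_apply]
    rfl
  have hS (u : U r m) : u ∈ S := by
    have := (UniversalEnvelopingAlgebra.lift ℂ j u).2
    rwa [show ((UniversalEnvelopingAlgebra.lift ℂ j u : S) : U r m) = u from
      congrArg (fun F => F u) hid] at this
  intro x
  obtain ⟨t, rfl⟩ := (vermaRel r m lam).mkQ_surjective x
  change (vermaRel r m lam).mkQ t ∈ LinearMap.range (kappa r m lam)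
  induction t with
  | zero => rw [map_zero]; exact Submodule.zero_mem _
  | add x y hx hy => rw [map_add]; exact Submodule.add_mem _ hx hy
  | tmul u v =>
    change vermaMk lam u v ∈ _
    rw [vermaMk_eq]
    exact Submodule.smul_mem _ _ (hS u _ ⟨1, kappa_one r m lam⟩)

/-- The isomorphism `φ`. -/
noncomputable def phi (r m : ℕ) (lam : ℂ) : Pol (m + 1) ≃ₗ[ℂ] Verma r m lam :=
  LinearEquiv.ofBijective (kappa r m lam)
    ⟨Function.LeftInverse.injective (theta_kappa lam), kappa_surjective r m lam⟩


theorem phi_apply (r m : ℕ) (lam : ℂ) (f : Pol (m + 1)) : phi r m lam f = kappa r m lam f := rfl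

theorem phi_symm_apply (r m : ℕ) (lam : ℂ) (x : Verma r m lam) :
    (phi r m lam).symm x = theta r m lam x := by
  obtain ⟨f, rfl⟩ := (phi r m lam).surjective x
  rw [LinearEquiv.symm_apply_apply, phi_apply, theta_kappa]

theorem isPhi_phi (r m : ℕ) (lam : ℂ) : IsPhi (phi r m lam) := by
  refine ⟨kappa_one r m lam, fun Z v ξ => ?_⟩
  rw [phi_symm_apply, phi_symm_apply, theta_vermaAct, dpiTilde_eq]

/-- Intertwining the elements of 𝔫₋ alone forces compatibility with multiplication by each ξ_j, so
the value at 1 determines the map. -/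
theorem IsPhi.eq_phi {r m : ℕ} {lam : ℂ} {ψ : Pol (m + 1) ≃ₗ[ℂ] Verma r m lam} (h : IsPhi ψ) :
    ψ = phi r m lam := by
  have hZ (Z : g r m) (f : Pol (m + 1)) : vermaAct Z (ψ f) = ψ (tildeOp lam Z f) := by
    refine ψ.symm_apply_eq.1 ?_
    refine eq_of_real_eval fun ξ => ?_
    rw [h.2, dpiTilde_eq, ψ.symm_apply_apply]
  refine LinearEquiv.ext fun f => ?_
  rw [phi_apply]
  induction f using MvPolynomial.induction_on with
  | C a => rw [← mul_one (C a), ← smul_eq_C_mul, map_smul, map_smul, h.1, kappa_one]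
  | add p q hp hq => rw [map_add, map_add, hp, hq]
  | mul_X p i hp =>
    rw [kappa_mul_X, ← hp, hZ, tildeOp_negElt, map_smul, smul_smul, mul_comm p]
    simp

theorem vermaAct_phi {r m : ℕ} {lam : ℂ} (Z : g r m) (f : Pol (m + 1)) :
    vermaAct Z (phi r m lam f) = phi r m lam (tildeOp lam Z f) := by
  apply (phi r m lam).symm.injective
  rw [LinearEquiv.symm_apply_apply, phi_symm_apply, theta_vermaAct, ← phi_symm_apply,
    LinearEquiv.symm_apply_apply]

theorem phi_mem_singular_iff {r m : ℕ} {lam : ℂ} (f : Pol (m + 1)) :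
    phi r m lam f ∈ singular r m lam ↔ f ∈ Sol r m lam := by
  rw [mem_Sol_iff_tildeOp]
  change (∀ Z : g r m, InNPlusPrime Z → vermaAct Z (phi r m lam f) = 0) ↔ _
  refine forall₂_congr fun Z _ => ?_
  rw [vermaAct_phi, LinearEquiv.map_eq_zero_iff]

theorem map_phi_Sol (r m : ℕ) (lam : ℂ) :
    (Sol r m lam).map (phi r m lam).toLinearMap = singular r m lam := by
  ext x
  obtain ⟨f, rfl⟩ := (phi r m lam).surjective x
  rw [phi_mem_singular_iff]
  constructor
  · rintro ⟨f', hf', h⟩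
    rwa [← (phi r m lam).injective h]
  · exact fun hf => ⟨f, hf, rfl⟩

/-! ### The action of `L'` -/

section LPrime

variable {r m : ℕ} {a : GL (Idx m) ℝ}

theorem InLPrime.entry_mul (ha : InLPrime r a) : a.1 e0 e0 * a.1 eInf eInf = 1 := by
  have h : (a.1ᵀ * gram ℝ r m * a.1) e0 eInf = gram ℝ r m e0 eInf := by rw [ha.mem_orthGroup]
  have h0 (i : Fin (m + 1)) : a.1 (mid i) e0 = 0 := ha.2.1 _ (by simp)
  have h0' : a.1 eInf e0 = 0 := ha.2.1 _ (by simp)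
  simpa [Matrix.mul_apply, Fintype.sum_sum_type, gram, h0, h0'] using h

theorem InLPrime.e0_mid (ha : InLPrime r a) (j : Fin (m + 1)) : a.1 e0 (mid j) = 0 := by
  have h : (a.1ᵀ * gram ℝ r m * a.1) (mid j) eInf = gram ℝ r m (mid j) eInf := by
    rw [ha.mem_orthGroup]
  have h0 (i : Fin (m + 1)) : a.1 (mid i) eInf = 0 := ha.2.2.1 _ (by simp)
  have h0' : a.1 e0 eInf = 0 := ha.2.2.1 _ (by simp)
  simp [Matrix.mul_apply, Fintype.sum_sum_type, gram, h0, h0'] at h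
  exact h.resolve_right fun h' => by simpa [h'] using ha.entry_mul

theorem InLPrime.eInf_mid (ha : InLPrime r a) (j : Fin (m + 1)) : a.1 eInf (mid j) = 0 := by
  have h : (a.1ᵀ * gram ℝ r m * a.1) (mid j) e0 = gram ℝ r m (mid j) e0 := by
    rw [ha.mem_orthGroup]
  have h0 (i : Fin (m + 1)) : a.1 (mid i) e0 = 0 := ha.2.1 _ (by simp)
  have h0' : a.1 eInf e0 = 0 := ha.2.1 _ (by simp)
  simp [Matrix.mul_apply, Fintype.sum_sum_type, gram, h0, h0'] at h
  exact h.resolve_right fun h' => by simpa [h'] using ha.entry_mul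

theorem InLPrime.mid_mid (ha : InLPrime r a) (i j : Fin (m + 1)) :
    ∑ k, eps ℝ r k * a.1 (mid k) (mid i) * a.1 (mid k) (mid j) =
      if i = j then eps ℝ r i else 0 := by
  have h : (a.1ᵀ * gram ℝ r m * a.1) (mid i) (mid j) = gram ℝ r m (mid i) (mid j) := by
    rw [ha.mem_orthGroup]
  simpa [Matrix.mul_apply, Fintype.sum_sum_type, gram, ha.e0_mid, ha.eInf_mid, mul_comm] using h

theorem InLPrime.inv (ha : InLPrime r a) : InLPrime r a⁻¹ := by
  have hu (y z : Idx m) : ∑ x, (a⁻¹).1 y x * a.1 x z = if y = z then 1 else 0 := by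
    have h : ((a⁻¹).1 * a.1) y z = (1 : Matrix (Idx m) (Idx m) ℝ) y z := by
      rw [← Units.val_mul, inv_mul_cancel]; rfl
    rwa [Matrix.mul_apply, Matrix.one_apply] at h
  have hcol (z : Idx m) (hz : ∀ x, x ≠ z → a.1 x z = 0) (y : Idx m) :
      (a⁻¹).1 y z * a.1 z z = if y = z then 1 else 0 := by
    rw [← hu]
    refine (Finset.sum_eq_single (f := fun x => (a⁻¹).1 y x * a.1 x z) z (fun x _ hx => ?_)
      (fun h => absurd (Finset.mem_univ z) h)).symm
    rw [hz x hx, mul_zero]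
  have hz (z : Idx m) (hz : ∀ x, x ≠ z → a.1 x z = 0) (y : Idx m) (hy : y ≠ z) :
      (a⁻¹).1 y z = 0 := by
    have h1 := hcol z hz y
    rw [if_neg hy] at h1
    refine (mul_eq_zero.1 h1).resolve_right fun h' => ?_
    have h2 := hcol z hz z
    simp [h'] at h2
  refine ⟨inv_mem ha.1, hz _ ha.2.1, hz _ ha.2.2.1, fun y => ?_⟩
  have h := hcol (mid (Fin.last m)) (fun x hx => by rw [ha.2.2.2, if_neg hx]) y
  rwa [ha.2.2.2, if_pos rfl, mul_one] at h

theorem Ad_negElt (ha : InLPrime r a) (j : Fin (m + 1)) :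
    Ad ha (negElt r j) =
      ∑ k, (((a.1 e0 e0)⁻¹ * a.1 (mid k) (mid j) : ℝ) : ℂ) • negElt r k := by
  have hne : a.1 e0 e0 ≠ 0 := fun h => by simpa [h] using ha.entry_mul
  have hinv : (cGL a).1 * (cGL a)⁻¹.1 = 1 := by rw [← Units.val_mul, mul_inv_cancel]; rfl
  apply Subtype.ext
  have hs : (∑ k, (((a.1 e0 e0)⁻¹ * a.1 (mid k) (mid j) : ℝ) : ℂ) • negElt r k : g r m).1 =
      ∑ k, (((a.1 e0 e0)⁻¹ * a.1 (mid k) (mid j) : ℝ) : ℂ) • negMat r k := by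
    simp [negElt]
  rw [hs]
  -- Multiplying through by a avoids its inverse. The bottom row is the only place where
  -- orthogonality of the middle block is used, along with a_{∞∞} = a_{00}⁻¹.
  have key : (cGL a).1 * negMat r j =
      (∑ k, (((a.1 e0 e0)⁻¹ * a.1 (mid k) (mid j) : ℝ) : ℂ) • negMat r k) * (cGL a).1 := by
    have hc (x y : Idx m) : (cGL a).1 x y = (a.1 x y : ℂ) := rfl
    have h1 (i : Fin (m + 1)) : a.1 (mid i) e0 = 0 := ha.2.1 _ (by simp)
    have h1' : a.1 eInf e0 = 0 := ha.2.1 _ (by simp)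
    have h2 (i : Fin (m + 1)) : a.1 (mid i) eInf = 0 := ha.2.2.1 _ (by simp)
    have h2' : a.1 e0 eInf = 0 := ha.2.2.1 _ (by simp)
    have heps (i : Fin (m + 1)) : ((eps ℝ r i : ℝ) : ℂ) = eps ℂ r i := by
      unfold eps; split_ifs <;> simp
    ext x y
    rcases x with _ | i | _ <;> rcases y with _ | k | _ <;>
      simp [Matrix.mul_apply, Matrix.sum_apply, Fintype.sum_sum_type, negMat, hc, h1, h1', h2, h2',
        ha.e0_mid, ha.eInf_mid]
    · have hne' : (a.1 e0 e0 : ℂ) ≠ 0 := Complex.ofReal_ne_zero.2 hne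
      change (a.1 (mid i) (mid j) : ℂ) =
        (a.1 e0 e0 : ℂ)⁻¹ * (a.1 (mid i) (mid j) : ℂ) * (a.1 e0 e0 : ℂ)
      rw [mul_right_comm, inv_mul_cancel₀ hne', one_mul]
    have H := congrArg (fun t : ℝ => (t : ℂ)) (ha.mid_mid k j)
    have hi : (a.1 eInf eInf : ℂ) = (a.1 e0 e0 : ℂ)⁻¹ := by
      rw [← Complex.ofReal_inv, eq_inv_of_mul_eq_one_right ha.entry_mul]
    simp only [Complex.ofReal_sum, Complex.ofReal_mul, heps] at H
    have hsum : ∑ x, (a.1 e0 e0 : ℂ)⁻¹ * (a.1 (mid x) (mid j) : ℂ) * eps ℂ r x *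
        (a.1 (mid x) (mid k) : ℂ) = (a.1 e0 e0 : ℂ)⁻¹ * ∑ x, eps ℂ r x *
          (a.1 (mid x) (mid k) : ℂ) * (a.1 (mid x) (mid j) : ℂ) := by
      rw [Finset.mul_sum]
      exact Finset.sum_congr rfl fun x _ => by ring
    refine Eq.trans ?_ (congrArg Neg.neg hsum.symm)
    rw [H]
    change (if k = j then -((a.1 eInf eInf : ℂ) * eps ℂ r j) else 0) = _
    rw [hi]
    rcases eq_or_ne k j with rfl | h
    · simp [heps]
    · simp [h]
  change (cGL a).1 * negMat r j * (cGL a)⁻¹.1 = _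
  rw [key, Matrix.mul_assoc, hinv, Matrix.mul_one]

theorem vermaLAct_smul {lam : ℂ} (ha : InLPrime r a) (u : U r m) (x : Verma r m lam) :
    vermaLAct ha (u • x) = AdU ha u • vermaLAct ha x := by
  obtain ⟨t, rfl⟩ := (vermaRel r m lam).mkQ_surjective x
  have h (t : U r m ⊗[ℂ] ℂ) : vermaLAct ha ((vermaRel r m lam).mkQ t) =
      (vermaRel r m lam).mkQ (preAct lam ha t) := rfl
  rw [← map_smul, h, h, preAct_smul, map_smul]

theorem vermaLAct_vermaAct {lam : ℂ} (ha : InLPrime r a) (Z : g r m) (x : Verma r m lam) :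
    vermaLAct ha (vermaAct Z x) = vermaAct (Ad ha Z) (vermaLAct ha x) := by
  rw [vermaAct, vermaLAct_smul]
  simp [AdU, vermaAct]

theorem polLAct_mul_X (lam : ℂ) (f : Pol (m + 1)) (j : Fin (m + 1)) :
    polLAct lam a (f * X j) = ∑ k, (((a.1 e0 e0)⁻¹ * a.1 (mid k) (mid j) : ℝ) : ℂ) •
      (X k * polLAct lam a f) := by
  simp only [polLAct, LinearMap.smul_apply, AlgHom.toLinearMap_apply, map_mul, aeval_X]
  rw [mul_comm, Finset.sum_mul, Finset.smul_sum]
  refine Finset.sum_congr rfl fun k _ => ?_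
  rw [smul_mul_assoc, mul_smul_comm, smul_comm]

theorem phi_polLAct {lam : ℂ} (ha : InLPrime r a) (f : Pol (m + 1)) :
    phi r m lam (polLAct lam a f) = vermaLAct ha (phi r m lam f) := by
  induction f using MvPolynomial.induction_on with
  | C c =>
    have h1 : polLAct lam a (C c) = (chi lam a * c) • (1 : Pol (m + 1)) := by
      simp [polLAct, smul_eq_C_mul, mul_smul]
    have h2 : (C c : Pol (m + 1)) = c • 1 := by rw [smul_eq_C_mul, mul_one]
    rw [h1, h2, map_smul, map_smul, phi_apply, kappa_one, map_smul, vermaLAct_mk, map_one,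
      vermaMk_eq lam 1 (chi lam a * 1), smul_smul, one_smul, mul_one, mul_comm]
  | add p q hp hq => simp only [map_add, hp, hq]
  | mul_X p i hp =>
    rw [polLAct_mul_X, phi_apply, phi_apply, kappa_mul_X, map_smul, vermaLAct_vermaAct, Ad_negElt,
      vermaAct_sum_smul, Finset.smul_sum, ← phi_apply, ← phi_apply, ← hp, map_sum]
    refine Finset.sum_congr rfl fun k _ => ?_
    rw [map_smul, vermaAct_phi, tildeOp_negElt, map_smul, smul_comm, smul_smul (-Complex.I)]
    simp

theorem InNPlusPrime.Ad (ha : InLPrime r a) {Z : g r m} (hZ : InNPlusPrime Z) :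
    InNPlusPrime (Ad ha Z) := by
  obtain ⟨⟨h1, h2, h3⟩, h4⟩ := hZ
  have hb := ha.inv
  have hc (x y : Idx m) : (cGL a).1 x y = (a.1 x y : ℂ) := rfl
  have hc' (x y : Idx m) : (cGL a)⁻¹.1 x y = ((a⁻¹).1 x y : ℂ) := by
    rw [show (cGL a)⁻¹ = cGL a⁻¹ from (map_inv _ _).symm]; rfl
  obtain ⟨h5, h6⟩ := Ad_e0 ha Z h1
  refine ⟨⟨h5, h6.trans h2, fun i j => ?_⟩, fun x => ?_⟩
  · change ((cGL a).1 * Z.1 * (cGL a)⁻¹.1) (mid i) (mid j) = 0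
    have h7 : a.1 (mid i) e0 = 0 := ha.2.1 _ (by simp)
    have h8 : a.1 (mid i) eInf = 0 := ha.2.2.1 _ (by simp)
    simp only [Matrix.mul_apply, Fintype.sum_sum_type, hc, hc']
    simp [hb.e0_mid, hb.eInf_mid, h7, h8, h3]
  · change ((cGL a).1 * Z.1 * (cGL a)⁻¹.1) x (mid (Fin.last m)) = 0
    rw [Matrix.mul_apply]
    refine Finset.sum_eq_zero fun y _ => ?_
    rw [hc', hb.2.2.2]
    split_ifs with hy
    · rw [hy, Matrix.mul_apply, Finset.sum_eq_zero fun z _ => by rw [h4, mul_zero], zero_mul]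
    · simp

theorem polLAct_mem_Sol {lam : ℂ} (ha : InLPrime r a) {f : Pol (m + 1)} (hf : f ∈ Sol r m lam) :
    polLAct lam a f ∈ Sol r m lam := by
  rw [← phi_mem_singular_iff] at hf ⊢
  intro Z hZ
  -- Since Ad(a⁻¹) preserves 𝔫₊', every Z in it is Ad(a) of another element of 𝔫₊', on which the
  -- singular vector is already known to vanish.
  have hZ' : FMethod.Ad ha (FMethod.Ad ha.inv Z) = Z := by
    have h : (cGL a).1 * (cGL a)⁻¹.1 = 1 := by rw [← Units.val_mul, mul_inv_cancel]; rfl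
    have h' : cGL a⁻¹ = (cGL a)⁻¹ := map_inv _ _
    apply Subtype.ext
    change (cGL a).1 * ((cGL a⁻¹).1 * Z.1 * (cGL a⁻¹)⁻¹.1) * (cGL a)⁻¹.1 = Z.1
    rw [h', inv_inv]
    simp only [Matrix.mul_assoc]
    rw [h, Matrix.mul_one, ← Matrix.mul_assoc, h, Matrix.one_mul]
  rw [phi_polLAct ha, ← hZ', ← vermaLAct_vermaAct, hf _ (hZ.Ad ha.inv), map_zero]

end LPrime


/-! ### Euler operator, Laplacian and Casimir operator -/

section Operators

variable {r n : ℕ}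

theorem coeff_euler (f : Pol n) (α : Fin n →₀ ℕ) :
    coeff α (euler n f) = (α.degree : ℂ) * coeff α f := by
  rw [euler_apply]
  induction f using MvPolynomial.induction_on' with
  | add p q hp hq =>
    simp only [map_add, mul_add, Finset.sum_add_distrib, coeff_add, hp, hq]
  | monomial β c =>
    simp only [X_mul_pderiv_monomial]
    rw [← Finset.sum_smul, coeff_smul, coeff_monomial, nsmul_eq_mul, Finsupp.degree_eq_sum]
    split_ifs with h
    · rw [h]
    · simp

theorem mem_homogeneousSubmodule_iff_euler (f : Pol n) (k : ℕ) :
    f ∈ homogeneousSubmodule (Fin n) ℂ k ↔ euler n f = (k : ℂ) • f := by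
  rw [mem_homogeneousSubmodule]
  constructor
  · intro h
    ext α
    rw [coeff_euler, coeff_smul, smul_eq_mul]
    by_cases hα : coeff α f = 0
    · simp [hα]
    · have h1 : α.degree = k := by
        rw [Finsupp.degree_eq_weight_one]; exact h hα
      rw [h1]
  · intro h α hα
    have h1 := congrArg (coeff α) h
    rw [coeff_euler, coeff_smul, smul_eq_mul] at h1
    have := mul_right_cancel₀ hα h1
    have h2 : α.degree = k := by exact_mod_cast this
    rw [Finsupp.degree_eq_weight_one] at h2
    exact h2

theorem eq_zero_of_euler {f : Pol n} {c : ℂ} (hc : ∀ k : ℕ, c ≠ k) (h : euler n f = c • f) :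
    f = 0 := by
  ext α
  have h1 := congrArg (coeff α) h
  rw [coeff_euler, coeff_smul, smul_eq_mul] at h1
  by_contra h2
  exact hc _ (mul_right_cancel₀ h2 h1).symm

theorem euler_mul (f h : Pol n) : euler n (f * h) = f * euler n h + h * euler n f := by
  simp only [euler_apply, Derivation.leibniz, smul_eq_mul, mul_add, Finset.sum_add_distrib,
    Finset.mul_sum]
  congr 1 <;> exact Finset.sum_congr rfl fun i _ => by ring

theorem euler_pderiv (i : Fin n) (f : Pol n) :
    euler n (pderiv i f) = pderiv i (euler n f) - pderiv i f := by
  have : pderiv i (euler n f) = ∑ k, (X k * pderiv k (pderiv i f) +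
      if k = i then pderiv i f else 0) := by
    rw [euler_apply, map_sum]
    refine Finset.sum_congr rfl fun k _ => ?_
    rw [Derivation.leibniz, pderiv_comm i k]
    rcases eq_or_ne k i with rfl | h
    · simp
    · simp [pderiv_X_of_ne h, h]
  rw [this, euler_apply, Finset.sum_add_distrib]
  simp

theorem euler_box (f : Pol n) :
    euler n (box r n f) = box r n (euler n f) - (2 : ℂ) • box r n f := by
  simp only [box_apply, map_sum, map_smul, euler_pderiv, map_sub, Finset.smul_sum,
    ← Finset.sum_sub_distrib]
  exact Finset.sum_congr rfl fun i _ => by module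

theorem euler_pderiv_of {f : Pol n} {c : ℂ} (h : euler n f = c • f) (i : Fin n) :
    euler n (pderiv i f) = (c - 1) • pderiv i f := by
  rw [euler_pderiv, h, Derivation.map_smul, sub_smul, one_smul]

theorem euler_box_of {f : Pol n} {c : ℂ} (h : euler n f = c • f) :
    euler n (box r n f) = (c - 2) • box r n f := by
  rw [euler_box, h, map_smul, sub_smul]

theorem pderiv_quad (i : Fin n) : pderiv i (quad r n) = (2 * eps ℂ r i) • X i := by
  rw [quad, map_sum, Finset.sum_eq_single i]
  · rw [Derivation.map_smul, pderiv_pow, pderiv_X_self, mul_comm, ← smul_smul, smul_comm]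
    simp only [smul_eq_C_mul, map_ofNat]
    norm_num
  · intro k _ hk
    rw [Derivation.map_smul, pderiv_pow, pderiv_X_of_ne hk]
    simp
  · simp

theorem pderiv_quad_mul (i : Fin n) (f : Pol n) :
    pderiv i (quad r n * f) = (2 * eps ℂ r i) • (X i * f) + quad r n * pderiv i f := by
  rw [Derivation.leibniz, pderiv_quad, smul_eq_mul, smul_eq_mul, mul_smul_comm, mul_comm f,
    add_comm]

theorem quad_eq_sum_mul : quad r n = ∑ i, eps ℂ r i • (X i * X i) := by
  simp only [quad, sq]

theorem euler_quad : euler n (quad r n) = (2 : ℂ) • quad r n := by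
  rw [euler_apply]
  simp only [pderiv_quad]
  rw [quad_eq_sum_mul, Finset.smul_sum]
  exact Finset.sum_congr rfl fun i _ => by rw [mul_smul_comm, mul_smul]

theorem euler_quad_pow_mul {f : Pol n} {c : ℂ} (h : euler n f = c • f) (s : ℕ) :
    euler n (quad r n ^ s * f) = (c + 2 * s) • (quad r n ^ s * f) := by
  induction s with
  | zero => simp [h]
  | succ s ih =>
    rw [pow_succ', mul_assoc, euler_mul, ih, euler_quad]
    simp only [smul_eq_C_mul, map_add, map_mul, Nat.cast_succ]
    simp only [map_ofNat, map_one]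
    ring

theorem box_quad_mul (f : Pol n) :
    box r n (quad r n * f) =
      quad r n * box r n f + (4 : ℂ) • euler n f + (2 * n : ℂ) • f := by
  have h (i : Fin n) : eps ℂ r i • pderiv i (pderiv i (quad r n * f)) =
      quad r n * (eps ℂ r i • pderiv i (pderiv i f)) + (4 : ℂ) • (X i * pderiv i f) +
        (2 : ℂ) • f := by
    have e : (C (eps ℂ r i) : Pol n) * C (eps ℂ r i) = 1 := by
      rw [← C_mul, eps_mul_self, C_1]
    rw [pderiv_quad_mul, map_add, Derivation.map_smul, Derivation.leibniz, pderiv_quad_mul,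
      pderiv_X_self]
    simp only [smul_eq_C_mul, smul_eq_mul, map_mul, map_ofNat]
    linear_combination (4 * X i * pderiv i f + 2 * f) * e
  simp only [box_apply, h, Finset.sum_add_distrib, euler_apply, Finset.mul_sum, Finset.smul_sum]
  congr 1
  rw [Finset.sum_const, Finset.card_univ, Fintype.card_fin, ← Nat.cast_smul_eq_nsmul ℂ, smul_smul,
    mul_comm]

theorem quad_ne_zero (hn : 0 < n) : quad r n ≠ 0 := by
  intro h
  have h1 := pderiv_quad (r := r) (⟨0, hn⟩ : Fin n)
  have e := eps_mul_self r (⟨0, hn⟩ : Fin n)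
  rw [h, map_zero] at h1
  rcases smul_eq_zero.1 h1.symm with h2 | h2
  · have : eps ℂ r (⟨0, hn⟩ : Fin n) = 0 := by simpa using h2
    simp [this] at e
  · exact X_ne_zero _ h2

theorem mem_harm_iff {f : Pol n} {k : ℕ} :
    f ∈ harm r n k ↔ euler n f = (k : ℂ) • f ∧ box r n f = 0 := by
  rw [harm, Submodule.mem_inf, mem_homogeneousSubmodule_iff_euler, LinearMap.mem_ker]

/-- The 𝔰𝔩₂-relation [□, Q] = 4E + 2n summed over the s + 1 factors Q. The constant is nonzero in
the range needed later, so □ can be inverted on such products. -/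
theorem box_quad_pow_succ_mul {f : Pol n} {c : ℂ} (h : euler n f = c • f) (hb : box r n f = 0)
    (s : ℕ) : box r n (quad r n ^ (s + 1) * f) =
      (2 * (s + 1) * (2 * s + 2 * c + n)) • (quad r n ^ s * f) := by
  induction s with
  | zero =>
    rw [zero_add, pow_one, box_quad_mul, hb, h, pow_zero, one_mul, mul_zero, zero_add, smul_smul,
      ← add_smul]
    congr 1
    push_cast
    ring
  | succ s ih =>
    rw [pow_succ', mul_assoc, box_quad_mul, ih, euler_quad_pow_mul h, mul_smul_comm, ← mul_assoc,
      ← pow_succ', smul_smul, ← add_smul, ← add_smul]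
    congr 1
    push_cast
    ring

/-- The Casimir operator of `𝔰𝔬(r, n - r)`, up to sign. -/
noncomputable def casimir (r n : ℕ) : Pol n →ₗ[ℂ] Pol n :=
  LinearMap.mulLeft ℂ (quad r n) ∘ₗ box r n - euler n ∘ₗ euler n - ((n : ℂ) - 2) • euler n

theorem casimir_apply (f : Pol n) : casimir r n f =
    quad r n * box r n f - euler n (euler n f) - ((n : ℂ) - 2) • euler n f := by
  simp [casimir]

/-- Q is invariant under rotations. In this form the commutators of Q with Q□ and with E² + (n-2)E
cancel. -/
theorem casimir_quad_mul (f : Pol n) : casimir r n (quad r n * f) = quad r n * casimir r n f := by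
  simp only [casimir_apply, box_quad_mul, euler_mul, euler_quad, map_add, map_smul, mul_sub, mul_add]
  simp only [smul_eq_C_mul, map_sub, map_mul, map_ofNat, map_natCast]
  ring

theorem casimir_of_mem_harm {f : Pol n} {j : ℕ} (hf : f ∈ harm r n j) :
    casimir r n f = (-(j * (j + n - 2) : ℂ)) • f := by
  obtain ⟨h1, h2⟩ := mem_harm_iff.1 hf
  rw [casimir_apply, h2, h1, map_smul, h1, mul_zero]
  module

/-- A gradient proportional to that of Q means that f is killed by infinitesimal rotations.
Concretely Ef = Qh and □f = nh + Eh, and substitution gives zero. -/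
theorem casimir_of_gradient {f h : Pol n} (hf : ∀ i, pderiv i f = eps ℂ r i • (X i * h)) :
    casimir r n f = 0 := by
  have e (i : Fin n) := eps_mul_self r i
  have h1 : euler n f = quad r n * h := by
    rw [euler_apply, quad_eq_sum_mul, Finset.sum_mul]
    refine Finset.sum_congr rfl fun i _ => ?_
    rw [hf, mul_smul_comm, smul_mul_assoc, mul_assoc]
  have h2 : box r n f = (n : ℂ) • h + euler n h := by
    rw [box_apply, euler_apply]
    have (i : Fin n) : eps ℂ r i • pderiv i (pderiv i f) = h + X i * pderiv i h := by
      rw [hf, Derivation.map_smul, smul_smul, e, one_smul, Derivation.leibniz, pderiv_X_self,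
        smul_eq_mul, smul_eq_mul, mul_one, add_comm]
    simp only [this, Finset.sum_add_distrib, Finset.sum_const, Finset.card_univ, Fintype.card_fin,
      ← Nat.cast_smul_eq_nsmul ℂ]
  rw [casimir_apply, h1, h2, euler_mul, euler_quad]
  simp only [smul_eq_C_mul, map_sub, map_ofNat, map_natCast]
  ring

/-- In degree d the eigenvalue equation reads Q□f = (d-j)(d+j+n-2) f. If d ≠ j the constant is
nonzero for n ≥ 2, so f is Q times a polynomial of degree d - 2 with the same eigenvalue. The
descent ends at d = j, where f is harmonic, or at a negative degree, where f = 0. -/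
theorem eq_quad_pow_mul_of_casimir (hn : 2 ≤ n) (j d : ℕ) {f : Pol n}
    (h1 : euler n f = (d : ℂ) • f) (h2 : casimir r n f = (-(j * (j + n - 2) : ℂ)) • f) :
    f = 0 ∨ ∃ s, ∃ h ∈ harm r n j, d = j + 2 * s ∧ f = quad r n ^ s * h := by
  induction d using Nat.strong_induction_on generalizing f with
  | _ d ih =>
    have h3 : quad r n * box r n f = ((d - j) * (d + j + n - 2) : ℂ) • f := by
      rw [casimir_apply, h1, map_smul, h1] at h2
      rw [← sub_eq_zero] at h2 ⊢
      rw [← h2]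
      module
    rcases eq_or_ne d j with rfl | hdj
    · refine Or.inr ⟨0, f, mem_harm_iff.2 ⟨h1, ?_⟩, by simp, by simp⟩
      rw [sub_self, zero_mul, zero_smul] at h3
      exact (mul_eq_zero.1 h3).resolve_left (quad_ne_zero (by omega))
    · have hc : ((d - j) * (d + j + n - 2) : ℂ) ≠ 0 := by
        refine mul_ne_zero (sub_ne_zero.2 (by exact_mod_cast hdj)) ?_
        obtain ⟨k, rfl⟩ : ∃ k, n = k + 2 := ⟨n - 2, by omega⟩
        have : (d + j + ((k + 2 : ℕ) : ℂ) - 2) = ((d + j + k : ℕ) : ℂ) := by push_cast; ring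
        rw [this]
        exact_mod_cast (by omega : d + j + k ≠ 0)
      set c : ℂ := (d - j) * (d + j + n - 2) with hcdef
      set h := c⁻¹ • box r n f with hh
      have h4 : f = quad r n * h := by
        rw [hh, mul_smul_comm, h3, smul_smul, inv_mul_cancel₀ hc, one_smul]
      have h5 : euler n h = ((d : ℂ) - 2) • h := by
        rw [hh, map_smul, euler_box_of h1, smul_comm]
      have h6 : casimir r n h = (-(j * (j + n - 2) : ℂ)) • h := by
        refine mul_left_cancel₀ (quad_ne_zero (r := r) (n := n) (by omega)) ?_
        rw [← casimir_quad_mul, ← h4, h2, mul_smul_comm, ← h4]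
      by_cases hd : d < 2
      · left
        have : h = 0 := by
          refine eq_zero_of_euler (fun k hk => ?_) h5
          have : (d : ℂ) = ((k + 2 : ℕ) : ℂ) := by push_cast; linear_combination hk
          have : d = k + 2 := by exact_mod_cast this
          omega
        rw [h4, this, mul_zero]
      · have h7 : euler n h = ((d - 2 : ℕ) : ℂ) • h := by
          rw [h5, Nat.cast_sub (by omega)]; simp
        rcases ih (d - 2) (by omega) h7 h6 with h8 | ⟨s, k, hk, hs, h8⟩
        · left; rw [h4, h8, mul_zero]
        · exact Or.inr ⟨s + 1, k, hk, by omega, by rw [h4, h8, pow_succ', mul_assoc]⟩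

/-- Fischer decomposition. The decomposition of □f is lifted through □ term by term to a polynomial
F without a harmonic term; then f - F is harmonic. -/
theorem exists_harmonic_decomposition (hn : 2 ≤ n) (d : ℕ) {f : Pol n}
    (h : euler n f = (d : ℂ) • f) :
    ∃ u : ℕ → Pol n, (∀ s, 2 * s ≤ d → u s ∈ harm r n (d - 2 * s)) ∧
      f = ∑ s ∈ Finset.range (d / 2 + 1), quad r n ^ s * u s := by
  induction d using Nat.strong_induction_on generalizing f with
  | _ d ih =>
    have hb := euler_box_of (r := r) h
    by_cases hd : d < 2
    · have hz : box r n f = 0 := by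
        refine eq_zero_of_euler (fun k hk => ?_) hb
        have : (d : ℂ) = ((k + 2 : ℕ) : ℂ) := by push_cast; linear_combination hk
        have : d = k + 2 := by exact_mod_cast this
        omega
      refine ⟨fun _ => f, fun s hs => ?_, ?_⟩
      · have : s = 0 := by omega
        subst this
        exact mem_harm_iff.2 ⟨h, hz⟩
      · have : d / 2 = 0 := by omega
        simp [this]
    · obtain ⟨e, rfl⟩ : ∃ e, d = e + 2 := ⟨d - 2, by omega⟩
      obtain ⟨u, hu, hf⟩ := ih e (by omega) (f := box r n f) (by rw [hb]; push_cast; congr 1; ring)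
      -- These are the constants of `box_quad_pow_succ_mul` for a harmonic polynomial of degree e -
      -- 2s in n variables.
      let c : ℕ → ℂ := fun s => 2 * (s + 1) * (2 * s + 2 * ((e - 2 * s : ℕ) : ℂ) + n)
      have hc (s : ℕ) : c s ≠ 0 := by
        have : c s = ((2 * (s + 1) * (2 * s + 2 * (e - 2 * s) + n) : ℕ) : ℂ) := by
          simp only [c]; push_cast; ring
        rw [this, Nat.cast_ne_zero]
        have h1 : 2 * s + 2 * (e - 2 * s) + n ≠ 0 := by omega
        positivity
      set F := ∑ s ∈ Finset.range (e / 2 + 1), quad r n ^ (s + 1) * ((c s)⁻¹ • u s) with hF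
      have hle {s : ℕ} (hs : s ∈ Finset.range (e / 2 + 1)) : 2 * s ≤ e := by
        have := Finset.mem_range.1 hs; omega
      have hF1 : euler n F = ((e + 2 : ℕ) : ℂ) • F := by
        rw [hF, map_sum, Finset.smul_sum]
        refine Finset.sum_congr rfl fun s hs => ?_
        have h1 := (mem_harm_iff.1 (hu s (hle hs))).1
        rw [mul_smul_comm, map_smul, euler_quad_pow_mul h1, smul_comm]
        congr 2
        rw [Nat.cast_sub (hle hs)]
        push_cast
        ring
      have hF2 : box r n F = box r n f := by
        conv_rhs => rw [hf]
        rw [hF, map_sum]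
        refine Finset.sum_congr rfl fun s hs => ?_
        obtain ⟨h1, h2⟩ := mem_harm_iff.1 (hu s (hle hs))
        rw [mul_smul_comm, map_smul, box_quad_pow_succ_mul h1 h2, smul_smul]
        change ((c s)⁻¹ * c s) • _ = _
        rw [inv_mul_cancel₀ (hc s), one_smul]
      -- The harmonic remainder takes index 0, and the lifted terms are shifted by one power of Q.
      refine ⟨fun s => Nat.casesOn s (f - F) fun s => (c s)⁻¹ • u s, fun s hs => ?_, ?_⟩
      · rcases s with _ | s
        · refine mem_harm_iff.2 ⟨?_, ?_⟩
          · change euler n (f - F) = _ • (f - F)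
            rw [map_sub, h, hF1, ← smul_sub]
            simp
          · change box r n (f - F) = 0
            rw [map_sub, hF2, sub_self]
        · have h1 := hu s (by omega)
          rw [show e + 2 - 2 * (s + 1) = e - 2 * s by omega]
          exact Submodule.smul_mem _ _ h1
      · rw [show (e + 2) / 2 + 1 = (e / 2 + 1) + 1 by omega, Finset.sum_range_succ']
        change f = F + quad r n ^ 0 * (f - F)
        rw [pow_zero, one_mul, add_sub_cancel]

end Operators


/-! ### Expansion in powers of the last variable -/

/-- Polynomials in `ξ₁, …, ξ_{m+1}` as polynomials in `ξ_{m+1}`. -/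
noncomputable def lastEquiv (m : ℕ) : Pol (m + 1) ≃ₐ[ℂ] Polynomial (Pol m) :=
  (renameEquiv ℂ finSuccEquivLast).trans (optionEquivLeft ℂ (Fin m))

/-- The coefficient of the `a`-th power of the last variable. -/
noncomputable def cmp {m : ℕ} (a : ℕ) : Pol (m + 1) →ₗ[ℂ] Pol m :=
  (Polynomial.lcoeff (Pol m) a).restrictScalars ℂ ∘ₗ (lastEquiv m).toLinearMap

/-- The inclusion of `Pol[ξ₁, …, ξ_m]` into `Pol[ξ₁, …, ξ_{m+1}]`. -/
noncomputable def emb (m : ℕ) : Pol m →ₐ[ℂ] Pol (m + 1) := rename Fin.castSucc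

section Components

variable {r m : ℕ}

theorem cmp_apply (a : ℕ) (f : Pol (m + 1)) : cmp a f = (lastEquiv m f).coeff a := rfl

theorem lastEquiv_last : lastEquiv m (X (Fin.last m)) = Polynomial.X := by
  simp [lastEquiv]

theorem lastEquiv_castSucc (i : Fin m) : lastEquiv m (X i.castSucc) = Polynomial.C (X i) := by
  simp [lastEquiv]

theorem lastEquiv_emb (f : Pol m) : lastEquiv m (emb m f) = Polynomial.C f := by
  induction f using MvPolynomial.induction_on with
  | C a => simp [emb, lastEquiv]
  | add p q hp hq => simp [hp, hq]
  | mul_X p i hp =>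
    have : emb m (X i) = X i.castSucc := rename_X _ _
    rw [map_mul, map_mul, hp, this, lastEquiv_castSucc, map_mul]

theorem ext_cmp {f h : Pol (m + 1)} (H : ∀ a, cmp a f = cmp a h) : f = h :=
  (lastEquiv m).injective (Polynomial.ext H)

theorem cmp_emb_mul (a : ℕ) (h : Pol m) (f : Pol (m + 1)) :
    cmp a (emb m h * f) = h * cmp a f := by
  rw [cmp_apply, map_mul, lastEquiv_emb, Polynomial.coeff_C_mul, cmp_apply]

theorem cmp_X_castSucc_mul (a : ℕ) (i : Fin m) (f : Pol (m + 1)) :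
    cmp a (X i.castSucc * f) = X i * cmp a f := by
  rw [cmp_apply, map_mul, lastEquiv_castSucc, Polynomial.coeff_C_mul, cmp_apply]

theorem cmp_emb_mul_last_pow (a b : ℕ) (h : Pol m) :
    cmp a (emb m h * X (Fin.last m) ^ b) = if a = b then h else 0 := by
  rw [cmp_emb_mul, cmp_apply, map_pow, lastEquiv_last, Polynomial.coeff_X_pow]
  split_ifs <;> simp

theorem cmp_last_mul (a : ℕ) (f : Pol (m + 1)) :
    cmp a (X (Fin.last m) * f) = if a = 0 then 0 else cmp (a - 1) f := by
  rw [cmp_apply, map_mul, lastEquiv_last]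
  rcases a with _ | a
  · simp
  · simp [cmp_apply]

theorem lastEquiv_pderiv_last (f : Pol (m + 1)) :
    lastEquiv m (pderiv (Fin.last m) f) = Polynomial.derivative (lastEquiv m f) := by
  induction f using MvPolynomial.induction_on with
  | C a => simp [lastEquiv]
  | add p q hp hq => simp [hp, hq]
  | mul_X p i hp =>
    rw [Derivation.leibniz, map_add, smul_eq_mul, smul_eq_mul, map_mul, map_mul, hp, map_mul,
      Polynomial.derivative_mul]
    induction i using Fin.lastCases with
    | last => rw [lastEquiv_last]; simp; ring
    | cast i =>
      rw [lastEquiv_castSucc, pderiv_X_of_ne (Fin.castSucc_lt_last i).ne]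
      simp [mul_comm]

theorem cmp_pderiv_last (a : ℕ) (f : Pol (m + 1)) :
    cmp a (pderiv (Fin.last m) f) = ((a : ℂ) + 1) • cmp (a + 1) f := by
  rw [cmp_apply, lastEquiv_pderiv_last, Polynomial.coeff_derivative, cmp_apply, smul_eq_C_mul,
    mul_comm]
  simp

theorem cmp_pderiv_castSucc (a : ℕ) (i : Fin m) (f : Pol (m + 1)) :
    cmp a (pderiv i.castSucc f) = pderiv i (cmp a f) := by
  induction f using MvPolynomial.induction_on generalizing a with
  | C c =>
    have : (C c : Pol (m + 1)) = emb m (C c) * X (Fin.last m) ^ 0 := by simp [emb]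
    rw [pderiv_C, map_zero, this, cmp_emb_mul_last_pow]
    split_ifs <;> simp
  | add p q hp hq => simp [hp, hq]
  | mul_X p k hp =>
    rw [mul_comm p, Derivation.leibniz, map_add, smul_eq_mul, smul_eq_mul]
    induction k using Fin.lastCases with
    | last =>
      rw [pderiv_X_of_ne (Fin.castSucc_lt_last i).ne', mul_zero, map_zero, add_zero, cmp_last_mul,
        cmp_last_mul]
      split_ifs
      · simp
      · rw [hp]
    | cast k =>
      rw [cmp_X_castSucc_mul, cmp_X_castSucc_mul, hp, Derivation.leibniz]
      congr 1
      rcases eq_or_ne k i with rfl | h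
      · simp
      · rw [pderiv_X_of_ne h, pderiv_X_of_ne (fun h' => h (Fin.castSucc_injective m h'))]
        simp

theorem cmp_box (a : ℕ) (f : Pol (m + 1)) : cmp a (box r (m + 1) f) =
    box r m (cmp a f) + (eps ℂ r (Fin.last m) * ((a + 1) * (a + 2))) • cmp (a + 2) f := by
  rw [box_apply, Fin.sum_univ_castSucc, map_add, map_sum, box_apply]
  simp only [map_smul, cmp_pderiv_castSucc, cmp_pderiv_last, smul_smul]
  congr 2
  push_cast
  ring

theorem cmp_euler (a : ℕ) (f : Pol (m + 1)) :
    cmp a (euler (m + 1) f) = euler m (cmp a f) + (a : ℂ) • cmp a f := by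
  rw [euler_apply, Fin.sum_univ_castSucc, map_add, map_sum, euler_apply]
  simp only [cmp_X_castSucc_mul, cmp_pderiv_castSucc, cmp_last_mul, cmp_pderiv_last]
  congr 1
  rcases a with _ | a
  · simp
  · simp

theorem euler_cmp_of {f : Pol (m + 1)} {c : ℂ} (h : euler (m + 1) f = c • f) (a : ℕ) :
    euler m (cmp a f) = (c - a) • cmp a f := by
  have := cmp_euler a f
  rw [h, map_smul] at this
  rw [sub_smul, this, add_sub_cancel_right]

/-- On degree c the Euler operator becomes a scalar. The first-order coefficient λ - c + 1 vanishes
precisely in degree λ + 1, the source of the exceptional solutions. -/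
theorem P_of_euler {f : Pol (m + 1)} {c lam : ℂ} (h : euler (m + 1) f = c • f)
    (j : Fin (m + 1)) : P r (m + 1) lam j f = -Complex.I • ((eps ℂ r j / 2) •
      (X j * box r (m + 1) f) + (lam - c + 1) • pderiv j f) := by
  rw [P_apply, euler_pderiv_of h]
  module

theorem P_castSucc_eq_zero_iff {f : Pol (m + 1)} {c lam : ℂ} (h : euler (m + 1) f = c • f)
    (j : Fin m) : P r (m + 1) lam j.castSucc f = 0 ↔ ∀ a, (eps ℂ r j / 2) •
      (X j * (box r m (cmp a f) + (eps ℂ r (Fin.last m) * ((a + 1) * (a + 2))) • cmp (a + 2) f)) +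
        (lam - c + 1) • pderiv j (cmp a f) = 0 := by
  rw [P_of_euler h, smul_eq_zero_iff_right (neg_ne_zero.2 Complex.I_ne_zero)]
  have he : eps ℂ r j.castSucc = eps ℂ r j := rfl
  constructor
  · intro H a
    have := congrArg (cmp a) H
    rwa [map_add, map_smul, map_smul, cmp_X_castSucc_mul, cmp_box, cmp_pderiv_castSucc,
      map_zero, he] at this
  · intro H
    refine ext_cmp fun a => ?_
    rw [map_add, map_smul, map_smul, cmp_X_castSucc_mul, cmp_box, cmp_pderiv_castSucc,
      map_zero, he, H]

end Components

/-! ### The vectors `w_{K,λ}` -/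

section W

variable {r m : ℕ} {lam : ℂ} {K : ℕ}

/-- The coefficient of `(∑_{i<n} εᵢ ξᵢ²)^k ξ_n^{K-2k}` in `w_{K,λ}`. -/
noncomputable def wCoeff (r m : ℕ) (lam : ℂ) (K k : ℕ) : ℂ :=
  wNorm K * ((-1) ^ k * poch (-lam - (m : ℂ) / 2 + ((K + 1) / 2 : ℕ)) (K - k - (K + 1) / 2) /
    (k.factorial * (K - 2 * k).factorial) * 2 ^ (K - 2 * k)) * (-eps ℂ r (Fin.last m)) ^ k

theorem coeff_gegenbauerRen (α : ℂ) (l k : ℕ) (hk : k < l / 2 + 1) :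
    (gegenbauerRen α l).coeff (l - 2 * k) = (-1) ^ k *
      poch (α + ((l + 1) / 2 : ℕ)) (l - k - (l + 1) / 2) /
        (k.factorial * (l - 2 * k).factorial) * 2 ^ (l - 2 * k) := by
  rw [gegenbauerRen, Polynomial.finsetSum_coeff, Finset.sum_eq_single k]
  · rw [Polynomial.coeff_C_mul, mul_pow, ← Polynomial.C_ofNat, ← Polynomial.C_pow,
      Polynomial.coeff_C_mul, Polynomial.coeff_X_pow_self, mul_one]
  · intro b hb hbk
    have := Finset.mem_range.1 hb
    rw [Polynomial.coeff_C_mul, mul_pow, ← Polynomial.C_ofNat, ← Polynomial.C_pow,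
      Polynomial.coeff_C_mul, Polynomial.coeff_X_pow, if_neg (by omega), mul_zero, mul_zero]
  · intro h
    exact absurd (Finset.mem_range.2 hk) h

theorem w_eq : w r m lam K = ∑ k ∈ Finset.range (K / 2 + 1),
    wCoeff r m lam K k • (emb m (quad r m ^ k) * X (Fin.last m) ^ (K - 2 * k)) := by
  have hq : emb m (quad r m) = ∑ i : Fin m,
      eps ℂ r (Fin.castSucc i) • (X (Fin.castSucc i) : Pol (m + 1)) ^ 2 := by
    rw [quad, map_sum]
    refine Finset.sum_congr rfl fun i _ => ?_
    rw [map_smul, map_pow]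
    congr 2
    exact rename_X _ _
  rw [w, ← hq, Finset.smul_sum]
  refine Finset.sum_congr rfl fun k hk => ?_
  rw [coeff_gegenbauerRen _ _ _ (Finset.mem_range.1 hk), smul_pow, map_pow, smul_mul_assoc,
    smul_smul, smul_smul, wCoeff, mul_assoc]

theorem cmp_w (a : ℕ) : cmp a (w r m lam K) = ∑ k ∈ Finset.range (K / 2 + 1),
    if a = K - 2 * k then wCoeff r m lam K k • quad r m ^ k else 0 := by
  rw [w_eq, map_sum]
  refine Finset.sum_congr rfl fun k _ => ?_
  rw [map_smul, cmp_emb_mul_last_pow, smul_ite, smul_zero]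

theorem cmp_w_of_le {k : ℕ} (hk : 2 * k ≤ K) :
    cmp (K - 2 * k) (w r m lam K) = wCoeff r m lam K k • quad r m ^ k := by
  rw [cmp_w, Finset.sum_eq_single k]
  · rw [if_pos rfl]
  · intro b hb hbk
    have := Finset.mem_range.1 hb
    rw [if_neg (by omega)]
  · intro h
    exact absurd (Finset.mem_range.2 (by omega)) h

theorem cmp_w_of_ne {a : ℕ} (h : ∀ k, 2 * k ≤ K → a ≠ K - 2 * k) :
    cmp a (w r m lam K) = 0 := by
  rw [cmp_w]
  refine Finset.sum_eq_zero fun k hk => ?_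
  have := Finset.mem_range.1 hk
  rw [if_neg (h k (by omega))]

/-- At k = [K/2] the renormalized Pochhammer product is empty, so this coefficient never vanishes,
whatever λ is. This is the purpose of dividing out (α)_{[(K+1)/2]}. -/
theorem wCoeff_ne_zero (r m : ℕ) (lam : ℂ) (K : ℕ) : wCoeff r m lam K (K / 2) ≠ 0 := by
  have h1 : K - K / 2 - (K + 1) / 2 = 0 := by omega
  have h2 : eps ℂ r (Fin.last m) ≠ 0 := by
    intro h
    have := eps_mul_self r (Fin.last m)
    simp [h] at this
  have h3 : wNorm K ≠ 0 := by
    unfold wNorm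
    split_ifs <;> simp [Nat.factorial_ne_zero]
  rw [wCoeff, h1]
  simp [poch, h2, h3, Nat.factorial_ne_zero]

theorem wCoeff_succ {k : ℕ} (hk : 2 * (k + 1) ≤ K) :
    (2 * (k + 1) * (2 * (k + 1) + m + 2 * lam - 2 * K)) * wCoeff r m lam K (k + 1) =
      -(eps ℂ r (Fin.last m) * ((K - 2 * k - 1) * (K - 2 * k)) * wCoeff r m lam K k) := by
  obtain ⟨u, hu⟩ : ∃ u, K = 2 * (k + 1) + u := ⟨K - 2 * (k + 1), by omega⟩
  set t := K - (k + 1) - (K + 1) / 2 with ht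
  have h1 : K - k - (K + 1) / 2 = t + 1 := by omega
  have h2 : K - 2 * (k + 1) = u := by omega
  have h3 : K - 2 * k = u + 2 := by omega
  -- The one Pochhammer factor by which consecutive coefficients differ is α + K - k - 1; the parity
  -- of K drops out here.
  have h4 : (((K + 1) / 2 : ℕ) : ℂ) + t = K - k - 1 := by
    have : (K + 1) / 2 + t + k + 1 = K := by omega
    have := congrArg (Nat.cast : ℕ → ℂ) this
    push_cast at this
    linear_combination this
  have h5 : (K : ℂ) = 2 * (k + 1) + u := by rw [hu]; push_cast; ring
  rw [wCoeff, wCoeff, ← ht, h1, h2, h3]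
  have h6 (x : ℂ) : poch x (t + 1) = poch x t * (x + t) := Finset.prod_range_succ _ _
  rw [h6, add_assoc (-lam - (m : ℂ) / 2) (((K + 1) / 2 : ℕ) : ℂ) (t : ℂ), h4, Nat.factorial_succ (u + 1), Nat.factorial_succ u, Nat.factorial_succ k]
  have f1 : (k.factorial : ℂ) ≠ 0 := by exact_mod_cast Nat.factorial_ne_zero k
  have f2 : (u.factorial : ℂ) ≠ 0 := by exact_mod_cast Nat.factorial_ne_zero u
  have f3 : (k : ℂ) + 1 ≠ 0 := by exact_mod_cast Nat.succ_ne_zero k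
  have f4 : (u : ℂ) + 1 ≠ 0 := by exact_mod_cast Nat.succ_ne_zero u
  have f5 : (u : ℂ) + 1 + 1 ≠ 0 := by exact_mod_cast Nat.succ_ne_zero (u + 1)
  push_cast
  generalize poch _ t = p
  rw [h5]
  field_simp
  ring

theorem w_ne_zero (r : ℕ) {m : ℕ} (hm : 0 < m) (lam : ℂ) (K : ℕ) : w r m lam K ≠ 0 := by
  intro h
  have h1 := cmp_w_of_le (r := r) (m := m) (lam := lam) (K := K) (k := K / 2) (by omega)
  rw [h, map_zero] at h1
  exact smul_ne_zero (wCoeff_ne_zero r m lam K) (pow_ne_zero _ (quad_ne_zero hm)) h1.symm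

theorem euler_one_smul (n : ℕ) : euler n (1 : Pol n) = (0 : ℂ) • (1 : Pol n) := by
  simp [euler_apply]

theorem box_one (r n : ℕ) : box r n (1 : Pol n) = 0 := by
  simp [box_apply]

theorem euler_w (r m : ℕ) (lam : ℂ) (K : ℕ) :
    euler (m + 1) (w r m lam K) = (K : ℂ) • w r m lam K := by
  refine ext_cmp fun a => ?_
  rw [cmp_euler, map_smul]
  by_cases h : ∃ k, 2 * k ≤ K ∧ a = K - 2 * k
  · obtain ⟨k, hk, rfl⟩ := h
    have h1 := euler_quad_pow_mul (r := r) (euler_one_smul m) k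
    rw [mul_one] at h1
    rw [cmp_w_of_le hk, map_smul, h1, Nat.cast_sub hk]
    push_cast
    module
  · push Not at h
    rw [cmp_w_of_ne h]
    simp

/-- The recurrence for the coefficients of `w_{K,λ}`, as a formula for the Laplacian of
`g(ξ') w_{K,λ}(ξ)` with `g` harmonic. -/
theorem cmp_box_emb_mul_w {h : Pol m} {j : ℕ} (hh : h ∈ harm r m j) {k : ℕ}
    (hk : 2 * (k + 1) ≤ K) : cmp (K - 2 * (k + 1)) (box r (m + 1) (emb m h * w r m lam K)) =
      (4 * (k + 1) * (K + j - lam - 1) * wCoeff r m lam K (k + 1)) • (quad r m ^ k * h) := by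
  obtain ⟨h1, h2⟩ := mem_harm_iff.1 hh
  have e : K - 2 * (k + 1) + 2 = K - 2 * k := by omega
  rw [cmp_box, cmp_emb_mul, cmp_emb_mul, e, cmp_w_of_le hk, cmp_w_of_le (by omega : 2 * k ≤ K),
    mul_smul_comm, map_smul, mul_comm h, box_quad_pow_succ_mul h1 h2, mul_smul_comm, mul_comm h,
    smul_smul, smul_smul, ← add_smul]
  congr 1
  rw [Nat.cast_sub hk]
  push_cast
  linear_combination wCoeff_succ (r := r) (m := m) (lam := lam) hk

theorem cmp_box_emb_mul_w_of_ne {h : Pol m} {j : ℕ} (hh : h ∈ harm r m j) {a : ℕ}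
    (ha : ∀ k, 2 * (k + 1) ≤ K → a ≠ K - 2 * (k + 1)) :
    cmp a (box r (m + 1) (emb m h * w r m lam K)) = 0 := by
  have h0 : cmp (a + 2) (w r m lam K) = 0 := by
    refine cmp_w_of_ne fun k hk hak => ha k ?_ ?_ <;> omega
  rw [cmp_box, cmp_emb_mul, cmp_emb_mul, h0, mul_zero, smul_zero, add_zero]
  by_cases hK : a = K
  · subst hK
    have h1 := cmp_w_of_le (r := r) (m := m) (lam := lam) (K := a) (k := 0) (by omega)
    rw [mul_zero, Nat.sub_zero, pow_zero] at h1
    rw [h1, mul_smul_comm, mul_one, map_smul, (mem_harm_iff.1 hh).2, smul_zero]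
  · rw [cmp_w_of_ne, mul_zero, map_zero]
    intro k hk hak
    rcases k with _ | k
    · exact hK (by omega)
    · exact ha k hk hak

/-- The factor K + j - λ - 1 in `cmp_box_emb_mul_w` vanishes exactly when K + j = λ + 1. -/
theorem emb_mul_w_mem_harm {h : Pol m} {j l : ℕ} (hh : h ∈ harm r m j) (hj : K + j = l + 1) :
    emb m h * w r m (l : ℂ) K ∈ harm r (m + 1) (l + 1) := by
  have hj' : (K : ℂ) + j = l + 1 := by exact_mod_cast hj
  refine mem_harm_iff.2 ⟨?_, ext_cmp fun a => ?_⟩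
  · have h1 : euler (m + 1) (emb m h) = (j : ℂ) • emb m h := by
      rw [← mem_homogeneousSubmodule_iff_euler]
      exact IsHomogeneous.rename_isHomogeneous hh.1
    rw [euler_mul, h1, euler_w, mul_smul_comm, mul_smul_comm, mul_comm (w _ _ _ _), ← add_smul, hj']
    push_cast
    rfl
  · rw [map_zero]
    by_cases ha : ∃ k, 2 * (k + 1) ≤ K ∧ a = K - 2 * (k + 1)
    · obtain ⟨k, hk, rfl⟩ := ha
      rw [cmp_box_emb_mul_w hh hk, hj']
      simp
    · push Not at ha
      exact cmp_box_emb_mul_w_of_ne hh ha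

theorem one_mem_harm (r n : ℕ) : (1 : Pol n) ∈ harm r n 0 :=
  mem_harm_iff.2 ⟨by simp [euler_apply], box_one r n⟩

/-- The case h = 1, j = 0 of the same formula: □w_K carries the factor K - λ - 1, which cancels the
factor λ - K + 1 in front of ∂_j. -/
theorem w_mem_Sol (r m : ℕ) (lam : ℂ) (K : ℕ) : w r m lam K ∈ Sol r m lam := by
  rw [mem_Sol_iff]
  intro j
  rw [P_castSucc_eq_zero_iff (euler_w r m lam K)]
  intro a
  rw [← cmp_box]
  have hw : w r m lam K = emb m 1 * w r m lam K := by rw [map_one, one_mul]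
  by_cases ha : ∃ k, 2 * (k + 1) ≤ K ∧ a = K - 2 * (k + 1)
  · obtain ⟨k, hk, rfl⟩ := ha
    have e1 : ((k + 1 : ℕ) : Pol m) * quad r m ^ k * ((2 * eps ℂ r j) • X j) =
        (((k : ℂ) + 1) * (2 * eps ℂ r j)) • (X j * quad r m ^ k) := by
      simp only [smul_eq_C_mul, map_mul, map_add, map_one, map_natCast, Nat.cast_succ]
      ring
    rw [cmp_w_of_le hk, hw, cmp_box_emb_mul_w (one_mem_harm r m) hk, Derivation.map_smul,
      pderiv_pow, pderiv_quad, Nat.add_sub_cancel, e1, mul_one, mul_smul_comm, smul_smul, smul_smul,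
      smul_smul, ← add_smul]
    refine (congrArg (fun c : ℂ => c • (X j * quad r m ^ k)) ?_).trans (zero_smul ℂ _)
    push_cast
    ring
  · push Not at ha
    rw [hw, cmp_box_emb_mul_w_of_ne (one_mem_harm r m) ha, ← hw, mul_zero, smul_zero, zero_add]
    by_cases hK : a = K
    · subst hK
      have h1 := cmp_w_of_le (r := r) (m := m) (lam := lam) (K := a) (k := 0) (by omega)
      rw [mul_zero, Nat.sub_zero, pow_zero] at h1
      rw [h1, Derivation.map_smul]
      simp
    · rw [cmp_w_of_ne, map_zero, smul_zero]
      intro k hk hak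
      rcases k with _ | k
      · exact hK (by omega)
      · exact ha k hk hak

end W


/-! ### Solutions degree by degree -/

section Solutions

variable {r m : ℕ} {lam : ℂ}

/-- Uniqueness for a two-step recursion in the power of ξ_n. It is applied both to □f = 0 and to the
system P_j f = 0, where f_a determines f_{a+2}. -/
theorem eq_zero_of_cmp {f : Pol (m + 1)} (h0 : cmp 0 f = 0) (h1 : cmp 1 f = 0)
    (hs : ∀ a, cmp a f = 0 → cmp (a + 2) f = 0) : f = 0 := by
  have h : ∀ a, cmp a f = 0 ∧ cmp (a + 1) f = 0 := fun a => by
    induction a with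
    | zero => exact ⟨h0, h1⟩
    | succ a ih => exact ⟨ih.2, hs a ih.1⟩
  exact ext_cmp fun a => by rw [(h a).1, map_zero]

theorem eps_ne_zero (r : ℕ) {n : ℕ} (i : Fin n) : eps ℂ r i ≠ 0 := by
  intro h
  have := eps_mul_self r i
  simp [h] at this

theorem last_factor_ne_zero (r m a : ℕ) :
    eps ℂ r (Fin.last m) * (((a : ℂ) + 1) * (a + 2)) ≠ 0 := by
  refine mul_ne_zero (eps_ne_zero r _) (mul_ne_zero ?_ ?_)
  · exact_mod_cast Nat.succ_ne_zero a
  · exact_mod_cast Nat.succ_ne_zero (a + 1)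

theorem eq_of_box_eq_zero {f h : Pol (m + 1)} (hf : box r (m + 1) f = 0)
    (hh : box r (m + 1) h = 0) (h0 : cmp 0 f = cmp 0 h) (h1 : cmp 1 f = cmp 1 h) : f = h := by
  rw [← sub_eq_zero]
  refine eq_zero_of_cmp (by rw [map_sub, h0, sub_self]) (by rw [map_sub, h1, sub_self])
    fun a ha => ?_
  have h2 : box r (m + 1) (f - h) = 0 := by rw [map_sub, hf, hh, sub_self]
  have h3 := cmp_box (r := r) a (f - h)
  rw [h2, map_zero, ha, map_zero, zero_add] at h3
  exact (smul_eq_zero.1 h3.symm).resolve_left (last_factor_ne_zero r m a)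

theorem eq_of_mem_Sol (hm : 0 < m) {f h : Pol (m + 1)} {c : ℂ} (hf : f ∈ Sol r m lam)
    (hh : h ∈ Sol r m lam) (ef : euler (m + 1) f = c • f) (eh : euler (m + 1) h = c • h)
    (h0 : cmp 0 f = cmp 0 h) (h1 : cmp 1 f = cmp 1 h) : f = h := by
  rw [← sub_eq_zero]
  have hs := (mem_Sol_iff lam _).1 (Submodule.sub_mem _ hf hh)
  have es : euler (m + 1) (f - h) = c • (f - h) := by rw [map_sub, ef, eh, smul_sub]
  refine eq_zero_of_cmp (by rw [map_sub, h0, sub_self]) (by rw [map_sub, h1, sub_self])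
    fun a ha => ?_
  have h3 := (P_castSucc_eq_zero_iff es _).1 (hs ⟨0, hm⟩) a
  rw [ha, map_zero, map_zero, smul_zero, add_zero, zero_add, mul_smul_comm, smul_smul] at h3
  have h4 := (smul_eq_zero.1 h3).resolve_left (mul_ne_zero
    (div_ne_zero (eps_ne_zero r _) two_ne_zero) (last_factor_ne_zero r m a))
  exact (mul_eq_zero.1 h4).resolve_left (X_ne_zero _)

theorem euler_P {n : ℕ} {f : Pol n} {c : ℂ} (h : euler n f = c • f) (j : Fin n) :
    euler n (P r n lam j f) = (c - 1) • P r n lam j f := by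
  have hX : euler n (X j) = X j := by
    rw [euler_apply, Finset.sum_eq_single j]
    · simp
    · intro k _ hk
      rw [pderiv_X_of_ne hk.symm, mul_zero]
    · simp
  rw [P_apply, euler_pderiv_of h]
  simp only [map_smul, map_add, map_sub, euler_mul, hX, euler_box_of h, euler_pderiv_of h,
    mul_smul_comm]
  rw [mul_comm (box r n f)]
  module

theorem homogeneousComponent_mem_Sol {f : Pol (m + 1)} (hf : f ∈ Sol r m lam) (K : ℕ) :
    homogeneousComponent K f ∈ Sol r m lam := by
  rw [mem_Sol_iff] at hf ⊢
  intro j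
  have he (k : ℕ) : euler (m + 1) (homogeneousComponent k f) =
      (k : ℂ) • homogeneousComponent k f := by
    rw [← mem_homogeneousSubmodule_iff_euler]
    exact homogeneousComponent_mem k f
  -- P_j lowers the degree by one, so the terms of degree |α| in P_j f come only from the component
  -- of degree |α| + 1 of f.
  have hz (k : ℕ) (α : Fin (m + 1) →₀ ℕ) (h : α.degree + 1 ≠ k) :
      coeff α (P r (m + 1) lam j.castSucc (homogeneousComponent k f)) = 0 := by
    have h1 := congrArg (coeff α) (euler_P (r := r) (lam := lam) (he k) j.castSucc)
    rw [coeff_euler, coeff_smul, smul_eq_mul] at h1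
    by_contra h2
    have h3 := mul_right_cancel₀ h2 h1
    exact h (by exact_mod_cast (by linear_combination h3 : (α.degree : ℂ) + 1 = k))
  ext α
  rw [coeff_zero]
  by_cases h : α.degree + 1 = K
  · subst h
    by_cases hd : α.degree + 1 < f.totalDegree + 1
    · have h1 := congrArg (coeff α) (hf j)
      rw [← sum_homogeneousComponent f, map_sum, coeff_sum,
        Finset.sum_eq_single (α.degree + 1)] at h1
      · simpa using h1
      · intro k _ hk
        exact hz k α hk.symm
      · intro h'
        exact absurd (Finset.mem_range.2 hd) h'
    · rw [homogeneousComponent_eq_zero _ _ (by omega), map_zero, coeff_zero]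
  · exact hz K α h

/-- An eigenvector of the Casimir operator in the variables `ξ₁, …, ξ_{n-1}` has the same leading
coefficients with respect to `ξ_n` as some `g(ξ') w_{K,λ}(ξ)`. -/
theorem exists_cmp_eq_cmp_emb_mul_w (hm : 2 ≤ m) (lam : ℂ) {K j : ℕ} {f : Pol (m + 1)}
    (he : euler (m + 1) f = ((K + j : ℕ) : ℂ) • f)
    (hc : ∀ a, casimir r m (cmp a f) = (-(j * (j + m - 2) : ℂ)) • cmp a f) :
    ∃ h ∈ harm r m j, ∀ b ≤ 1, cmp b f = cmp b (emb m h * w r m lam K) := by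
  -- The component f_b has degree K + j - b and the Casimir eigenvalue of H^j, so it is zero or of
  -- the form Q'^s h with 2s = K - b. Of b = 0 and b = 1 only the one with the parity of K survives.
  have key (b : ℕ) (hb : b ≤ 1) : cmp b f = 0 ∨
      b = K - 2 * (K / 2) ∧ ∃ h ∈ harm r m j, cmp b f = quad r m ^ (K / 2) * h := by
    have h1 := euler_cmp_of he b
    by_cases hbK : b ≤ K + j
    · rw [← Nat.cast_sub hbK] at h1
      rcases eq_quad_pow_mul_of_casimir hm j _ h1 (hc b) with h2 | ⟨s, h, hh, hs, h2⟩
      · exact Or.inl h2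
      · have : s = K / 2 := by omega
        exact Or.inr ⟨by omega, h, hh, by rw [h2, this]⟩
    · left
      refine eq_zero_of_euler (fun k hk => ?_) h1
      have : ((K + j : ℕ) : ℂ) = ((k + b : ℕ) : ℂ) := by push_cast at hk ⊢; linear_combination hk
      have : K + j = k + b := by exact_mod_cast this
      omega
  have hw : cmp (K - 2 * (K / 2)) (w r m lam K) = _ := cmp_w_of_le (by omega)
  have hne (b : ℕ) (hb : b ≤ 1) (hbK : b ≠ K - 2 * (K / 2)) (h : Pol m) :
      cmp b f = cmp b (emb m h * w r m lam K) := by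
    rw [cmp_emb_mul, cmp_w_of_ne (fun k hk hbk => hbK (by omega)), mul_zero]
    exact (key b hb).resolve_right fun h => hbK h.1
  have hK : K - 2 * (K / 2) ≤ 1 := by omega
  rcases key _ hK with h0 | ⟨_, h, hh, h0⟩
  · refine ⟨0, Submodule.zero_mem _, fun b hb => ?_⟩
    by_cases hbK : b = K - 2 * (K / 2)
    · rw [hbK, h0]; simp
    · exact hne b hb hbK 0
  · refine ⟨(wCoeff r m lam K (K / 2))⁻¹ • h, Submodule.smul_mem _ _ hh, fun b hb => ?_⟩
    by_cases hbK : b = K - 2 * (K / 2)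
    · rw [hbK, h0, cmp_emb_mul, hw, smul_mul_smul_comm, inv_mul_cancel₀ (wCoeff_ne_zero r m lam K),
        one_smul, mul_comm]
    · exact hne b hb hbK _

theorem emb_mul_w_of_mem_harm_zero {h : Pol m} (hh : h ∈ harm r m 0) (K : ℕ) :
    emb m h * w r m lam K ∈ Submodule.span ℂ {w r m lam K} := by
  have h1 : h = C (coeff 0 h) :=
    totalDegree_eq_zero_iff_eq_C.1 (Nat.le_zero.1 (IsHomogeneous.totalDegree_le hh.1))
  rw [h1]
  have : emb m (C (coeff 0 h)) = C (coeff 0 h) := rename_C _ _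
  rw [this, ← smul_eq_C_mul]
  exact Submodule.smul_mem _ _ (Submodule.mem_span_singleton_self _)

/-- Away from degree λ + 1 the equations can be solved for ∂_j f_a, which shows that the gradient is
radial; the leading component is then a constant times a power of Q', as for w_K. -/
theorem mem_span_w_of_mem_Sol (hm : 2 ≤ m) {K : ℕ} (hK : lam - K + 1 ≠ 0) {f : Pol (m + 1)}
    (hf : f ∈ Sol r m lam) (he : euler (m + 1) f = (K : ℂ) • f) :
    f ∈ Submodule.span ℂ {w r m lam K} := by
  have hP := (mem_Sol_iff lam f).1 hf
  have hc (a : ℕ) : casimir r m (cmp a f) = (-(((0 : ℕ) : ℂ) * ((0 : ℕ) + m - 2) : ℂ)) • cmp a f := by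
    have : casimir r m (cmp a f) = 0 := by
      -- The radial factor is obtained by dividing the equation by λ - K + 1.
      refine casimir_of_gradient (h := (-(lam - K + 1)⁻¹ / 2) • (box r m (cmp a f) +
        (eps ℂ r (Fin.last m) * ((a + 1) * (a + 2))) • cmp (a + 2) f)) fun i => ?_
      have h1 := (P_castSucc_eq_zero_iff he i).1 (hP i) a
      set B := box r m (cmp a f) + (eps ℂ r (Fin.last m) * ((a + 1) * (a + 2))) • cmp (a + 2) f
      have h2 : (lam - K + 1)⁻¹ • ((eps ℂ r i / 2) • (X i * B) +
          (lam - K + 1) • pderiv i (cmp a f)) = 0 := by rw [h1, smul_zero]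
      rw [smul_add, smul_smul, smul_smul, inv_mul_cancel₀ hK, one_smul] at h2
      rw [eq_neg_of_add_eq_zero_right h2, mul_smul_comm, smul_smul, ← neg_smul]
      congr 1
      ring
    rw [this]
    simp
  obtain ⟨h, hh, H⟩ := exists_cmp_eq_cmp_emb_mul_w hm lam (j := 0) he hc
  have hs := emb_mul_w_of_mem_harm_zero (lam := lam) hh K
  obtain ⟨c, hcw⟩ := Submodule.mem_span_singleton.1 hs
  rw [← hcw] at H hs
  have : f = c • w r m lam K := eq_of_mem_Sol (by omega) hf
    (Submodule.smul_mem _ _ (w_mem_Sol r m lam K)) he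
    (by rw [map_smul, euler_w, smul_comm]) (H 0 (by omega)) (H 1 le_rfl)
  rw [this]
  exact hs

/-- In degree λ + 1 only ξ_j □f remains of P_j f, and a single index j < n already forces □f = 0. -/
theorem mem_Sol_iff_mem_harm (hm : 0 < m) (l : ℕ) {f : Pol (m + 1)}
    (he : euler (m + 1) f = ((l + 1 : ℕ) : ℂ) • f) :
    f ∈ Sol r m (l : ℂ) ↔ f ∈ harm r (m + 1) (l + 1) := by
  have hP (j : Fin (m + 1)) : P r (m + 1) (l : ℂ) j f =
      -Complex.I • ((eps ℂ r j / 2) • (X j * box r (m + 1) f)) := by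
    rw [P_of_euler he]
    push_cast
    simp
  rw [mem_Sol_iff, mem_harm_iff]
  refine ⟨fun h => ⟨he, ?_⟩, fun h j => by rw [hP, h.2]; simp⟩
  have h1 := h ⟨0, hm⟩
  rw [hP, smul_smul] at h1
  have h2 := (smul_eq_zero.1 h1).resolve_left (mul_ne_zero (neg_ne_zero.2 Complex.I_ne_zero)
    (div_ne_zero (eps_ne_zero r _) two_ne_zero))
  exact (mul_eq_zero.1 h2).resolve_left (X_ne_zero _)

/-- The `O(p-1,q-2)`-decomposition of the harmonic polynomials of degree `l + 1`. -/
theorem harm_le (hm : 2 ≤ m) (l : ℕ) (V : Submodule ℂ (Pol (m + 1)))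
    (hV : ∀ j ≤ l + 1, ∀ h ∈ harm r m j, emb m h * w r m (l : ℂ) (l + 1 - j) ∈ V) :
    harm r (m + 1) (l + 1) ≤ V := by
  intro f hf
  obtain ⟨he, hb⟩ := mem_harm_iff.1 hf
  have e0 := euler_cmp_of he 0
  have e1 := euler_cmp_of he 1
  rw [Nat.cast_zero, sub_zero] at e0
  rw [← Nat.cast_sub (by omega), Nat.add_sub_cancel] at e1
  obtain ⟨u, hu, hu'⟩ := exists_harmonic_decomposition (r := r) hm (l + 1) e0
  obtain ⟨v, hv, hv'⟩ := exists_harmonic_decomposition (r := r) hm l e1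
  -- The candidate has the same f_0 and f_1 as f: the product of u_s with w_{2s} contributes only to
  -- the component 0, that of v_s with w_{2s+1} only to the component 1. The constants normalize the
  -- coefficient of Q'^s to 1.
  set F : Pol (m + 1) :=
    ∑ s ∈ Finset.range ((l + 1) / 2 + 1), (wCoeff r m (l : ℂ) (2 * s) s)⁻¹ •
      (emb m (u s) * w r m (l : ℂ) (2 * s)) +
    ∑ s ∈ Finset.range (l / 2 + 1), (wCoeff r m (l : ℂ) (2 * s + 1) s)⁻¹ •
      (emb m (v s) * w r m (l : ℂ) (2 * s + 1)) with hF
  have hle {d s : ℕ} (hs : s ∈ Finset.range (d / 2 + 1)) : 2 * s ≤ d := by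
    have := Finset.mem_range.1 hs; omega
  have hFb : box r (m + 1) F = 0 := by
    rw [hF, map_add, map_sum, map_sum, Finset.sum_eq_zero, Finset.sum_eq_zero, add_zero]
    · intro s hs
      have := hle hs
      rw [map_smul, (mem_harm_iff.1 (emb_mul_w_mem_harm (hv s this) (by omega))).2, smul_zero]
    · intro s hs
      have := hle hs
      rw [map_smul, (mem_harm_iff.1 (emb_mul_w_mem_harm (hu s this) (by omega))).2, smul_zero]
  have w0 (s : ℕ) : cmp 0 (w r m (l : ℂ) (2 * s)) = wCoeff r m (l : ℂ) (2 * s) s • quad r m ^ s := by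
    have := cmp_w_of_le (r := r) (m := m) (lam := (l : ℂ)) (K := 2 * s) (k := s) le_rfl
    rwa [Nat.sub_self] at this
  have w1 (s : ℕ) : cmp 1 (w r m (l : ℂ) (2 * s + 1)) =
      wCoeff r m (l : ℂ) (2 * s + 1) s • quad r m ^ s := by
    have := cmp_w_of_le (r := r) (m := m) (lam := (l : ℂ)) (K := 2 * s + 1) (k := s) (by omega)
    rwa [Nat.add_sub_cancel_left] at this
  have w0' (s : ℕ) : cmp 0 (w r m (l : ℂ) (2 * s + 1)) = 0 := cmp_w_of_ne fun k hk h => by omega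
  have w1' (s : ℕ) : cmp 1 (w r m (l : ℂ) (2 * s)) = 0 := cmp_w_of_ne fun k hk h => by omega
  have n0 (s : ℕ) : wCoeff r m (l : ℂ) (2 * s) s ≠ 0 := by
    have := wCoeff_ne_zero r m (l : ℂ) (2 * s)
    rwa [show 2 * s / 2 = s by omega] at this
  have n1 (s : ℕ) : wCoeff r m (l : ℂ) (2 * s + 1) s ≠ 0 := by
    have := wCoeff_ne_zero r m (l : ℂ) (2 * s + 1)
    rwa [show (2 * s + 1) / 2 = s by omega] at this
  have hfF : f = F := by
    refine eq_of_box_eq_zero hb hFb ?_ ?_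
    · rw [hu', hF, map_add, map_sum, map_sum, Finset.sum_eq_zero (s := Finset.range (l / 2 + 1)),
        add_zero]
      · refine Finset.sum_congr rfl fun s _ => ?_
        rw [map_smul, cmp_emb_mul, w0, mul_smul_comm, smul_smul, inv_mul_cancel₀ (n0 s), one_smul,
          mul_comm]
      · intro s _
        rw [map_smul, cmp_emb_mul, w0', mul_zero, smul_zero]
    · rw [hv', hF, map_add, map_sum, map_sum,
        Finset.sum_eq_zero (s := Finset.range ((l + 1) / 2 + 1)), zero_add]
      · refine Finset.sum_congr rfl fun s _ => ?_
        rw [map_smul, cmp_emb_mul, w1, mul_smul_comm, smul_smul, inv_mul_cancel₀ (n1 s), one_smul,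
          mul_comm]
      · intro s _
        rw [map_smul, cmp_emb_mul, w1', mul_zero, smul_zero]
  rw [hfF, hF]
  refine Submodule.add_mem _ (Submodule.sum_mem _ fun s hs => Submodule.smul_mem _ _ ?_)
    (Submodule.sum_mem _ fun s hs => Submodule.smul_mem _ _ ?_)
  · have h1 := hle hs
    have := hV _ (by omega) _ (hu s h1)
    rwa [show l + 1 - (l + 1 - 2 * s) = 2 * s by omega] at this
  · have h1 := hle hs
    have := hV _ (by omega) _ (hv s h1)
    rwa [show l + 1 - (l - 2 * s) = 2 * s + 1 by omega] at this

theorem Sol_le (V : Submodule ℂ (Pol (m + 1)))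
    (hV : ∀ K : ℕ, ∀ f ∈ Sol r m lam, euler (m + 1) f = (K : ℂ) • f → f ∈ V) :
    Sol r m lam ≤ V := by
  intro f hf
  rw [← sum_homogeneousComponent f]
  refine Submodule.sum_mem _ fun K _ => hV K _ (homogeneousComponent_mem_Sol hf K) ?_
  rw [← mem_homogeneousSubmodule_iff_euler]
  exact homogeneousComponent_mem K f

end Solutions


/-! ### Linear substitutions -/

section Substitution

variable {r m : ℕ} {A : Matrix (Fin m) (Fin m) ℝ}

theorem subst_X (A : Matrix (Fin m) (Fin m) ℝ) (i : Fin m) :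
    subst A (X i) = ∑ k, ((A i k : ℝ) : ℂ) • (X k : Pol m) := by
  simp [subst]

theorem subst_one (f : Pol m) : subst (1 : Matrix (Fin m) (Fin m) ℝ) f = f := by
  have : subst (1 : Matrix (Fin m) (Fin m) ℝ) = AlgHom.id ℂ _ := by
    refine algHom_ext fun i => ?_
    rw [subst_X, Finset.sum_eq_single i]
    · simp
    · intro k _ hk
      simp [Matrix.one_apply_ne hk.symm]
    · simp
  rw [this]
  rfl

theorem pderiv_subst (A : Matrix (Fin m) (Fin m) ℝ) (k : Fin m) (f : Pol m) :
    pderiv k (subst A f) = ∑ i, ((A i k : ℝ) : ℂ) • subst A (pderiv i f) := by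
  induction f using MvPolynomial.induction_on with
  | C a => simp [subst]
  | add p q hp hq => simp only [map_add, hp, hq, smul_add, Finset.sum_add_distrib]
  | mul_X p i hp =>
    have h1 : pderiv k (subst A (X i)) = C ((A i k : ℝ) : ℂ) := by
      rw [subst_X, map_sum, Finset.sum_eq_single k]
      · rw [Derivation.map_smul, pderiv_X_self, smul_eq_C_mul, mul_one]
      · intro b _ hb
        rw [Derivation.map_smul, pderiv_X_of_ne hb, smul_zero]
      · simp
    have h2 (a : Fin m) : ((A a k : ℝ) : ℂ) • subst A (pderiv a (p * X i)) =
        (if a = i then C ((A i k : ℝ) : ℂ) * subst A p else 0) +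
          subst A (X i) * (((A a k : ℝ) : ℂ) • subst A (pderiv a p)) := by
      rw [Derivation.leibniz, smul_eq_mul, smul_eq_mul, map_add, map_mul, map_mul, smul_add,
        mul_smul_comm]
      congr 1
      split_ifs with h
      · rw [h, pderiv_X_self, map_one, mul_one, smul_eq_C_mul]
      · rw [pderiv_X_of_ne (Ne.symm h), map_zero, mul_zero, smul_zero]
    simp only [h2, Finset.sum_add_distrib, Finset.sum_ite_eq', Finset.mem_univ, if_true]
    rw [map_mul, Derivation.leibniz, h1, hp, smul_eq_mul, smul_eq_mul, mul_comm (subst A p),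
      ← Finset.mul_sum]

theorem euler_subst (A : Matrix (Fin m) (Fin m) ℝ) (f : Pol m) :
    euler m (subst A f) = subst A (euler m f) := by
  simp only [euler_apply, pderiv_subst, map_sum, map_mul, subst_X, Finset.mul_sum, Finset.sum_mul]
  rw [Finset.sum_comm]
  exact Finset.sum_congr rfl fun i _ => Finset.sum_congr rfl fun k _ => by
    rw [mul_smul_comm, smul_mul_assoc]

/-- AᵀQA = Q implies AQAᵀ = Q because Q² = 1. The row form is the one that governs □, the column
form the one that governs the quadratic polynomial. -/
theorem InO.sum_mul (hA : InO r A) (i j : Fin m) :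
    ∑ k, eps ℝ r k * A i k * A j k = if i = j then eps ℝ r i else 0 := by
  have e (i : Fin m) : eps ℝ r i * eps ℝ r i = 1 := by unfold eps; split_ifs <;> simp
  have hD : Matrix.diagonal (eps ℝ r) * Matrix.diagonal (eps ℝ r) =
      (1 : Matrix (Fin m) (Fin m) ℝ) := by
    rw [Matrix.diagonal_mul_diagonal]
    simp only [e, Matrix.diagonal_one]
  have h1 : Matrix.diagonal (eps ℝ r) * Aᵀ * Matrix.diagonal (eps ℝ r) * A = 1 := by
    rw [Matrix.mul_assoc, Matrix.mul_assoc, ← Matrix.mul_assoc Aᵀ, hA, hD]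
  have h2 : A * Matrix.diagonal (eps ℝ r) * Aᵀ = Matrix.diagonal (eps ℝ r) := by
    have h3 := _root_.mul_eq_one_comm.1 h1
    calc A * Matrix.diagonal (eps ℝ r) * Aᵀ =
        A * (Matrix.diagonal (eps ℝ r) * Aᵀ * Matrix.diagonal (eps ℝ r)) *
          Matrix.diagonal (eps ℝ r) := by
          simp only [Matrix.mul_assoc, hD, Matrix.mul_one]
      _ = _ := by rw [h3, Matrix.one_mul]
  have h4 := congrFun (congrFun h2 i) j
  rw [Matrix.mul_apply, Matrix.diagonal_apply] at h4
  simp only [Matrix.mul_diagonal, Matrix.transpose_apply] at h4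
  rw [← h4]
  exact Finset.sum_congr rfl fun k _ => by ring

theorem InO.box_subst (hA : InO r A) (f : Pol m) : box r m (subst A f) = subst A (box r m f) := by
  have hC (i j : Fin m) : ∑ k, eps ℂ r k * (A i k : ℂ) * (A j k : ℂ) =
      if i = j then eps ℂ r i else 0 := by
    have e (i : Fin m) : ((eps ℝ r i : ℝ) : ℂ) = eps ℂ r i := by unfold eps; split_ifs <;> simp
    have h := congrArg (Complex.ofReal) (hA.sum_mul i j)
    rw [Complex.ofReal_sum] at h
    simp only [Complex.ofReal_mul, e] at h
    rw [h]
    split_ifs <;> simp [e]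
  have h1 (k : Fin m) : eps ℂ r k • pderiv k (pderiv k (subst A f)) =
      ∑ i, ∑ j, (eps ℂ r k * (A i k : ℂ) * (A j k : ℂ)) • subst A (pderiv j (pderiv i f)) := by
    simp only [pderiv_subst, map_sum, Derivation.map_smul, Finset.smul_sum, smul_smul, mul_assoc]
  simp only [box_apply, h1]
  rw [Finset.sum_comm, map_sum]
  refine Finset.sum_congr rfl fun i _ => ?_
  rw [Finset.sum_comm]
  simp only [← Finset.sum_smul, hC, ite_smul, zero_smul, Finset.sum_ite_eq, Finset.mem_univ,
    if_true, map_smul]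

theorem InO.subst_quad (hA : InO r A) : subst A (quad r m) = quad r m := by
  have hC (i j : Fin m) : ∑ k, eps ℂ r k * ((A k i : ℂ) * (A k j : ℂ)) =
      if i = j then eps ℂ r i else 0 := by
    have e (i : Fin m) : ((eps ℝ r i : ℝ) : ℂ) = eps ℂ r i := by unfold eps; split_ifs <;> simp
    have h4 := congrFun (congrFun hA i) j
    rw [Matrix.mul_apply, Matrix.diagonal_apply] at h4
    simp only [Matrix.mul_diagonal, Matrix.transpose_apply] at h4
    have h := congrArg (Complex.ofReal) h4
    rw [Complex.ofReal_sum] at h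
    simp only [Complex.ofReal_mul, e] at h
    have h5 : (((if i = j then eps ℝ r i else 0 : ℝ)) : ℂ) = if i = j then eps ℂ r i else 0 := by
      split_ifs <;> simp [e]
    rw [← h5, ← h]
    exact Finset.sum_congr rfl fun k _ => by ring
  have h1 (k : Fin m) : subst A (eps ℂ r k • (X k * X k)) =
      ∑ i, ∑ j, (eps ℂ r k * ((A k i : ℂ) * (A k j : ℂ))) • (X i * X j : Pol m) := by
    rw [map_smul, map_mul, subst_X, Finset.sum_mul_sum, Finset.smul_sum]
    refine Finset.sum_congr rfl fun i _ => ?_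
    rw [Finset.smul_sum]
    refine Finset.sum_congr rfl fun j _ => ?_
    rw [smul_mul_smul_comm, smul_smul]
  rw [quad_eq_sum_mul, map_sum]
  simp only [h1]
  rw [Finset.sum_comm]
  refine Finset.sum_congr rfl fun i _ => ?_
  rw [Finset.sum_comm]
  simp only [← Finset.sum_smul, hC, ite_smul, zero_smul, Finset.sum_ite_eq, Finset.mem_univ,
    if_true]

theorem InO.subst_mem_harm (hA : InO r A) {j : ℕ} {f : Pol m} (hf : f ∈ harm r m j) :
    subst A f ∈ harm r m j := by
  rw [mem_harm_iff] at hf ⊢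
  rw [euler_subst, hA.box_subst, hf.1, hf.2, map_smul, map_zero]
  exact ⟨rfl, rfl⟩

theorem substPrime_last (A : Matrix (Fin m) (Fin m) ℝ) :
    substPrime A (X (Fin.last m)) = X (Fin.last m) := by
  simp [substPrime]

theorem substPrime_emb (A : Matrix (Fin m) (Fin m) ℝ) (f : Pol m) :
    substPrime A (emb m f) = emb m (subst A f) := by
  have : (substPrime A).comp (emb m) = (emb m).comp (subst A) := by
    refine algHom_ext fun i => ?_
    simp [substPrime, emb, subst, smul_eq_C_mul]
  exact DFunLike.congr_fun this f

theorem cmp_substPrime (A : Matrix (Fin m) (Fin m) ℝ) (a : ℕ) (f : Pol (m + 1)) :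
    cmp a (substPrime A f) = subst A (cmp a f) := by
  induction f using MvPolynomial.induction_on generalizing a with
  | C c =>
    have : (C c : Pol (m + 1)) = emb m (C c) * X (Fin.last m) ^ 0 := by simp [emb]
    rw [this, map_mul, substPrime_emb, map_pow, substPrime_last, cmp_emb_mul_last_pow,
      cmp_emb_mul_last_pow]
    split_ifs <;> simp
  | add p q hp hq => rw [map_add, map_add, hp, hq, map_add, map_add]
  | mul_X p i hp =>
    rw [map_mul, mul_comm, mul_comm p]
    induction i using Fin.lastCases with
    | last =>
      rw [substPrime_last, cmp_last_mul, cmp_last_mul]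
      split_ifs
      · rw [map_zero]
      · exact hp _
    | cast i =>
      have : (X i.castSucc : Pol (m + 1)) = emb m (X i) := by simp [emb]
      rw [this, substPrime_emb, cmp_emb_mul, cmp_emb_mul, hp, map_mul]

theorem InO.substPrime_w (hA : InO r A) (lam : ℂ) (K : ℕ) :
    substPrime A (w r m lam K) = w r m lam K := by
  rw [w_eq, map_sum]
  refine Finset.sum_congr rfl fun k _ => ?_
  rw [map_smul, map_mul, substPrime_emb, map_pow, map_pow (substPrime A), substPrime_last,
    hA.subst_quad, map_pow]

end Substitution

/-! ### One-parameter subgroups and infinitesimal rotations -/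

section Rotations

variable {r m : ℕ}

/-- Testing against linear functionals makes a topology on polynomials unnecessary. All functionals
are treated at once, since the product rule replaces L by L composed with multiplication by a
variable. -/
theorem hasDerivAt_subst {A : ℝ → Matrix (Fin m) (Fin m) ℝ} {B : Matrix (Fin m) (Fin m) ℝ}
    (h0 : A 0 = 1) (hA : ∀ i k, HasDerivAt (fun t => A t i k) (B i k) 0)
    (D : Derivation ℂ (Pol m) (Pol m)) (hD : ∀ i, D (X i) = ∑ k, ((B i k : ℝ) : ℂ) • X k)
    (f : Pol m) (L : Pol m →ₗ[ℂ] ℂ) : HasDerivAt (fun t => L (subst (A t) f)) (L (D f)) 0 := by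
  induction f using MvPolynomial.induction_on generalizing L with
  | C a =>
    have : (fun t => L (subst (A t) (C a))) = fun _ => L (C a) := by
      funext t; simp [subst]
    rw [this]
    simpa using hasDerivAt_const (0 : ℝ) (L (C a))
  | add p q hp hq =>
    simpa only [map_add] using (hp L).fun_add (hq L)
  | mul_X p i hp =>
    have h1 (k : Fin m) : HasDerivAt
        (fun t => ((A t i k : ℝ) : ℂ) * L (X k * subst (A t) p))
        ((B i k : ℂ) * L (X k * p) + (((1 : Matrix (Fin m) (Fin m) ℝ) i k : ℝ) : ℂ) *
          L (X k * D p)) 0 := by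
      have := (hA i k).ofReal_comp.fun_mul (hp (L ∘ₗ LinearMap.mulLeft ℂ (X k)))
      simpa [h0, subst_one] using this
    have h2 := HasDerivAt.fun_sum (u := Finset.univ) fun k _ => h1 k
    have h3 (t : ℝ) : L (subst (A t) (p * X i)) =
        ∑ k, ((A t i k : ℝ) : ℂ) * L (X k * subst (A t) p) := by
      rw [map_mul, subst_X, Finset.mul_sum, map_sum]
      refine Finset.sum_congr rfl fun k _ => ?_
      rw [mul_smul_comm, map_smul, smul_eq_mul, mul_comm (subst _ _)]
    simp only [h3]
    refine h2.congr_deriv ?_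
    rw [Derivation.leibniz, hD, smul_eq_mul, smul_eq_mul, map_add, Finset.mul_sum, map_sum,
      Finset.sum_add_distrib]
    congr 1
    · refine Finset.sum_congr rfl fun k _ => ?_
      rw [mul_smul_comm, map_smul, smul_eq_mul, mul_comm p]
    · rw [Finset.sum_eq_single i]
      · simp
      · intro k _ hk
        simp [Matrix.one_apply_ne hk.symm]
      · simp

/-- Infinitesimal skewness says (tB)ᵀ = Q(-tB)Q⁻¹; exponentiating this conjugation gives exp(tB)ᵀ =
Q exp(tB)⁻¹ Q⁻¹. -/
theorem inO_exp {B : Matrix (Fin m) (Fin m) ℝ}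
    (hB : Bᵀ * Matrix.diagonal (eps ℝ r) = -(Matrix.diagonal (eps ℝ r) * B)) (t : ℝ) :
    InO r (NormedSpace.exp (t • B)) := by
  have e (i : Fin m) : eps ℝ r i * eps ℝ r i = 1 := by unfold eps; split_ifs <;> simp
  set Q : Matrix (Fin m) (Fin m) ℝ := Matrix.diagonal (eps ℝ r) with hQ
  have hD : Q * Q = 1 := by
    rw [hQ, Matrix.diagonal_mul_diagonal]
    simp only [e, Matrix.diagonal_one]
  have hu : IsUnit Q := ⟨⟨Q, Q, hD, hD⟩, rfl⟩
  have hi : Q⁻¹ = Q := Matrix.inv_eq_left_inv hD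
  have h1 : (t • B)ᵀ = Q * (-(t • B)) * Q⁻¹ := by
    have : Bᵀ = -(Q * B) * Q := by rw [← hB, Matrix.mul_assoc, hD, Matrix.mul_one]
    rw [hi, Matrix.transpose_smul, this]
    simp
  have h2 : (NormedSpace.exp (t • B))⁻¹ * NormedSpace.exp (t • B) = 1 :=
    Matrix.nonsing_inv_mul _ ((Matrix.isUnit_iff_isUnit_det _).1 (Matrix.isUnit_exp _))
  change (NormedSpace.exp (t • B))ᵀ * Q * NormedSpace.exp (t • B) = Q
  rw [← Matrix.exp_transpose, h1, Matrix.exp_conj _ _ hu, Matrix.exp_neg, hi,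
    Matrix.mul_assoc _ Q Q, hD, Matrix.mul_one, Matrix.mul_assoc, h2, Matrix.mul_one]

theorem hasDerivAt_exp_apply (B : Matrix (Fin m) (Fin m) ℝ) (i k : Fin m) :
    HasDerivAt (fun t : ℝ => NormedSpace.exp (t • B) i k) (B i k) 0 := by
  let _ : NormedRing (Matrix (Fin m) (Fin m) ℝ) := Matrix.linftyOpNormedRing
  let _ : NormedAlgebra ℝ (Matrix (Fin m) (Fin m) ℝ) := Matrix.linftyOpNormedAlgebra
  have := (hasDerivAt_pi.1 ((hasDerivAt_pi.1
    (hasDerivAt_exp_smul_const (𝕂 := ℝ) B (0 : ℝ))) i)) k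
  simp only [zero_smul, NormedSpace.exp_zero, one_mul] at this
  exact this

/-- The infinitesimal rotation `εᵢ ξᵢ ∂ₖ - εₖ ξₖ ∂ᵢ`. -/
noncomputable def rot (r : ℕ) {m : ℕ} (i k : Fin m) : Derivation ℂ (Pol m) (Pol m) :=
  (eps ℂ r i • X i : Pol m) • pderiv k - (eps ℂ r k • X k : Pol m) • pderiv i

theorem rot_apply (i k : Fin m) (f : Pol m) :
    rot r i k f = eps ℂ r i • (X i * pderiv k f) - eps ℂ r k • (X k * pderiv i f) := by
  simp [rot]

/-- The matrix of the infinitesimal rotation `rot`. -/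
noncomputable def rotMat (r : ℕ) {m : ℕ} (i k : Fin m) : Matrix (Fin m) (Fin m) ℝ :=
  Matrix.single k i (eps ℝ r i) - Matrix.single i k (eps ℝ r k)

theorem rot_X (i k a : Fin m) :
    rot r i k (X a) = ∑ b, ((rotMat r i k a b : ℝ) : ℂ) • (X b : Pol m) := by
  have e (i : Fin m) : ((eps ℝ r i : ℝ) : ℂ) = eps ℂ r i := by unfold eps; split_ifs <;> simp
  have h (i k : Fin m) : ∑ b, ((Matrix.single k i (eps ℝ r i) a b : ℝ) : ℂ) • (X b : Pol m) =
      eps ℂ r i • (X i * pderiv k (X a)) := by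
    rw [Finset.sum_eq_single i]
    · rcases eq_or_ne k a with rfl | hk
      · simp [e]
      · simp [Matrix.single, pderiv_X_of_ne hk.symm, hk]
    · intro b _ hb
      simp [Matrix.single, hb.symm]
    · simp
  rw [rot_apply, ← h i k, ← h k i, ← Finset.sum_sub_distrib]
  exact Finset.sum_congr rfl fun b _ => by
    rw [rotMat, Matrix.sub_apply, Complex.ofReal_sub, sub_smul]

theorem rotMat_skew (i k : Fin m) : (rotMat r i k)ᵀ * Matrix.diagonal (eps ℝ r) =
    -(Matrix.diagonal (eps ℝ r) * rotMat r i k) := by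
  ext a b
  rw [Matrix.mul_diagonal, Matrix.neg_apply, Matrix.diagonal_mul]
  have h (i k a b : Fin m) : (if k = b ∧ i = a then eps ℝ r i else 0) * eps ℝ r b =
      eps ℝ r a * if i = a ∧ k = b then eps ℝ r k else 0 := by
    by_cases hab : i = a ∧ k = b
    · rw [if_pos hab, if_pos hab.symm, hab.1, hab.2]
    · rw [if_neg hab, if_neg fun h => hab h.symm, zero_mul, mul_zero]
  simp only [rotMat, Matrix.transpose_apply, Matrix.sub_apply, Matrix.single_apply]
  rw [sub_mul, h i k a b, h k i a b]
  ring

theorem box_X_mul (i : Fin m) (f : Pol m) :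
    box r m (X i * f) = X i * box r m f + (2 * eps ℂ r i) • pderiv i f := by
  have h (k : Fin m) : eps ℂ r k • pderiv k (pderiv k (X i * f)) =
      X i * (eps ℂ r k • pderiv k (pderiv k f)) +
        if k = i then (2 * eps ℂ r i) • pderiv i f else 0 := by
    rcases eq_or_ne k i with rfl | hk
    · simp only [Derivation.leibniz, smul_eq_mul, pderiv_X_self, map_add, mul_one, if_true,
        smul_eq_C_mul, map_mul, map_ofNat]
      ring
    · simp only [Derivation.leibniz, smul_eq_mul, pderiv_X_of_ne hk.symm, mul_zero, add_zero,
        if_neg hk, mul_smul_comm]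
  simp only [box_apply, h, Finset.sum_add_distrib, Finset.mul_sum, Finset.sum_ite_eq',
    Finset.mem_univ, if_true]

theorem euler_X_mul (i : Fin m) (f : Pol m) :
    euler m (X i * f) = X i * euler m f + X i * f := by
  have hX : euler m (X i) = X i := by
    rw [euler_apply, Finset.sum_eq_single i]
    · simp
    · intro k _ hk
      simp [pderiv_X_of_ne hk.symm]
    · simp
  rw [euler_mul, hX, mul_comm f]

theorem rot_mem_harm (i k : Fin m) {j : ℕ} {f : Pol m} (hf : f ∈ harm r m j) :
    rot r i k f ∈ harm r m j := by
  obtain ⟨h1, h2⟩ := mem_harm_iff.1 hf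
  have hb (a : Fin m) : box r m (pderiv a f) = pderiv a (box r m f) := by
    simp only [box_apply, map_sum, Derivation.map_smul, pderiv_comm a]
  refine mem_harm_iff.2 ⟨?_, ?_⟩
  · rw [rot_apply, map_sub, map_smul, map_smul, euler_X_mul, euler_X_mul, euler_pderiv_of h1,
      euler_pderiv_of h1]
    simp only [mul_smul_comm]
    module
  · rw [rot_apply, map_sub, map_smul, map_smul, box_X_mul, box_X_mul, hb, hb, h2, map_zero,
      map_zero, mul_zero, mul_zero, zero_add, zero_add, pderiv_comm i k, smul_smul, smul_smul,
      ← sub_smul]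
    rw [show eps ℂ r i * (2 * eps ℂ r i) - eps ℂ r k * (2 * eps ℂ r k) = 0 by
      linear_combination 2 * eps_mul_self r i - 2 * eps_mul_self r k, zero_smul]

/-- The Casimir operator as a signed sum of squares of rotations; each pair i ≠ k occurs twice,
hence the factor 2. Thus whatever commutes with all rotations commutes with `casimir`. -/
theorem sum_rot_rot (f : Pol m) :
    ∑ i, ∑ k, (eps ℂ r i * eps ℂ r k) • rot r i k (rot r i k f) = (2 : ℂ) • casimir r m f := by
  have hE : euler m (euler m f) = ∑ i, ∑ k, X i * (X k * pderiv k (pderiv i f)) +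
      euler m f := by
    have (i : Fin m) : X i * euler m (pderiv i f) = ∑ k, X i * (X k * pderiv k (pderiv i f)) := by
      rw [euler_apply, Finset.mul_sum]
    simp only [← this]
    conv_lhs => rw [euler_apply]
    conv_rhs => rw [euler_apply m f]
    rw [← Finset.sum_add_distrib]
    refine Finset.sum_congr rfl fun i _ => ?_
    rw [euler_pderiv]
    ring
  have hQ : quad r m * box r m f = ∑ i, ∑ k, (eps ℂ r i * eps ℂ r k) •
      (X i * (X i * pderiv k (pderiv k f))) := by
    rw [quad_eq_sum_mul, box_apply, Finset.sum_mul_sum]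
    exact Finset.sum_congr rfl fun i _ => Finset.sum_congr rfl fun k _ => by
      rw [smul_mul_smul_comm, mul_assoc]
  have hd (a i k : Fin m) (h : Pol m) : pderiv a (X i * h) =
      (if a = i then h else 0) + X i * pderiv a h := by
    rw [Derivation.leibniz, smul_eq_mul, smul_eq_mul, add_comm]
    congr 1
    split_ifs with hai
    · rw [hai, pderiv_X_self, mul_one]
    · rw [pderiv_X_of_ne (Ne.symm hai), mul_zero]
  have hterm (i k : Fin m) : (eps ℂ r i * eps ℂ r k) • rot r i k (rot r i k f) =
      ((eps ℂ r i * eps ℂ r k) • (X i * (X i * pderiv k (pderiv k f))) +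
        (eps ℂ r k * eps ℂ r i) • (X k * (X k * pderiv i (pderiv i f)))) +
      (if i = k then (2 : ℂ) • (X i * pderiv i f) else 0) -
      (X i * pderiv i f + X k * pderiv k f) -
      (X i * (X k * pderiv k (pderiv i f)) + X k * (X i * pderiv i (pderiv k f))) := by
    have ei : (C (eps ℂ r i) : Pol m) * C (eps ℂ r i) = 1 := by
      rw [← C_mul, eps_mul_self, C_1]
    have ek : (C (eps ℂ r k) : Pol m) * C (eps ℂ r k) = 1 := by
      rw [← C_mul, eps_mul_self, C_1]
    simp only [rot_apply, map_sub, Derivation.map_smul, hd _ _ k]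
    rcases eq_or_ne i k with rfl | hik
    · simp only [sub_self, smul_zero, if_true, smul_eq_C_mul, map_mul, map_ofNat]
      linear_combination (-2 * (X i * (X i * pderiv i (pderiv i f)))) * ei
    · simp only [if_neg hik, if_neg hik.symm, if_true, smul_eq_C_mul, map_mul, zero_add,
        pderiv_comm k i]
      linear_combination (C (eps ℂ r i) * C (eps ℂ r k) * (X i * (X i * pderiv k (pderiv k f))) -
        (X i * pderiv i f + X k * pderiv k f + 2 * X i * X k * pderiv i (pderiv k f)) *
          (C (eps ℂ r k) * C (eps ℂ r k))) * ei +
        (C (eps ℂ r i) * C (eps ℂ r k) * (X k * (X k * pderiv i (pderiv i f))) -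
        (X i * pderiv i f + X k * pderiv k f + 2 * X i * X k * pderiv i (pderiv k f))) * ek
  have hQ' := hQ.trans Finset.sum_comm
  have hE' := hE
  rw [Finset.sum_comm] at hE'
  have h1 : ∑ i : Fin m, ∑ k : Fin m, (if i = k then (2 : ℂ) • (X i * pderiv i f) else 0) =
      (2 : ℂ) • euler m f := by
    simp [euler_apply, Finset.smul_sum]
  have h2 : ∑ i : Fin m, ∑ _k : Fin m, X i * pderiv i f = (m : ℂ) • euler m f := by
    simp [euler_apply, Finset.mul_sum, smul_eq_C_mul]
  have h3 : ∑ _i : Fin m, ∑ k : Fin m, X k * pderiv k f = (m : ℂ) • euler m f := by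
    simp [euler_apply, smul_eq_C_mul]
  simp only [hterm, Finset.sum_add_distrib, Finset.sum_sub_distrib, ← hQ, ← hQ', h1, h2, h3]
  rw [eq_sub_iff_add_eq.2 hE.symm, eq_sub_iff_add_eq.2 hE'.symm, casimir_apply]
  module

end Rotations


/-! ### Branching of harmonic polynomials -/

section Branching

variable {r m : ℕ}

/-- The map `g ↦ g w` of `H^j(ℝ^{p-1,q-2})` into polynomials in one more variable. -/
noncomputable def branchMap (r m : ℕ) (lam : ℂ) (K j : ℕ) : harm r m j →ₗ[ℂ] Pol (m + 1) :=
  LinearMap.mulRight ℂ (w r m lam K) ∘ₗ (emb m).toLinearMap ∘ₗ (harm r m j).subtype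

theorem branchMap_apply (lam : ℂ) (K j : ℕ) (h : harm r m j) :
    branchMap r m lam K j h = emb m h * w r m lam K := rfl

theorem branchMap_injective (hm : 0 < m) (lam : ℂ) (K j : ℕ) :
    Function.Injective (branchMap r m lam K j) := by
  intro g h hgh
  have h1 := mul_right_cancel₀ (w_ne_zero r hm lam K) hgh
  exact Subtype.ext (rename_injective _ (Fin.castSucc_injective m) h1)

theorem isBranching_branchMap {l K j : ℕ} (hj : K + j = l + 1) :
    IsBranching r m (l + 1) j (branchMap r m (l : ℂ) K j) := by
  refine ⟨fun h => emb_mul_w_mem_harm h.2 hj, fun A hA f f' hf => ?_⟩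
  rw [branchMap_apply, branchMap_apply, map_mul, substPrime_emb, hA.substPrime_w, hf]

theorem rot_of_equivariant {j : ℕ} {R : harm r m j →ₗ[ℂ] Pol m}
    (hR : ∀ A, InO r A → ∀ f f' : harm r m j, (f' : Pol m) = subst A (f : Pol m) →
      R f' = subst A (R f)) (i k : Fin m) (f : harm r m j) :
    R ⟨rot r i k f, rot_mem_harm i k f.2⟩ = rot r i k (R f) := by
  -- An arbitrary linear extension of R to all polynomials: its coefficients are functionals to
  -- which the derivative formula applies, and along the curve only its values on harmonic
  -- polynomials matter.
  obtain ⟨R', hR'⟩ := LinearMap.exists_extend R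
  have hR1 (f : harm r m j) : R' f = R f := LinearMap.congr_fun hR' f
  have h0 : NormedSpace.exp ((0 : ℝ) • rotMat r i k) = 1 := by
    rw [zero_smul, NormedSpace.exp_zero]
  have hd := hasDerivAt_exp_apply (rotMat r i k)
  ext α
  have h1 := hasDerivAt_subst h0 hd (rot r i k) (rot_X i k) (f : Pol m) (lcoeff ℂ α ∘ₗ R')
  have h2 := hasDerivAt_subst h0 hd (rot r i k) (rot_X i k) (R f) (lcoeff ℂ α)
  have h3 (t : ℝ) : (lcoeff ℂ α ∘ₗ R') (subst (NormedSpace.exp (t • rotMat r i k)) (f : Pol m)) =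
      lcoeff ℂ α (subst (NormedSpace.exp (t • rotMat r i k)) (R f)) := by
    have hA := inO_exp (rotMat_skew (r := r) i k) t
    rw [LinearMap.comp_apply, ← hR _ hA f ⟨_, hA.subst_mem_harm f.2⟩ rfl, ← hR1]
  simp only [h3] at h1
  have h4 := h1.unique h2
  rw [LinearMap.comp_apply] at h4
  rw [← hR1]
  exact h4

theorem casimir_of_equivariant {j : ℕ} {R : harm r m j →ₗ[ℂ] Pol m}
    (hR : ∀ A, InO r A → ∀ f f' : harm r m j, (f' : Pol m) = subst A (f : Pol m) →
      R f' = subst A (R f)) (f : harm r m j) :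
    casimir r m (R f) = (-(j * (j + m - 2) : ℂ)) • R f := by
  have h1 : (∑ i, ∑ k, (eps ℂ r i * eps ℂ r k) • (⟨rot r i k (rot r i k f),
      rot_mem_harm i k (rot_mem_harm i k f.2)⟩ : harm r m j)) =
      (2 : ℂ) • (-(j * (j + m - 2) : ℂ)) • f := by
    apply Subtype.ext
    simp only [Submodule.coe_sum, Submodule.coe_smul]
    rw [sum_rot_rot, casimir_of_mem_harm f.2]
  have h2 := congrArg R h1
  simp only [map_sum, map_smul] at h2
  have h3 (i k : Fin m) : R ⟨rot r i k (rot r i k f), rot_mem_harm i k (rot_mem_harm i k f.2)⟩ =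
      rot r i k (rot r i k (R f)) := by
    rw [← rot_of_equivariant hR i k f]
    exact rot_of_equivariant hR i k ⟨rot r i k f, rot_mem_harm i k f.2⟩
  simp only [h3, sum_rot_rot] at h2
  exact smul_right_injective _ (two_ne_zero' ℂ) h2

/-- Taking the component of ξ_n^a commutes with O(p-1,q-2), so each component of T f is a Casimir
eigenvector with the eigenvalue of H^j. Its leading components then match those of some h w_K, and
harmonicity propagates the match to all components. -/
theorem IsBranching.range_le (hm : 2 ≤ m) {l K j : ℕ} (hj : K + j = l + 1)
    {T : harm r m j →ₗ[ℂ] Pol (m + 1)} (hT : IsBranching r m (l + 1) j T) :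
    LinearMap.range T ≤ LinearMap.range (branchMap r m (l : ℂ) K j) := by
  rintro _ ⟨f, rfl⟩
  obtain ⟨he, hb⟩ := mem_harm_iff.1 (hT.1 f)
  have hc (a : ℕ) : casimir r m (cmp a (T f)) = (-(j * (j + m - 2) : ℂ)) • cmp a (T f) :=
    casimir_of_equivariant (R := cmp a ∘ₗ T) (fun A hA f f' hf => by
      rw [LinearMap.comp_apply, LinearMap.comp_apply, hT.2 A hA f f' hf, cmp_substPrime]) f
  rw [← hj] at he
  obtain ⟨h, hh, hcmp⟩ := exists_cmp_eq_cmp_emb_mul_w hm (l : ℂ) he hc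
  refine ⟨⟨h, hh⟩, ?_⟩
  rw [branchMap_apply]
  exact (eq_of_box_eq_zero hb (mem_harm_iff.1 (emb_mul_w_mem_harm hh hj)).2 (hcmp 0 (by omega))
    (hcmp 1 le_rfl)).symm

theorem branch_eq_range (hm : 2 ≤ m) {l K j : ℕ} (hj : K + j = l + 1) :
    branch r m (l + 1) j = LinearMap.range (branchMap r m (l : ℂ) K j) :=
  le_antisymm (iSup₂_le fun _ hT => hT.range_le hm hj)
    (le_iSup₂_of_le _ (isBranching_branchMap hj) le_rfl)

end Branching


/-! ### The decomposition of the space of solutions -/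

section Decomposition

variable {r m : ℕ} {lam : ℂ}

/-- The Euler operator in the first `m` variables. -/
noncomputable def eulerPrime (m : ℕ) : Pol (m + 1) →ₗ[ℂ] Pol (m + 1) :=
  ∑ i : Fin m, LinearMap.mulLeft ℂ (X i.castSucc) ∘ₗ (pderiv i.castSucc).toLinearMap

/-- The Casimir operator in the first `m` variables. -/
noncomputable def casimirPrime (r m : ℕ) : Pol (m + 1) →ₗ[ℂ] Pol (m + 1) :=
  LinearMap.mulLeft ℂ (emb m (quad r m)) ∘ₗ (∑ i : Fin m, eps ℂ r i •
    ((pderiv i.castSucc).toLinearMap ∘ₗ (pderiv i.castSucc).toLinearMap)) -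
      eulerPrime m ∘ₗ eulerPrime m - ((m : ℂ) - 2) • eulerPrime m

theorem cmp_eulerPrime (a : ℕ) (f : Pol (m + 1)) :
    cmp a (eulerPrime m f) = euler m (cmp a f) := by
  simp [eulerPrime, euler_apply, cmp_X_castSucc_mul, cmp_pderiv_castSucc]

theorem cmp_casimirPrime (a : ℕ) (f : Pol (m + 1)) :
    cmp a (casimirPrime r m f) = casimir r m (cmp a f) := by
  simp [casimirPrime, casimir_apply, box_apply, cmp_emb_mul, cmp_eulerPrime, cmp_pderiv_castSucc,
    Finset.mul_sum]

theorem casimir_quad_pow_mul (k : ℕ) (f : Pol m) :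
    casimir r m (quad r m ^ k * f) = quad r m ^ k * casimir r m f := by
  induction k with
  | zero => simp
  | succ k ih => rw [pow_succ', mul_assoc, casimir_quad_mul, ih, mul_assoc]

theorem casimirPrime_emb_mul_w {h : Pol m} {j : ℕ} (hh : h ∈ harm r m j) (K : ℕ) :
    casimirPrime r m (emb m h * w r m lam K) =
      (-(j * (j + m - 2) : ℂ)) • (emb m h * w r m lam K) := by
  refine ext_cmp fun a => ?_
  rw [cmp_casimirPrime, map_smul, cmp_emb_mul, cmp_w, Finset.mul_sum, map_sum, Finset.smul_sum]
  refine Finset.sum_congr rfl fun k _ => ?_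
  split_ifs
  · rw [mul_smul_comm, mul_comm h, map_smul, casimir_quad_pow_mul, casimir_of_mem_harm hh,
      mul_smul_comm, smul_comm]
  · rw [mul_zero, map_zero, smul_zero]

/-- The Euler operator and the Casimir operator in ξ' are combined into E + iC', whose real and
imaginary eigenvalue parts record the degree and the Casimir eigenvalue. The degree alone would not
separate w_{λ+1} from the H'_j. -/
theorem iSupIndep_span_w_branch (hm : 2 ≤ m) (l : ℕ) : iSupIndep (Sum.elim
    (fun K : ℕ => Submodule.span ℂ {w r m (l : ℂ) K})
    (fun j : Finset.Icc 1 (l + 1) => branch r m (l + 1) j)) := by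
  have hop {h : Pol m} {j K : ℕ} (hh : h ∈ harm r m j) :
      emb m h * w r m (l : ℂ) K ∈ Module.End.eigenspace
        (euler (m + 1) + Complex.I • casimirPrime r m)
        (((K + j : ℝ) : ℂ) + (-(j * (j + m - 2) : ℝ) : ℂ) * Complex.I) := by
    have he : euler (m + 1) (emb m h) = (j : ℂ) • emb m h := by
      have h1 := (mem_homogeneousSubmodule_iff_euler h j).1 hh.1
      rw [← mem_homogeneousSubmodule_iff_euler] at h1 ⊢
      exact IsHomogeneous.rename_isHomogeneous h1
    refine Module.End.mem_eigenspace_iff.2 ?_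
    rw [LinearMap.add_apply, LinearMap.smul_apply, casimirPrime_emb_mul_w hh, euler_mul, he,
      euler_w, mul_smul_comm, mul_smul_comm, mul_comm (w _ _ _ _)]
    push_cast
    module
  -- For m ≥ 2 the function j(j+m-2) is positive and strictly increasing on j ≥ 1, so these
  -- eigenvalues are pairwise distinct.
  let μ : ℕ ⊕ Finset.Icc 1 (l + 1) → ℂ := Sum.elim (fun K => K)
    fun j => ((l + 1 : ℝ) : ℂ) + (-(j.1 * (j.1 + m - 2) : ℝ) : ℂ) * Complex.I
  have hm' : (2 : ℝ) ≤ m := by exact_mod_cast hm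
  have hμ : Function.Injective μ := by
    have hj (j : Finset.Icc 1 (l + 1)) : (1 : ℝ) ≤ j.1 := by
      exact_mod_cast (Finset.mem_Icc.1 j.2).1
    have him (j : Finset.Icc 1 (l + 1)) : (μ (Sum.inr j)).im = -(j.1 * (j.1 + m - 2) : ℝ) := by
      simp [μ]
    have him' (K : ℕ) : (μ (Sum.inl K)).im = 0 := by simp [μ]
    rintro (K | j) (K' | j') h
    · exact congrArg _ (Nat.cast_injective (R := ℂ) h)
    · have h1 := congrArg Complex.im h
      rw [him, him'] at h1
      nlinarith [hj j']
    · have h1 := congrArg Complex.im h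
      rw [him, him'] at h1
      nlinarith [hj j]
    · have h1 := congrArg Complex.im h
      rw [him, him] at h1
      have h2 : ((j.1 : ℝ) - j'.1) * (j.1 + j'.1 + m - 2) = 0 := by linear_combination -h1
      have h3 : ((j.1 : ℝ) - j'.1) = 0 := by
        refine (mul_eq_zero.1 h2).resolve_right ?_
        linarith [hj j, hj j']
      exact congrArg _ (Subtype.ext (Nat.cast_injective (R := ℝ) (sub_eq_zero.1 h3)))
  refine ((Module.End.eigenspaces_iSupIndep
    (euler (m + 1) + Complex.I • casimirPrime r m)).comp hμ).mono ?_
  rintro (K | j)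
  · refine (Submodule.span_singleton_le_iff_mem _ _).2 ?_
    have := hop (K := K) (one_mem_harm r m)
    simpa [μ] using this
  · have hj := (Finset.mem_Icc.1 j.2).2
    change branch r m (l + 1) j ≤ _
    rw [branch_eq_range hm (Nat.sub_add_cancel hj)]
    rintro _ ⟨h, rfl⟩
    have h1 := hop (K := l + 1 - j) h.2
    have e : ((l + 1 - j.1 : ℕ) : ℝ) + j.1 = l + 1 := by
      exact_mod_cast Nat.sub_add_cancel hj
    rw [e] at h1
    exact h1

theorem iSupIndep_span_w (r m : ℕ) (lam : ℂ) :
    iSupIndep fun K : ℕ => Submodule.span ℂ {w r m lam K} := by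
  have h := (Module.End.eigenspaces_iSupIndep (euler (m + 1))).comp
    (Nat.cast_injective (R := ℂ))
  refine h.mono fun K => ?_
  rw [Submodule.span_singleton_le_iff_mem]
  exact Module.End.mem_eigenspace_iff.2 (euler_w r m lam K)

theorem span_w_le_Sol (r m : ℕ) (lam : ℂ) (K : ℕ) :
    Submodule.span ℂ {w r m lam K} ≤ Sol r m lam :=
  (Submodule.span_singleton_le_iff_mem _ _).2 (w_mem_Sol r m lam K)

/-- Degree 0 needs its own argument: for λ = -1, which is not a natural number, λ - K + 1 vanishes
at K = 0. -/
theorem mem_span_w_zero (hm : 0 < m) {f : Pol (m + 1)}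
    (he : euler (m + 1) f = ((0 : ℕ) : ℂ) • f) : f ∈ Submodule.span ℂ {w r m lam 0} := by
  have h (f : Pol (m + 1)) (he : euler (m + 1) f = ((0 : ℕ) : ℂ) • f) : f = C (coeff 0 f) :=
    totalDegree_eq_zero_iff_eq_C.1 (Nat.le_zero.1 (IsHomogeneous.totalDegree_le
      ((mem_homogeneousSubmodule_iff_euler f 0).2 he)))
  have hw := h _ (euler_w r m lam 0)
  have h0 : coeff 0 (w r m lam 0) ≠ 0 := fun h0 => by
    rw [h0, C_0] at hw
    exact w_ne_zero r hm lam 0 hw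
  refine Submodule.mem_span_singleton.2 ⟨coeff 0 f / coeff 0 (w r m lam 0), ?_⟩
  rw [hw, h f he, smul_eq_C_mul, ← C_mul, coeff_zero_C, coeff_zero_C, div_mul_cancel₀ _ h0]

theorem iSup_span_w_eq_Sol (hm : 2 ≤ m) (hl : ¬ ∃ l : ℕ, lam = l) :
    ⨆ K : ℕ, Submodule.span ℂ {w r m lam K} = Sol r m lam := by
  refine le_antisymm (iSup_le fun K => span_w_le_Sol r m lam K) (Sol_le _ fun K f hf he => ?_)
  refine Submodule.mem_iSup_of_mem K ?_
  rcases K with _ | K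
  · exact mem_span_w_zero (by omega) he
  · refine mem_span_w_of_mem_Sol hm (fun h => hl ⟨K, ?_⟩) hf he
    push_cast at h
    linear_combination h

theorem iSup_span_w_sup_branch_eq_Sol (hm : 2 ≤ m) (l : ℕ) :
    (⨆ K : ℕ, Submodule.span ℂ {w r m (l : ℂ) K}) ⊔
      (⨆ j : Finset.Icc 1 (l + 1), branch r m (l + 1) j) = Sol r m (l : ℂ) := by
  apply le_antisymm
  · refine sup_le (iSup_le fun K => span_w_le_Sol r m l K) (iSup_le fun j => ?_)
    refine iSup₂_le fun T hT => ?_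
    rintro _ ⟨f, rfl⟩
    exact (mem_Sol_iff_mem_harm (by omega) l (mem_harm_iff.1 (hT.1 f)).1).2 (hT.1 f)
  · refine Sol_le _ fun K f hf he => ?_
    by_cases hK : K = l + 1
    · subst hK
      refine harm_le hm l _ (fun j hj h hh => ?_) ((mem_Sol_iff_mem_harm (by omega) l he).1 hf)
      rcases Nat.eq_zero_or_pos j with rfl | hj0
      · exact Submodule.mem_sup_left (Submodule.mem_iSup_of_mem _ (emb_mul_w_of_mem_harm_zero hh _))
      · refine Submodule.mem_sup_right (Submodule.mem_iSup_of_mem ⟨j, Finset.mem_Icc.2 ⟨hj0, hj⟩⟩ ?_)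
        rw [branch_eq_range hm (Nat.sub_add_cancel hj)]
        exact ⟨⟨h, hh⟩, rfl⟩
    · refine Submodule.mem_sup_left (Submodule.mem_iSup_of_mem K
        (mem_span_w_of_mem_Sol hm (fun h => hK ?_) hf he))
      have : (K : ℂ) = (l + 1 : ℕ) := by push_cast; linear_combination -h
      exact_mod_cast this

/-- For i < n the basis vector Y_i of 𝔫₋ fixes e_n infinitesimally, so it lies in 𝔤', and it acts as
iξ_i. Repeated action on w_K yields h(ξ') w_K for every polynomial h, harmonic or not. -/
theorem map_phi_branch_le (hm : 2 ≤ m) {l K j : ℕ} (hj : K + j = l + 1) :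
    (branch r m (l + 1) j).map (phi r m (l : ℂ)).toLinearMap ≤
      gPrimeSpan (phi r m (l : ℂ) (w r m (l : ℂ) K)) := by
  refine le_sInf fun W hW => ?_
  obtain ⟨h1, h2⟩ := hW
  rw [branch_eq_range hm hj]
  have hX (i : Fin m) (f : Pol (m + 1)) (hf : phi r m (l : ℂ) f ∈ W) :
      phi r m (l : ℂ) (X i.castSucc * f) ∈ W := by
    have hZ : InGPrime (negElt r i.castSucc : g r m) := by
      rintro (_ | a | _)
      · rfl
      · rfl
      · simp [negElt, negMat, (Fin.castSucc_lt_last i).ne']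
    have h3 := h2 _ hZ _ hf
    rw [vermaAct_phi, tildeOp_negElt, map_smul] at h3
    exact (Submodule.smul_mem_iff _ Complex.I_ne_zero).1 h3
  have h4 (h : Pol m) : phi r m (l : ℂ) (emb m h * w r m (l : ℂ) K) ∈ W := by
    induction h using MvPolynomial.induction_on with
    | C c =>
      have : emb m (C c) * w r m (l : ℂ) K = c • w r m (l : ℂ) K := by
        simp [emb, smul_eq_C_mul]
      rw [this, map_smul]
      exact W.smul_mem _ h1
    | add p q hp hq =>
      rw [map_add, add_mul, map_add]
      exact W.add_mem hp hq
    | mul_X p i hp =>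
      have : emb m (p * X i) * w r m (l : ℂ) K =
          X i.castSucc * (emb m p * w r m (l : ℂ) K) := by
        simp only [emb, map_mul, rename_X]
        ring
      rw [this]
      exact hX i _ hp
  rintro _ ⟨_, ⟨h, rfl⟩, rfl⟩
  exact h4 h

end Decomposition

end FMethod

/-! ### The theorem for SO_o(p,q) and SO_o(p,q-1) -/

theorem mainTheorem1 (p q : ℕ) (hp : 1 ≤ p) (hq : 2 ≤ q) (hpq : 4 < p + q) (lam : ℂ) :
    -- (1)
    (∀ f : FMethod.Pol (p + q - 3 + 1), f ∈ FMethod.Sol (p - 1) (p + q - 3) lam ↔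
      ∀ j : Fin (p + q - 3), FMethod.P (p - 1) (p + q - 3 + 1) lam j.castSucc f = 0) ∧
    -- the vectors `w_{K,λ}` are non-zero
    (∀ K : ℕ, FMethod.w (p - 1) (p + q - 3) lam K ≠ 0) ∧
    -- (2), the space of solutions for `λ ∉ ℕ`
    ((¬ ∃ l : ℕ, lam = l) →
      iSupIndep (fun K : ℕ => Submodule.span ℂ {FMethod.w (p - 1) (p + q - 3) lam K}) ∧
      (⨆ K : ℕ, Submodule.span ℂ {FMethod.w (p - 1) (p + q - 3) lam K}) =
        FMethod.Sol (p - 1) (p + q - 3) lam) ∧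
    -- (3), the space of solutions for `λ = l ∈ ℕ`; the summands `H'_j`, `1 ≤ j ≤ l + 1`
    (∀ l : ℕ, lam = l →
      (∀ j ∈ Finset.Icc 1 (l + 1),
        ∃ T : FMethod.harm (p - 1) (p + q - 3) j →ₗ[ℂ] FMethod.Pol (p + q - 3 + 1),
          FMethod.IsBranching (p - 1) (p + q - 3) (l + 1) j T ∧ Function.Injective T ∧
          LinearMap.range T = FMethod.branch (p - 1) (p + q - 3) (l + 1) j) ∧
      iSupIndep (Sum.elim
        (fun K : ℕ => Submodule.span ℂ {FMethod.w (p - 1) (p + q - 3) lam K})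
        (fun j : Finset.Icc 1 (l + 1) => FMethod.branch (p - 1) (p + q - 3) (l + 1) j)) ∧
      (⨆ K : ℕ, Submodule.span ℂ {FMethod.w (p - 1) (p + q - 3) lam K}) ⊔
          (⨆ j : Finset.Icc 1 (l + 1), FMethod.branch (p - 1) (p + q - 3) (l + 1) j) =
        FMethod.Sol (p - 1) (p + q - 3) lam) ∧
    -- the inverse Fourier transform `φ`
    ∃ φ : FMethod.Pol (p + q - 3 + 1) ≃ₗ[ℂ] FMethod.Verma (p - 1) (p + q - 3) lam,
      FMethod.IsPhi φ ∧ (∀ ψ, FMethod.IsPhi ψ → ψ = φ) ∧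
      -- `φ` is an `L'`-isomorphism of `Sol` onto the space of singular vectors
      (FMethod.Sol (p - 1) (p + q - 3) lam).map φ.toLinearMap =
        FMethod.singular (p - 1) (p + q - 3) lam ∧
      (∀ (a : GL (FMethod.Idx (p + q - 3)) ℝ) (ha : FMethod.InLPrime (p - 1) a),
        ∀ f ∈ FMethod.Sol (p - 1) (p + q - 3) lam,
          FMethod.polLAct lam a f ∈ FMethod.Sol (p - 1) (p + q - 3) lam ∧
          φ (FMethod.polLAct lam a f) = FMethod.vermaLAct ha (φ f)) ∧
      -- (3), the submodules generated by `φ(w_{λ+1-j,λ})`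
      (∀ l : ℕ, lam = l → ∀ j ∈ Finset.Icc 1 (l + 1),
        (FMethod.branch (p - 1) (p + q - 3) (l + 1) j).map φ.toLinearMap ≤
          FMethod.gPrimeSpan (φ (FMethod.w (p - 1) (p + q - 3) lam (l + 1 - j)))) := by
  have hm : 2 ≤ p + q - 3 := by omega
  have hm' : 0 < p + q - 3 := by omega
  refine ⟨fun f => FMethod.mem_Sol_iff lam f, fun K => FMethod.w_ne_zero _ hm' lam K,
    fun hl => ⟨FMethod.iSupIndep_span_w _ _ lam, FMethod.iSup_span_w_eq_Sol hm hl⟩, ?_,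
    FMethod.phi _ _ lam, FMethod.isPhi_phi _ _ lam, fun ψ hψ => hψ.eq_phi,
    FMethod.map_phi_Sol _ _ lam,
    fun a ha f hf => ⟨FMethod.polLAct_mem_Sol ha hf, FMethod.phi_polLAct ha f⟩, ?_⟩
  · rintro l rfl
    refine ⟨fun j hj => ?_, FMethod.iSupIndep_span_w_branch hm l,
      FMethod.iSup_span_w_sup_branch_eq_Sol hm l⟩
    have h := Nat.sub_add_cancel (Finset.mem_Icc.1 hj).2
    -- The isomorphism of H^j onto H'_j is multiplication by w_{l+1-j}, the index for which degrees
    -- add up to l + 1.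
    exact ⟨FMethod.branchMap _ _ l (l + 1 - j) j, FMethod.isBranching_branchMap h,
      FMethod.branchMap_injective hm' _ _ _, (FMethod.branch_eq_range hm h).symm⟩
  · rintro l rfl j hj
    exact FMethod.map_phi_branch_le hm (Nat.sub_add_cancel (Finset.mem_Icc.1 hj).2)
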